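/- **Setting.** Let $\Omega\subset\mathbb R^N$ ($N\ge 1$) be a bounded open set with (at least Lipschitz) regular boundary $\partial\Omega=\Gamma_D\cup\Gamma_N$, where $\Gamma_D\cap\Gamma_N=\emptyset$ and $\mathcal H^{N-1}(\Gamma_D)>0$. Let $p>2$, $p'=p/(p-1)$, $T>0$, $Q=(0,T)\times\Omega$, and let $W^{1,p}_D(\Omega)$ be the space of functions in $W^{1,p}(\Omega)$ whose trace vanishes a.e. on $\Gamma_D$. Let $V\in[W^{1,p'}(\Omega)]^N$ with $\nabla\cdot V\in L^\infty(\Omega)$, let $u_0\in L^\infty(\Omega)$ and $f\in L^1(Q)$ (for instance $f\in L^{p'}(Q)$). Let $\mathrm{Sign}^+(r)=\{1\}$ if $r>0$, $[0,1]$ if $r=0$, and $\{0\}$ if $r<0$. A couple $(u,v)$ is a *weak solution* of $$\partial_t u-\nabla\cdot\big(|\nabla v|^{p-2}\nabla v-uV\big)=f,\quad u\in\mathrm{Sign}^+(v)\quad\text{in }Q,$$ with $v=0$ on $(0,T)\times\Gamma_D$, zero normal flux $(|\nabla v|^{p-2}\nabla v-uV)\cdot\nu=0$ on $(0,T)\times\Gamma_N$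 and $u(0)=u_0$, if $u\in C([0,T),L^1(\Omega))\cap L^\infty(Q)$, $v\in L^p(0,T;W^{1,p}_D(\Omega))$, $v\ge 0$ and $u\in\mathrm{Sign}^+(v)$ a.e. in $Q$, and $$-\iint_Q u\,\xi\,\psi'+\iint_Q\big(|\nabla v|^{p-2}\nabla v-uV\big)\cdot\nabla\xi\,\psi=\iint_Q f\,\xi\,\psi+\int_\Omega u_0\,\xi\,\psi(0)$$ for all $\xi\in W^{1,p}_D(\Omega)$ and $\psi\in\mathcal D([0,T))$ such that $f\xi\psi\in L^1(Q)$ (which is automatic if $f\in L^{p'}(Q)$). **Proposition 3.1.** Let $(u,v)$ be a weak solution and let $\beta\in C^1(\mathbb R)$ satisfy $\beta'\le 1$ and $\beta'(1)=1$. Then $\beta(u)$, $|\nabla v|^{p-2}\nabla v$, $\beta(u)V$, $\beta(u)\,\nabla\cdot V$, $u\,(\nabla\cdot V)\,\beta'(u)$ and $f\beta'(u)$ are locally integrable in $Q$, and $$\partial_t\beta(u)-\Delta_p v+V\cdot\nabla\beta(u)+u\,(\nabla\cdot V)\,\beta'(u)\le f\,\beta'(u)\quad\text{in }\mathcal D'(Q),$$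 where $\Delta_p v=\nabla\cdot(|\nabla v|^{p-2}\nabla v)$ and $V\cdot\nabla\beta(u)=\nabla\cdot(\beta(u)V)-\beta(u)\,\nabla\cdot V$ in $\mathcal D'(Q)$. That is, for every $0\le\varphi\in\mathcal D(Q)$, $$-\iint_Q\beta(u)\,\partial_t\varphi+\iint_Q|\nabla v|^{p-2}\nabla v\cdot\nabla\varphi-\iint_Q\beta(u)\,V\cdot\nabla\varphi-\iint_Q\beta(u)\,(\nabla\cdot V)\,\varphi+\iint_Q u\,(\nabla\cdot V)\,\beta'(u)\,\varphi\le\iint_Q f\,\beta'(u)\,\varphi .$$ -/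

import Mathlib

open MeasureTheory Set Filter Topology TopologicalSpace
open scoped ENNReal NNReal ContDiff Distributions

namespace CrowdMotion

/-- The Euclidean space `ℝ^N`. -/
abbrev Sp (N : ℕ) : Type := EuclideanSpace ℝ (Fin N)

/-- The boundary of `Ω` is (at least) Lipschitz: near each boundary point, and with respect to
a suitable direction `e` (the vertical axis of a rotated coordinate system), `Ω` is the strict
epigraph of a Lipschitz function of the component orthogonal to `e`. -/
def HasLipschitzBoundary {N : ℕ} (Ω : Set (Sp N)) : Prop :=
  ∀ x ∈ frontier Ω, ∃ r : ℝ, 0 < r ∧ ∃ e : Sp N, ‖e‖ = 1 ∧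
    ∃ (K : ℝ≥0) (γ : Sp N → ℝ), LipschitzWith K γ ∧
      Ω ∩ Metric.ball x r =
        {y | y ∈ Metric.ball x r ∧ γ (y - inner ℝ y e • e) < inner ℝ y e}

/-- The surface measure on `∂Ω`: the `(N-1)`-dimensional Hausdorff measure. -/
noncomputable def surface {N : ℕ} (Ω : Set (Sp N)) : Measure (Sp N) :=
  (Measure.hausdorffMeasure ((N : ℝ) - 1)).restrict (frontier Ω)

/-- `G` is the weak (distributional) gradient of `w` in `Ω`. -/
def HasWeakGradient {N : ℕ} (Ω : Opens (Sp N)) (w : Sp N → ℝ) (G : Sp N → Sp N) : Prop :=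
  LocallyIntegrableOn w Ω ∧ LocallyIntegrableOn G Ω ∧
    ∀ φ : 𝓓(Ω, ℝ),
      ∫ x in (Ω : Set (Sp N)), w x • gradient φ x = - ∫ x in (Ω : Set (Sp N)), φ x • G x

/-- `d` is the weak (distributional) divergence of the vector field `V` in `Ω`. -/
def HasWeakDivergence {N : ℕ} (Ω : Opens (Sp N)) (V : Sp N → Sp N) (d : Sp N → ℝ) : Prop :=
  LocallyIntegrableOn V Ω ∧ LocallyIntegrableOn d Ω ∧
    ∀ φ : 𝓓(Ω, ℝ),
      ∫ x in (Ω : Set (Sp N)), inner ℝ (V x) (gradient φ x)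
        = - ∫ x in (Ω : Set (Sp N)), d x * φ x

/-- `w ∈ W^{1,q}(Ω)`, with weak gradient `G`. -/
def MemW1 {N : ℕ} (q : ℝ≥0∞) (Ω : Opens (Sp N)) (w : Sp N → ℝ) (G : Sp N → Sp N) : Prop :=
  MemLp w q (volume.restrict Ω) ∧ MemLp G q (volume.restrict Ω) ∧ HasWeakGradient Ω w G

/-- `V ∈ [W^{1,q}(Ω)]^N`: every component belongs to `W^{1,q}(Ω)`. -/
def MemW1Vec {N : ℕ} (q : ℝ≥0∞) (Ω : Opens (Sp N)) (V : Sp N → Sp N) : Prop :=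
  ∀ i : Fin N, ∃ G : Sp N → Sp N, MemW1 q Ω (fun x => V x i) G

/-- `g ∈ L^q(∂Ω)` is the trace on `∂Ω` of `w ∈ W^{1,q}(Ω)` (with weak gradient `G`): the trace
operator is the continuous extension to `W^{1,q}(Ω)` of the restriction to `∂Ω` of functions that
are smooth up to the boundary. -/
def HasTrace {N : ℕ} (q : ℝ≥0∞) (Ω : Opens (Sp N)) (w : Sp N → ℝ) (G : Sp N → Sp N)
    (g : Sp N → ℝ) : Prop :=
  MemLp g q (surface (Ω : Set (Sp N))) ∧
    ∃ φ : ℕ → Sp N → ℝ, (∀ n, ContDiff ℝ ∞ (φ n)) ∧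
      Tendsto (fun n => eLpNorm (fun x => φ n x - w x) q (volume.restrict Ω)) atTop (𝓝 0) ∧
      Tendsto (fun n => eLpNorm (fun x => gradient (φ n) x - G x) q (volume.restrict Ω))
        atTop (𝓝 0) ∧
      Tendsto (fun n => eLpNorm (fun x => φ n x - g x) q (surface (Ω : Set (Sp N))))
        atTop (𝓝 0)

/-- `w ∈ W^{1,q}_D(Ω)`, with weak gradient `G`: `w ∈ W^{1,q}(Ω)` and the trace of `w` vanishes
almost everywhere on `Γ_D`. -/
def MemW1D {N : ℕ} (q : ℝ≥0∞) (Ω : Opens (Sp N)) (ΓD : Set (Sp N))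
    (w : Sp N → ℝ) (G : Sp N → Sp N) : Prop :=
  MemW1 q Ω w G ∧
    ∃ g : Sp N → ℝ, HasTrace q Ω w G g ∧ ∀ᵐ x ∂(surface (Ω : Set (Sp N))), x ∈ ΓD → g x = 0

/-- The space-time cylinder `Q = (0,T) × Ω`. -/
def cylinder {N : ℕ} (T : ℝ) (Ω : Opens (Sp N)) : Opens (ℝ × Sp N) :=
  ⟨Ioo 0 T ×ˢ (Ω : Set (Sp N)), isOpen_Ioo.prod Ω.isOpen⟩

/-- The maximal monotone graph `Sign⁺`. -/
noncomputable def signPlus (r : ℝ) : Set ℝ :=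
  if 0 < r then {1} else if r = 0 then Icc 0 1 else {0}

/-- The vector `|ζ|^{p-2} ζ`. -/
noncomputable def pflux {N : ℕ} (p : ℝ) (ζ : Sp N) : Sp N := ‖ζ‖ ^ (p - 2) • ζ

/-- `(u,v)` is a weak solution of the evolution problem with exponent `p`, final time `T`,
Dirichlet part `Γ_D` of the boundary, velocity field `V`, source `f` and initial datum `u₀`.
The function `Dv` is the weak spatial gradient of `v` (determined a.e. in `Q` by `v`).

Elements `ψ` of `𝓓([0,T))` are the restrictions to `[0,T)` of elements of `𝓓((-∞,T))`.
The guard `IntegrableOn` in the last clause always holds if `f ∈ L^{p'}(Q)`; for a source that is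
merely in `L¹(Q)`, it selects the pairs `(ξ,ψ)` for which the source term has a meaning. -/
structure IsWeakSolution {N : ℕ} (p T : ℝ) (Ω : Opens (Sp N)) (ΓD : Set (Sp N))
    (V : Sp N → Sp N) (f : ℝ → Sp N → ℝ) (u₀ : Sp N → ℝ)
    (u v : ℝ → Sp N → ℝ) (Dv : ℝ → Sp N → Sp N) : Prop where
  /-- `u(t) ∈ L¹(Ω)` for `t ∈ [0,T)` -/
  u_slice : ∀ t ∈ Ico 0 T, MemLp (u t) 1 (volume.restrict (Ω : Set (Sp N)))
  /-- `t ↦ u(t)` is continuous from `[0,T)` to `L¹(Ω)` -/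
  u_cont : ∀ t₀ ∈ Ico 0 T,
    Tendsto (fun t => eLpNorm (fun x => u t x - u t₀ x) 1 (volume.restrict (Ω : Set (Sp N))))
      (𝓝[Ico 0 T] t₀) (𝓝 0)
  /-- `u ∈ L^∞(Q)` -/
  u_bdd : MemLp (fun z : ℝ × Sp N => u z.1 z.2) ⊤
    (volume.restrict (cylinder T Ω : Set (ℝ × Sp N)))
  /-- `v ∈ L^p(0,T; W^{1,p}_D(Ω))` -/
  v_memLp : MemLp (fun z : ℝ × Sp N => v z.1 z.2) (ENNReal.ofReal p)
    (volume.restrict (cylinder T Ω : Set (ℝ × Sp N)))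
  Dv_memLp : MemLp (fun z : ℝ × Sp N => Dv z.1 z.2) (ENNReal.ofReal p)
    (volume.restrict (cylinder T Ω : Set (ℝ × Sp N)))
  v_slice : ∀ᵐ t ∂(volume.restrict (Ioo 0 T)), MemW1D (ENNReal.ofReal p) Ω ΓD (v t) (Dv t)
  v_nonneg : ∀ᵐ z ∂(volume.restrict (cylinder T Ω : Set (ℝ × Sp N))), 0 ≤ v z.1 z.2
  u_mem_sign : ∀ᵐ z ∂(volume.restrict (cylinder T Ω : Set (ℝ × Sp N))),
    u z.1 z.2 ∈ signPlus (v z.1 z.2)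
  weak_form : ∀ (ξ : Sp N → ℝ) (Dξ : Sp N → Sp N), MemW1D (ENNReal.ofReal p) Ω ΓD ξ Dξ →
    ∀ ψ : 𝓓((⟨Iio T, isOpen_Iio⟩ : Opens ℝ), ℝ),
      IntegrableOn (fun z : ℝ × Sp N => f z.1 z.2 * ξ z.2 * ψ z.1)
        (cylinder T Ω : Set (ℝ × Sp N)) →
      (- ∫ z in (cylinder T Ω : Set (ℝ × Sp N)), u z.1 z.2 * ξ z.2 * deriv ψ z.1)
        + ∫ z in (cylinder T Ω : Set (ℝ × Sp N)),
            inner ℝ (pflux p (Dv z.1 z.2) - u z.1 z.2 • V z.2) (Dξ z.2) * ψ z.1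
      = (∫ z in (cylinder T Ω : Set (ℝ × Sp N)), f z.1 z.2 * ξ z.2 * ψ z.1)
        + ∫ x in (Ω : Set (Sp N)), u₀ x * ξ x * ψ 0

/-- The action on `φ ∈ 𝓓(Q)` of the distribution defined by a function `g ∈ L¹_loc(Q)`. -/
noncomputable def distFun {N : ℕ} {Q : Opens (ℝ × Sp N)} (g : ℝ × Sp N → ℝ)
    (φ : 𝓓(Q, ℝ)) : ℝ :=
  ∫ z in (Q : Set (ℝ × Sp N)), g z * φ z

/-- The action on `φ ∈ 𝓓(Q)` of the distribution `∂_t g`, for `g ∈ L¹_loc(Q)`. -/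
noncomputable def distTime {N : ℕ} {Q : Opens (ℝ × Sp N)} (g : ℝ × Sp N → ℝ)
    (φ : 𝓓(Q, ℝ)) : ℝ :=
  - ∫ z in (Q : Set (ℝ × Sp N)), g z * deriv (fun s : ℝ => φ (s, z.2)) z.1

/-- The action on `φ ∈ 𝓓(Q)` of the distribution `∇ · F` (divergence in `x`), for
`F ∈ L¹_loc(Q)^N`. -/
noncomputable def distDiv {N : ℕ} {Q : Opens (ℝ × Sp N)} (F : ℝ × Sp N → Sp N)
    (φ : 𝓓(Q, ℝ)) : ℝ :=
  - ∫ z in (Q : Set (ℝ × Sp N)), inner ℝ (F z) (gradient (fun y : Sp N => φ (z.1, y)) z.2)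

/-- The action on `φ ∈ 𝓓(Q)` of the distribution `V · ∇g`, defined as
`∇ · (g V) - g ∇ · V`, where `d = ∇ · V`. -/
noncomputable def distTransport {N : ℕ} {Q : Opens (ℝ × Sp N)} (V : Sp N → Sp N) (d : Sp N → ℝ)
    (g : ℝ × Sp N → ℝ) (φ : 𝓓(Q, ℝ)) : ℝ :=
  distDiv (fun z => g z • V z.2) φ - distFun (fun z => g z * d z.2) φ

end CrowdMotion

set_option linter.unusedSectionVars false

/-! Formally, multiplying the equation by $\beta'(u)$ gives $\partial_t\beta(u) +
V\cdot\nabla\beta(u) + u\,(\nabla\cdot V)\,\beta'(u) = \beta'(u)\,(f + \Delta_p v)$, so what is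
needed is $\beta'(u)\,\Delta_p v \le \Delta_p v$. Two facts give a meaning to this.

Kato-type inequality (`IsWeakSolution.integral_pflux_le`): $\Delta_p v + 1_{v>0}(f - \nabla\cdot V)
\ge 0$ as a distribution. Freeze $t$ and test the equation on $(t-h,t)$ with $H(v(t))\xi$, where $H
\ge 0$ is smooth, bounded and nondecreasing, with $H(s)=0$ for $s\le 0$. The increment $\int
(u(t)-u(t-h))H(v(t))\xi$ is nonnegative, since $u(t)=1\ge u(t-h)$ wherever $v(t)>0$. Averaging in
$h\to 0$ (`integral_pairing_nonneg_of_average`) removes the time derivative. Since $\nabla v=0$ a.e.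
on $\{v=0\}$ (`MemW1.ae_gradient_eq_zero`), $uV$ may be replaced by $V$ against $\nabla(H(v)\xi)$,
and integration by parts produces $\nabla\cdot V$. The term with $H'(v)|\nabla v|^p\ge 0$ has the
good sign and is dropped; finally $H$ increases to the Heaviside function.

Renormalization of the transport part (`tendsto_integral_transport`): for $U_n = u * k_n$, the
quantity $\nabla\cdot((uV)*k_n)$ equals $V\cdot\nabla U_n + u\,(\nabla\cdot V)*k_n$ up to a
DiPerna–Lions commutator. With both increments $u(z')-u(z)$ and $V(z')-V(z)$ kept inside it, the
commutator tends to zero in $L^1_{loc}$: the Sobolev bound on increments of $V$ absorbs the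
singularity of $\nabla k_n$, and increments of $u$ tend to zero in $L^p$.

The two meet in `IsWeakSolution.renormalized_le`. The mollified equation is multiplied by
$\varphi\beta'(U_n)$. With $G = 1_{v>0}(f-\nabla\cdot V)$, the smooth function $(\Delta_p v +
G)*k_n$ is nonnegative, so $\beta'\le 1$ bounds $\beta'(U_n)(\Delta_p v)*k_n$ by $(\Delta_p v)*k_n +
(1-\beta'(U_n))\,G*k_n$. In the limit $(1-\beta'(u))G = 0$, because $u=1$ on $\{v>0\}$ and
$\beta'(1)=1$. -/

namespace CrowdMotion

/-! ### Mollification and its convergence in Lebesgue spaces -/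

section Mollification

variable {E : Type*} [NormedAddCommGroup E] [NormedSpace ℝ E] [FiniteDimensional ℝ E]
  [MeasurableSpace E] [BorelSpace E] {μ : Measure E} [μ.IsAddHaarMeasure]
  {F : Type*} [NormedAddCommGroup F] [NormedSpace ℝ F] [CompleteSpace F]

/-- Translations act continuously on `L^q`, for `1 ≤ q < ∞`. -/
theorem tendsto_eLpNorm_translation_sub {q : ℝ≥0∞} (hq : 1 ≤ q) (hq' : q ≠ ⊤) {g : E → F}
    (hg : MemLp g q μ) :
    Tendsto (fun h : E => eLpNorm (fun x => g (x - h) - g x) q μ) (𝓝 0) (𝓝 0) := by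
  have : Fact (1 ≤ q) := ⟨hq⟩
  have : ProperSpace E := FiniteDimensional.proper ℝ E
  have hmp : ∀ h : E, MeasurePreserving (fun x : E => x - h) μ μ :=
    fun h => measurePreserving_sub_right μ h
  let G : E → C(E, E) := fun h => ⟨fun x => x - h, by fun_prop⟩
  have hG : Continuous G := by
    let g : C(E × E, E) := ⟨fun a => a.2 - a.1, by fun_prop⟩
    exact g.curry.continuous
  have h1 : Tendsto (fun h : E => Lp.compMeasurePreserving (G h) (hmp h) hg.toLp) (𝓝 0)
      (𝓝 (Lp.compMeasurePreserving (G 0) (hmp 0) hg.toLp)) :=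
    Filter.Tendsto.compMeasurePreservingLp tendsto_const_nhds hG.continuousAt _ _ hq'
  have h0 : Lp.compMeasurePreserving (G 0) (hmp 0) hg.toLp = hg.toLp := by
    ext1
    refine (Lp.coeFn_compMeasurePreserving _ (hmp 0)).trans ?_
    simp only [sub_zero]
    rfl
  rw [h0, tendsto_iff_edist_tendsto_0] at h1
  refine h1.congr fun h => ?_
  rw [Lp.edist_def]
  refine eLpNorm_congr_ae ?_
  have e1 := (Lp.coeFn_compMeasurePreserving hg.toLp (hmp h))
  have e2 := (hmp h).quasiMeasurePreserving.ae_eq_comp hg.coeFn_toLp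
  filter_upwards [e1, e2, hg.coeFn_toLp] with x h1 h2 h3
  simp only [Pi.sub_apply]
  rw [h3]
  congr 1
  exact h1.trans h2

/-- `k` is a smooth probability density supported in the closed ball of radius `δ`. -/
structure IsKernel (μ : Measure E) (k : E → ℝ) (δ : ℝ) : Prop where
  nonneg : ∀ x, 0 ≤ k x
  contDiff : ContDiff ℝ ∞ k
  integral_eq_one : ∫ x, k x ∂μ = 1
  eq_zero : ∀ x, δ < ‖x‖ → k x = 0

/-- The mollification `∫ k (x - y) • g y dy`. -/
noncomputable def mollify (μ : Measure E) (k : E → ℝ) (g : E → F) (x : E) : F :=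
  ∫ y, k (x - y) • g y ∂μ

theorem IsKernel.tsupport_subset {k : E → ℝ} {δ : ℝ} (hk : IsKernel μ k δ) :
    tsupport k ⊆ Metric.closedBall 0 δ := by
  refine closure_minimal (fun x hx => ?_) Metric.isClosed_closedBall
  by_contra h
  exact hx (hk.eq_zero x (by simpa using h))

theorem IsKernel.hasCompactSupport {k : E → ℝ} {δ : ℝ} (hk : IsKernel μ k δ) :
    HasCompactSupport k := by
  have : ProperSpace E := FiniteDimensional.proper ℝ E
  exact (isCompact_closedBall (0 : E) δ).of_isClosed_subset (isClosed_tsupport k)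
    hk.tsupport_subset

theorem IsKernel.integrable {k : E → ℝ} {δ : ℝ} (hk : IsKernel μ k δ) : Integrable k μ :=
  hk.contDiff.continuous.integrable_of_hasCompactSupport hk.hasCompactSupport

theorem mollify_eq_convolution (k : E → ℝ) (g : E → F) :
    mollify μ k g = convolution g k (ContinuousLinearMap.lsmul ℝ ℝ).flip μ := rfl

theorem integrable_kernel_smul {k : E → ℝ} (hk : Continuous k) (hk' : HasCompactSupport k)
    {g : E → F} (hg : LocallyIntegrable g μ) (x : E) :
    Integrable (fun y => k (x - y) • g y) μ :=
  (hk'.convolutionExists_right (ContinuousLinearMap.lsmul ℝ ℝ).flip hg hk x)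

theorem contDiff_mollify {k : E → ℝ} (hk : ContDiff ℝ ∞ k) (hk' : HasCompactSupport k)
    {g : E → F} (hg : LocallyIntegrable g μ) : ContDiff ℝ ∞ (mollify μ k g) :=
  hk'.contDiff_convolution_right (ContinuousLinearMap.lsmul ℝ ℝ).flip hg hk

theorem fderiv_mollify {k : E → ℝ} (hk : ContDiff ℝ ∞ k) (hk' : HasCompactSupport k)
    {g : E → F} (hg : LocallyIntegrable g μ) (x v : E) :
    fderiv ℝ (mollify μ k g) x v = ∫ y, (fderiv ℝ k (x - y) v) • g y ∂μ := by
  have hk1 : ContDiff ℝ 1 k := hk.of_le (by exact_mod_cast le_top)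
  have h := hk'.hasFDerivAt_convolution_right
    (ContinuousLinearMap.lsmul ℝ ℝ : ℝ →L[ℝ] F →L[ℝ] F).flip hg hk1 x
  rw [mollify_eq_convolution, h.fderiv, convolution_def, ContinuousLinearMap.integral_apply]
  · rfl
  · exact (hk'.fderiv ℝ).convolutionExists_right _ hg (hk1.continuous_fderiv one_ne_zero) x

theorem mollify_eq_integral_sub (k : E → ℝ) (g : E → F) (x : E) :
    mollify μ k g x = ∫ h, k h • g (x - h) ∂μ := by
  have := integral_sub_left_eq_self (fun h => k h • g (x - h)) μ x
  rw [← this]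
  simp [mollify]

/-- The measure with density `k`. -/
theorem IsKernel.isProbabilityMeasure {k : E → ℝ} {δ : ℝ} (hk : IsKernel μ k δ) :
    IsProbabilityMeasure (μ.withDensity fun x => ENNReal.ofReal (k x)) := by
  refine ⟨?_⟩
  rw [withDensity_apply _ MeasurableSet.univ, Measure.restrict_univ,
    ← ofReal_integral_eq_lintegral_ofReal hk.integrable (ae_of_all _ hk.nonneg),
    hk.integral_eq_one, ENNReal.ofReal_one]

theorem IsKernel.lintegral_eq_one {k : E → ℝ} {δ : ℝ} (hk : IsKernel μ k δ) :
    ∫⁻ x, ENNReal.ofReal (k x) ∂μ = 1 := by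
  rw [← ofReal_integral_eq_lintegral_ofReal hk.integrable (ae_of_all _ hk.nonneg),
    hk.integral_eq_one, ENNReal.ofReal_one]

/-- Jensen's inequality for the power function. -/
theorem lintegral_rpow_le_of_isProbabilityMeasure {α : Type*} [MeasurableSpace α] {ν : Measure α}
    [IsProbabilityMeasure ν] {r : ℝ} (hr : 1 ≤ r) {f : α → ℝ≥0∞} (hf : AEMeasurable f ν) :
    (∫⁻ a, f a ∂ν) ^ r ≤ ∫⁻ a, f a ^ r ∂ν := by
  have h := eLpNorm'_le_eLpNorm'_of_exponent_le (p := 1) (q := r) one_pos hr ν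
    hf.aestronglyMeasurable
  simp only [eLpNorm', enorm_eq_self, ENNReal.rpow_one, div_one, one_div] at h
  calc (∫⁻ a, f a ∂ν) ^ r ≤ ((∫⁻ a, f a ^ r ∂ν) ^ r⁻¹) ^ r :=
        ENNReal.rpow_le_rpow h (by linarith)
    _ = ∫⁻ a, f a ^ r ∂ν := by
        rw [← ENNReal.rpow_mul, inv_mul_cancel₀ (by linarith), ENNReal.rpow_one]

theorem IsKernel.rpow_lintegral_le {k : E → ℝ} {δ : ℝ} (hk : IsKernel μ k δ) {r : ℝ} (hr : 1 ≤ r)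
    {f : E → ℝ≥0∞} (hf : AEMeasurable f μ) :
    (∫⁻ h, ENNReal.ofReal (k h) * f h ∂μ) ^ r ≤ ∫⁻ h, ENNReal.ofReal (k h) * f h ^ r ∂μ := by
  have := hk.isProbabilityMeasure
  have hm : AEMeasurable (fun x => ENNReal.ofReal (k x)) μ :=
    (hk.contDiff.continuous.measurable.ennreal_ofReal).aemeasurable
  have hac := withDensity_absolutelyContinuous μ (fun x => ENNReal.ofReal (k x))
  have := lintegral_rpow_le_of_isProbabilityMeasure
    (ν := μ.withDensity fun x => ENNReal.ofReal (k x)) hr (hf.mono_ac hac)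
  rw [lintegral_withDensity_eq_lintegral_mul₀ hm hf,
    lintegral_withDensity_eq_lintegral_mul₀ hm (hf.pow_const r)] at this
  exact this

/-- Since the kernel has mass one, the error is the average of $g(x-h)-g(x)$ over $h$ against the
probability density $k$. Jensen's inequality and Tonelli's theorem reduce it to single shifts, and
only those with $|h|\le\delta$ count. -/
theorem IsKernel.lintegral_enorm_mollify_sub_le {k : E → ℝ} {δ : ℝ} (hk : IsKernel μ k δ)
    {r : ℝ} (hr : 1 ≤ r) {g : E → F} (hg : MemLp g (ENNReal.ofReal r) μ) {C : ℝ≥0∞}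
    (hC : ∀ h, ‖h‖ ≤ δ → ∫⁻ x, ‖g (x - h) - g x‖ₑ ^ r ∂μ ≤ C) :
    ∫⁻ x, ‖mollify μ k g x - g x‖ₑ ^ r ∂μ ≤ C := by
  have hk' := hk.contDiff.continuous
  have hgl : LocallyIntegrable g μ := hg.locallyIntegrable (by simpa using hr)
  have hmeas : AEStronglyMeasurable (fun z : E × E => g (z.1 - z.2) - g z.1) (μ.prod μ) := by
    refine AEStronglyMeasurable.sub ?_ hg.1.comp_fst
    exact hg.1.comp_quasiMeasurePreserving (quasiMeasurePreserving_sub μ μ)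
  have key : ∀ᵐ x ∂μ, ‖mollify μ k g x - g x‖ₑ ^ r
      ≤ ∫⁻ h, ENNReal.ofReal (k h) * ‖g (x - h) - g x‖ₑ ^ r ∂μ := by
    have h1 := hmeas.prodMk_left
    filter_upwards [h1] with x hx
    have hi : Integrable (fun h => k h • g (x - h)) μ := by
      have := (integrable_kernel_smul hk' hk.hasCompactSupport hgl x).comp_sub_left x
      simpa using this
    have e : mollify μ k g x - g x = ∫ h, k h • (g (x - h) - g x) ∂μ := by
      simp_rw [smul_sub]
      rw [integral_sub hi (hk.integrable.smul_const _), integral_smul_const, hk.integral_eq_one,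
        one_smul, mollify_eq_integral_sub]
    refine le_trans (ENNReal.rpow_le_rpow ?_ (by linarith)) (hk.rpow_lintegral_le hr hx.enorm)
    rw [e]
    refine (enorm_integral_le_lintegral_enorm _).trans (le_of_eq ?_)
    refine lintegral_congr fun h => ?_
    rw [enorm_smul, Real.enorm_eq_ofReal (hk.nonneg h)]
  calc ∫⁻ x, ‖mollify μ k g x - g x‖ₑ ^ r ∂μ
      ≤ ∫⁻ x, ∫⁻ h, ENNReal.ofReal (k h) * ‖g (x - h) - g x‖ₑ ^ r ∂μ ∂μ := lintegral_mono_ae key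
    _ = ∫⁻ h, ∫⁻ x, ENNReal.ofReal (k h) * ‖g (x - h) - g x‖ₑ ^ r ∂μ ∂μ := by
        refine lintegral_lintegral_swap ?_
        refine AEMeasurable.mul ?_ (hmeas.enorm.pow_const r)
        exact ((hk'.measurable.ennreal_ofReal).comp measurable_snd).aemeasurable
    _ = ∫⁻ h, ENNReal.ofReal (k h) * ∫⁻ x, ‖g (x - h) - g x‖ₑ ^ r ∂μ ∂μ := by
        refine lintegral_congr fun h => ?_
        rw [lintegral_const_mul' _ _ ENNReal.ofReal_ne_top]
    _ ≤ ∫⁻ h, ENNReal.ofReal (k h) * C ∂μ := by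
        refine lintegral_mono fun h => ?_
        by_cases hh : ‖h‖ ≤ δ
        · exact mul_le_mul_right (hC h hh) _
        · simp [hk.eq_zero h (not_le.1 hh)]
    _ = C := by
        rw [lintegral_mul_const _ hk'.measurable.ennreal_ofReal, hk.lintegral_eq_one, one_mul]

theorem eLpNorm_ofReal_eq {α : Type*} [MeasurableSpace α] {ν : Measure α} {r : ℝ} (hr : 1 ≤ r)
    (f : α → F) :
    eLpNorm f (ENNReal.ofReal r) ν = (∫⁻ x, ‖f x‖ₑ ^ r ∂ν) ^ r⁻¹ := by
  have h0 : ENNReal.ofReal r ≠ 0 := by simp; linarith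
  rw [eLpNorm_eq_lintegral_rpow_enorm_toReal h0 ENNReal.ofReal_ne_top,
    ENNReal.toReal_ofReal (by linarith), one_div]

theorem IsKernel.eLpNorm_mollify_sub_le {k : E → ℝ} {δ : ℝ} (hk : IsKernel μ k δ)
    {r : ℝ} (hr : 1 ≤ r) {g : E → F} (hg : MemLp g (ENNReal.ofReal r) μ) {C : ℝ≥0∞}
    (hC : ∀ h, ‖h‖ ≤ δ → eLpNorm (fun x => g (x - h) - g x) (ENNReal.ofReal r) μ ≤ C) :
    eLpNorm (fun x => mollify μ k g x - g x) (ENNReal.ofReal r) μ ≤ C := by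
  have hr0 : 0 < r := by linarith
  rw [eLpNorm_ofReal_eq hr, ENNReal.rpow_inv_le_iff hr0]
  refine hk.lintegral_enorm_mollify_sub_le hr hg fun h hh => ?_
  have := hC h hh
  rwa [eLpNorm_ofReal_eq hr, ENNReal.rpow_inv_le_iff hr0] at this

/-- Mollifications converge in `L^r`. -/
theorem tendsto_eLpNorm_mollify_sub {k : ℕ → E → ℝ} {δ : ℕ → ℝ}
    (hk : ∀ n, IsKernel μ (k n) (δ n)) (hδ : Tendsto δ atTop (𝓝 0))
    {r : ℝ} (hr : 1 ≤ r) {g : E → F} (hg : MemLp g (ENNReal.ofReal r) μ) :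
    Tendsto (fun n => eLpNorm (fun x => mollify μ (k n) g x - g x) (ENNReal.ofReal r) μ)
      atTop (𝓝 0) := by
  have ht := tendsto_eLpNorm_translation_sub (by simpa using hr) ENNReal.ofReal_ne_top hg
  rw [ENNReal.tendsto_nhds_zero] at ht ⊢
  intro ε hε
  obtain ⟨η, hη, h⟩ := Metric.eventually_nhds_iff.1 (ht ε hε)
  filter_upwards [hδ.eventually (gt_mem_nhds hη)] with n hn
  exact (hk n).eLpNorm_mollify_sub_le hr hg fun h' hh' => h (by simpa using hh'.trans_lt hn)

theorem tendsto_integral_mollify_sub {k : ℕ → E → ℝ} {δ : ℕ → ℝ}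
    (hk : ∀ n, IsKernel μ (k n) (δ n)) (hδ : Tendsto δ atTop (𝓝 0)) {g : E → F}
    (hg : Integrable g μ) :
    Tendsto (fun n => ∫⁻ x, ‖mollify μ (k n) g x - g x‖ₑ ∂μ) atTop (𝓝 0) := by
  have := tendsto_eLpNorm_mollify_sub hk hδ (r := 1) le_rfl (g := g)
    (by simpa [memLp_one_iff_integrable] using hg)
  simpa [eLpNorm_one_eq_lintegral_enorm] using this

end Mollification

/-! ### Construction and rescaling of kernels -/

section Kernels

variable {E : Type*} [NormedAddCommGroup E] [NormedSpace ℝ E] [FiniteDimensional ℝ E]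
  [MeasurableSpace E] [BorelSpace E]

theorem exists_isKernel_one (μ : Measure E) [μ.IsAddHaarMeasure] : ∃ k : E → ℝ, IsKernel μ k 1 := by
  let b : ContDiffBump (0 : E) := ⟨1 / 2, 1, by norm_num, by norm_num⟩
  refine ⟨b.normed μ, b.nonneg_normed, b.contDiff_normed, b.integral_normed, fun x hx => ?_⟩
  have : x ∉ Function.support (b.normed μ) := by
    rw [b.support_normed_eq]
    simpa [b] using hx.le
  simpa using this

theorem IsKernel.rescale {μ : Measure E} [μ.IsAddHaarMeasure] {k : E → ℝ} (hk : IsKernel μ k 1)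
    {δ : ℝ} (hδ : 0 < δ) :
    IsKernel μ (fun x => (δ ^ Module.finrank ℝ E)⁻¹ * k (δ⁻¹ • x)) δ where
  nonneg x := mul_nonneg (by positivity) (hk.nonneg _)
  contDiff := contDiff_const.mul (hk.contDiff.comp (contDiff_const_smul _))
  integral_eq_one := by
    rw [integral_const_mul, Measure.integral_comp_smul, hk.integral_eq_one]
    simp only [inv_pow, inv_inv, smul_eq_mul, mul_one]
    rw [abs_of_pos (by positivity), inv_mul_cancel₀ (by positivity)]
  eq_zero x hx := by
    rw [hk.eq_zero _ ?_, mul_zero]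
    rw [norm_smul, norm_inv, Real.norm_of_nonneg hδ.le, ← div_eq_inv_mul, lt_div_iff₀ hδ, one_mul]
    exact hx

/-- The gradient of the rescaled kernel gains a factor $\delta^{-1}$, which the weight $\|x\|$
compensates. This is the scale invariance behind the commutator estimate. -/
theorem integral_norm_fderiv_rescale {μ : Measure E} [μ.IsAddHaarMeasure] {k : E → ℝ}
    (hk : Differentiable ℝ k) {δ : ℝ} (hδ : 0 < δ) :
    ∫ x, ‖fderiv ℝ (fun x => (δ ^ Module.finrank ℝ E)⁻¹ * k (δ⁻¹ • x)) x‖ * ‖x‖ ∂μ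
      = ∫ x, ‖fderiv ℝ k x‖ * ‖x‖ ∂μ := by
  set d := Module.finrank ℝ E
  have h1 : ∀ x, fderiv ℝ (fun x => (δ ^ d)⁻¹ * k (δ⁻¹ • x)) x
      = ((δ ^ d)⁻¹ * δ⁻¹) • fderiv ℝ k (δ⁻¹ • x) := by
    intro x
    rw [fderiv_const_mul, fderiv_comp_smul, smul_smul]
    exact (hk _).comp x (differentiableAt_id.const_smul _)
  have h2 : ∀ x, ‖fderiv ℝ (fun x => (δ ^ d)⁻¹ * k (δ⁻¹ • x)) x‖ * ‖x‖
      = (δ ^ d)⁻¹ * (fun y => ‖fderiv ℝ k y‖ * ‖y‖) (δ⁻¹ • x) := by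
    intro x
    rw [h1, norm_smul]
    simp only [norm_smul, norm_inv, Real.norm_of_nonneg hδ.le, norm_mul, norm_pow]
    ring
  rw [integral_congr_ae (ae_of_all _ h2)]
  rw [integral_const_mul, Measure.integral_comp_smul μ (fun y => ‖fderiv ℝ k y‖ * ‖y‖)]
  simp only [inv_pow, inv_inv, smul_eq_mul]
  rw [abs_of_pos (by positivity), ← mul_assoc, inv_mul_cancel₀ (by positivity), one_mul]

/-- Kernels of arbitrarily small radius, with a scale-invariant bound on the gradients. -/
theorem exists_isKernel_fderiv_bound (μ : Measure E) [μ.IsAddHaarMeasure] :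
    ∃ C : ℝ, ∀ δ > 0, ∃ k : E → ℝ, IsKernel μ k δ ∧ ∫ x, ‖fderiv ℝ k x‖ * ‖x‖ ∂μ ≤ C := by
  obtain ⟨k, hk⟩ := exists_isKernel_one μ
  refine ⟨∫ x, ‖fderiv ℝ k x‖ * ‖x‖ ∂μ, fun δ hδ => ⟨_, hk.rescale hδ, le_of_eq ?_⟩⟩
  exact integral_norm_fderiv_rescale (hk.contDiff.differentiable (by simp)) hδ

/-- The norm of a product is the maximum of the norms, so the radius does not change. -/
theorem IsKernel.prod {E' : Type*} [NormedAddCommGroup E'] [NormedSpace ℝ E']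
    [FiniteDimensional ℝ E'] [MeasurableSpace E'] [BorelSpace E'] {μ : Measure E}
    [μ.IsAddHaarMeasure] {μ' : Measure E'} [μ'.IsAddHaarMeasure] {k : E → ℝ} {k' : E' → ℝ} {δ : ℝ}
    (hk : IsKernel μ k δ) (hk' : IsKernel μ' k' δ) :
    IsKernel (μ.prod μ') (fun z => k z.1 * k' z.2) δ where
  nonneg z := mul_nonneg (hk.nonneg _) (hk'.nonneg _)
  contDiff := (hk.contDiff.comp contDiff_fst).mul (hk'.contDiff.comp contDiff_snd)
  integral_eq_one := by
    rw [integral_prod_mul, hk.integral_eq_one, hk'.integral_eq_one, one_mul]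
  eq_zero z hz := by
    rw [Prod.norm_def, lt_max_iff] at hz
    rcases hz with h | h
    · rw [hk.eq_zero _ h, zero_mul]
    · rw [hk'.eq_zero _ h, mul_zero]

theorem exists_isKernel_seq (μ : Measure E) [μ.IsAddHaarMeasure] {δ : ℝ} (hδ : 0 < δ) :
    ∃ (k : ℕ → E → ℝ) (d : ℕ → ℝ), (∀ n, IsKernel μ (k n) (d n)) ∧ Tendsto d atTop (𝓝 0) ∧
      (∀ n, 0 < d n) ∧ ∀ n, d n ≤ δ := by
  obtain ⟨C, h⟩ := exists_isKernel_fderiv_bound μ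
  have hd : ∀ n : ℕ, 0 < δ / (n + 1) := fun n => by positivity
  choose k hk using fun n => h _ (hd n)
  refine ⟨k, fun n => δ / (n + 1), fun n => (hk n).1, ?_, hd, fun n => ?_⟩
  · exact tendsto_const_div_atTop_nhds_zero_nat δ |>.comp (tendsto_add_atTop_nat 1) |>.congr
      fun n => by simp
  · exact div_le_self hδ.le (by simp)

end Kernels

/-! ### Passage to the limit in integrals of products -/

section Limits

variable {α : Type*} [MeasurableSpace α] {ν : Measure α}
  {F F' F'' : Type*} [NormedAddCommGroup F] [NormedAddCommGroup F'] [NormedAddCommGroup F'']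
  [NormedSpace ℝ F'']

theorem ofReal_one_le {r : ℝ} (hr : 1 ≤ r) : 1 ≤ ENNReal.ofReal r := by simpa using hr

theorem lintegral_enorm_mul_le {r s : ℝ} (hrs : r.HolderConjugate s) {f : α → F} {g : α → F'}
    (hf : AEStronglyMeasurable f ν) (hg : AEStronglyMeasurable g ν) :
    ∫⁻ x, ‖f x‖ₑ * ‖g x‖ₑ ∂ν
      ≤ eLpNorm f (ENNReal.ofReal r) ν * eLpNorm g (ENNReal.ofReal s) ν := by
  rw [eLpNorm_eq_lintegral_rpow_enorm_toReal (by simpa using hrs.pos) ENNReal.ofReal_ne_top,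
    eLpNorm_eq_lintegral_rpow_enorm_toReal (by simpa using hrs.symm.pos) ENNReal.ofReal_ne_top,
    ENNReal.toReal_ofReal hrs.nonneg, ENNReal.toReal_ofReal hrs.symm.nonneg]
  exact ENNReal.lintegral_mul_le_Lp_mul_Lq ν hrs hf.enorm hg.enorm

theorem integrable_of_norm_le_mul {r s : ℝ} (hrs : r.HolderConjugate s) {f : α → F} {g : α → F'}
    (hf : MemLp f (ENNReal.ofReal r) ν) (hg : MemLp g (ENNReal.ofReal s) ν) {P : α → F''}
    (hP : AEStronglyMeasurable P ν) (h : ∀ᵐ x ∂ν, ‖P x‖ ≤ ‖f x‖ * ‖g x‖) : Integrable P ν := by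
  refine ⟨hP, ?_⟩
  refine lt_of_le_of_lt ((lintegral_mono_ae ?_).trans (lintegral_enorm_mul_le hrs hf.1 hg.1))
    (ENNReal.mul_lt_top hf.2 hg.2)
  filter_upwards [h] with x hx
  rw [← enorm_norm (f x), ← enorm_norm (g x), ← enorm_mul]
  exact enorm_le_iff_norm_le.2 (hx.trans (le_abs_self _))

/-- Passage to the limit in an integral of products, by Hölder's inequality. -/
theorem tendsto_integral_of_norm_sub_le_mul {r s : ℝ} (hrs : r.HolderConjugate s)
    {f : ℕ → α → F} {g : α → F'} (hf : ∀ n, AEStronglyMeasurable (f n) ν)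
    (hf0 : Tendsto (fun n => eLpNorm (f n) (ENNReal.ofReal r) ν) atTop (𝓝 0))
    (hg : MemLp g (ENNReal.ofReal s) ν) {P : ℕ → α → F''} {P' : α → F''}
    (hP : ∀ᶠ n in atTop, Integrable (P n) ν) (hP' : Integrable P' ν)
    (h : ∀ n, ∀ᵐ x ∂ν, ‖P n x - P' x‖ ≤ ‖f n x‖ * ‖g x‖) :
    Tendsto (fun n => ∫ x, P n x ∂ν) atTop (𝓝 (∫ x, P' x ∂ν)) := by
  refine tendsto_integral_of_L1 P' hP'.1 hP ?_
  have : Tendsto (fun n => eLpNorm (f n) (ENNReal.ofReal r) ν * eLpNorm g (ENNReal.ofReal s) ν)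
      atTop (𝓝 0) := by
    simpa using ENNReal.Tendsto.mul_const hf0 (Or.inr hg.2.ne)
  refine tendsto_of_tendsto_of_tendsto_of_le_of_le tendsto_const_nhds this (fun _ => zero_le)
    fun n => (lintegral_mono_ae ?_).trans (lintegral_enorm_mul_le hrs (hf n) hg.1)
  filter_upwards [h n] with x hx
  rw [← enorm_norm (f n x), ← enorm_norm (g x), ← enorm_mul]
  exact enorm_le_iff_norm_le.2 (hx.trans (le_abs_self _))

/-- Passage to the limit in an integral of products: one factor is bounded and converges almost
everywhere, the other one converges in `L¹`. -/
theorem tendsto_integral_mul_of_bounded {b : ℕ → α → ℝ} {b' : α → ℝ} {g : ℕ → α → ℝ} {g' : α → ℝ}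
    {M : ℝ} (hb : ∀ n, AEStronglyMeasurable (b n) ν) (hbM : ∀ n, ∀ᵐ x ∂ν, ‖b n x‖ ≤ M)
    (hlim : ∀ᵐ x ∂ν, Tendsto (fun n => b n x) atTop (𝓝 (b' x)))
    (hg : ∀ n, Integrable (g n) ν) (hg' : Integrable g' ν)
    (hgl : Tendsto (fun n => ∫⁻ x, ‖g n x - g' x‖ₑ ∂ν) atTop (𝓝 0)) :
    Tendsto (fun n => ∫ x, b n x * g n x ∂ν) atTop (𝓝 (∫ x, b' x * g' x ∂ν)) := by
  -- The product is split as $b_n g' + b_n(g_n - g')$: dominated convergence for the first term, the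
  -- uniform bound on $b_n$ and the $L^1$ convergence for the second.
  have h1 : Tendsto (fun n => ∫ x, b n x * g' x ∂ν) atTop (𝓝 (∫ x, b' x * g' x ∂ν)) := by
    refine tendsto_integral_of_dominated_convergence (fun x => M * ‖g' x‖)
      (fun n => (hb n).mul hg'.1) (hg'.norm.const_mul M) (fun n => ?_) ?_
    · filter_upwards [hbM n] with x hx
      rw [norm_mul]
      gcongr
    · filter_upwards [hlim] with x hx
      exact hx.mul_const _
  have hi : ∀ n, Integrable (fun x => b n x * g n x) ν := fun n =>
    (hg n).bdd_mul (c := M) (hb n) (hbM n)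
  have hi' : ∀ n, Integrable (fun x => b n x * g' x) ν := fun n =>
    hg'.bdd_mul (c := M) (hb n) (hbM n)
  have h2 : Tendsto (fun n => ∫ x, (b n x * g n x - b n x * g' x) ∂ν) atTop (𝓝 0) := by
    have h4 : Tendsto (fun n => ENNReal.ofReal M * ∫⁻ x, ‖g n x - g' x‖ₑ ∂ν) atTop (𝓝 0) := by
      simpa using ENNReal.Tendsto.const_mul hgl (Or.inr ENNReal.ofReal_ne_top)
    have h5 := tendsto_integral_of_L1 (μ := ν) (fun _ : α => (0 : ℝ)) aestronglyMeasurable_const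
      (F := fun n x => b n x * g n x - b n x * g' x) (l := atTop)
      (Eventually.of_forall fun n => (hi n).sub (hi' n)) ?_
    · simpa using h5
    refine tendsto_of_tendsto_of_tendsto_of_le_of_le tendsto_const_nhds h4 (fun _ => zero_le)
      fun n => ?_
    rw [← lintegral_const_mul' _ _ ENNReal.ofReal_ne_top]
    refine lintegral_mono_ae ?_
    filter_upwards [hbM n] with x hx
    rw [sub_zero, ← mul_sub, enorm_mul]
    gcongr
    rw [← ofReal_norm]
    exact ENNReal.ofReal_le_ofReal hx
  have h3 := h2.add h1
  rw [zero_add] at h3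
  refine h3.congr fun n => ?_
  rw [integral_sub (hi n) (hi' n)]
  ring

end Limits

/-! ### Weak gradients and limits of compactly supported smooth functions -/

section Sobolev

variable {N : ℕ} {Ω : Opens (Sp N)}

/-- The translated and reflected kernel `k (x - ·)`, as a test function. -/
def IsKernel.testFunction {E : Type*} [NormedAddCommGroup E] [NormedSpace ℝ E]
    [FiniteDimensional ℝ E] [MeasurableSpace E] [BorelSpace E] {μ : Measure E} [μ.IsAddHaarMeasure]
    {U : Opens E} {k : E → ℝ} {δ : ℝ} (hk : IsKernel μ k δ) (x : E)
    (hx : Metric.closedBall x δ ⊆ U) : 𝓓(U, ℝ) where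
  toFun y := k (x - y)
  contDiff' := hk.contDiff.comp (contDiff_const.sub contDiff_id)
  hasCompactSupport' := hk.hasCompactSupport.comp_homeomorph (Homeomorph.subLeft x)
  tsupport_subset' := by
    refine subset_trans (closure_minimal (fun y hy => ?_) Metric.isClosed_closedBall) hx
    by_contra h
    refine hy (hk.eq_zero _ ?_)
    rw [Metric.mem_closedBall, dist_eq_norm, norm_sub_rev] at h
    exact not_le.1 h

theorem gradient_comp_sub_left {k : Sp N → ℝ} (hk : Differentiable ℝ k) (x y : Sp N) :
    gradient (fun y => k (x - y)) y = - gradient k (x - y) := by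
  refine ext_inner_right ℝ fun v => ?_
  rw [inner_neg_left, inner_gradient_left, inner_gradient_left]
  have : HasFDerivAt (fun y => k (x - y)) ((fderiv ℝ k (x - y)).comp (-ContinuousLinearMap.id ℝ _)) y :=
    (hk (x - y)).hasFDerivAt.comp y ((hasFDerivAt_id y).const_sub x)
  rw [this.fderiv]
  simp

theorem continuous_gradient {φ : Sp N → ℝ} (h : ContDiff ℝ 1 φ) : Continuous (gradient φ) :=
  (InnerProductSpace.toDual ℝ (Sp N)).symm.continuous.comp (h.continuous_fderiv one_ne_zero)

theorem norm_gradient (φ : Sp N → ℝ) (x : Sp N) : ‖gradient φ x‖ = ‖fderiv ℝ φ x‖ :=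
  (InnerProductSpace.toDual ℝ (Sp N)).symm.norm_map _

theorem hasCompactSupport_gradient {φ : Sp N → ℝ} (h : HasCompactSupport φ) :
    HasCompactSupport (gradient φ) :=
  (h.fderiv ℝ).comp_left (g := (InnerProductSpace.toDual ℝ (Sp N)).symm) (map_zero _)

theorem inner_gradient_eq_fderiv (φ : Sp N → ℝ) (x v : Sp N) :
    inner ℝ v (gradient φ x) = fderiv ℝ φ x v := by
  rw [real_inner_comm, inner_gradient_left]

/-- Classical integration by parts, in terms of the gradient. -/
theorem integral_smul_gradient_eq_neg {a b : Sp N → ℝ} (ha : ContDiff ℝ 1 a) (hb : ContDiff ℝ 1 b)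
    (hbc : HasCompactSupport b) :
    ∫ x, a x • gradient b x = - ∫ x, b x • gradient a x := by
  have hga := continuous_gradient ha
  have hgb := continuous_gradient hb
  have h1 : Integrable (fun x => a x • gradient b x) :=
    (ha.continuous.smul hgb).integrable_of_hasCompactSupport
      (hasCompactSupport_gradient hbc).smul_left
  have h2 : Integrable (fun x => b x • gradient a x) :=
    (hb.continuous.smul hga).integrable_of_hasCompactSupport hbc.smul_right
  refine ext_inner_right ℝ fun v => ?_
  rw [inner_neg_left, real_inner_comm, real_inner_comm v, ← integral_inner h1, ← integral_inner h2]
  simp only [inner_smul_right, inner_gradient_eq_fderiv]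
  rw [integral_mul_fderiv_eq_neg_fderiv_mul_of_integrable]
  · simp_rw [mul_comm]
  · have := (h2.const_inner (𝕜 := ℝ) v)
    simp only [inner_smul_right, inner_gradient_eq_fderiv] at this
    simpa only [mul_comm] using this
  · have := (h1.const_inner (𝕜 := ℝ) v)
    simpa only [inner_smul_right, inner_gradient_eq_fderiv] using this
  · exact (ha.continuous.mul hb.continuous).integrable_of_hasCompactSupport hbc.mul_left
  · exact fun x _ => ha.differentiable one_ne_zero x
  · exact fun x _ => hb.differentiable one_ne_zero x

/-- When the ball around $x$ lies in $\Omega$, the kernel centred at $x$ is itself an admissible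
test function, and the weak gradient identity tested with it moves the derivative from the kernel to
$w$. -/
theorem gradient_mollify {w : Sp N → ℝ} {G : Sp N → Sp N} (hw : HasWeakGradient Ω w G)
    (hwi : LocallyIntegrable ((Ω : Set (Sp N)).indicator w)) {k : Sp N → ℝ} {δ : ℝ}
    (hk : IsKernel volume k δ) {x : Sp N} (hx : Metric.closedBall x δ ⊆ Ω) :
    gradient (mollify volume k ((Ω : Set (Sp N)).indicator w)) x
      = mollify volume k ((Ω : Set (Sp N)).indicator G) x := by
  have h := hw.2.2 (hk.testFunction x hx)
  have hd : Differentiable ℝ k := hk.contDiff.differentiable (by simp)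
  have e0 : ∀ y, (hk.testFunction x hx : Sp N → ℝ) y = k (x - y) := fun y => rfl
  have e1 : ∀ y, gradient (hk.testFunction x hx : Sp N → ℝ) y = - gradient k (x - y) :=
    fun y => gradient_comp_sub_left hd x y
  simp_rw [e0, e1, smul_neg, integral_neg, neg_inj] at h
  have hm := Ω.isOpen.measurableSet
  refine ext_inner_right ℝ fun v => ?_
  rw [inner_gradient_left, fderiv_mollify hk.contDiff hk.hasCompactSupport hwi]
  have r1 : mollify volume k ((Ω : Set (Sp N)).indicator G) x
      = ∫ y in (Ω : Set (Sp N)), k (x - y) • G y := by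
    rw [← integral_indicator hm]
    refine integral_congr_ae (ae_of_all _ fun y => ?_)
    simp only [indicator]
    split_ifs <;> simp
  have hgi : Integrable (fun y => ((Ω : Set (Sp N)).indicator w y) • gradient k (x - y)) := by
    have h1 := (hasCompactSupport_gradient hk.hasCompactSupport)
    exact (h1.convolutionExists_right (ContinuousLinearMap.lsmul ℝ ℝ) hwi
      (continuous_gradient (hk.contDiff.of_le (by simp))) x)
  rw [r1, ← h, ← integral_indicator hm, real_inner_comm]
  have r2 : (Ω : Set (Sp N)).indicator (fun y => w y • gradient k (x - y))
      = fun y => ((Ω : Set (Sp N)).indicator w y) • gradient k (x - y) := by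
    funext y
    simp only [indicator]
    split_ifs <;> simp
  rw [r2, ← integral_inner hgi]
  refine integral_congr_ae (ae_of_all _ fun y => ?_)
  simp only [inner_smul_right, inner_gradient_eq_fderiv, smul_eq_mul]
  ring

/-- `w` is the limit in `W^{1,r}(Ω)` of smooth functions supported in a fixed compact subset
of `Ω`, and `G` is the limit of their gradients. -/
structure IsCompactLimit (r : ℝ) (Ω : Opens (Sp N)) (w : Sp N → ℝ) (G : Sp N → Sp N) : Prop where
  memLp : MemLp w (ENNReal.ofReal r) (volume.restrict Ω)
  memLp_gradient : MemLp G (ENNReal.ofReal r) (volume.restrict Ω)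
  exists_seq : ∃ K : Set (Sp N), IsCompact K ∧ K ⊆ Ω ∧ ∃ φ : ℕ → Sp N → ℝ,
    (∀ n, ContDiff ℝ ∞ (φ n)) ∧ (∀ n, tsupport (φ n) ⊆ K) ∧
    Tendsto (fun n => eLpNorm (fun x => φ n x - w x) (ENNReal.ofReal r) (volume.restrict Ω))
      atTop (𝓝 0) ∧
    Tendsto (fun n => eLpNorm (fun x => gradient (φ n) x - G x) (ENNReal.ofReal r)
      (volume.restrict Ω)) atTop (𝓝 0)

theorem setIntegral_eq_integral_of_tsupport {F : Type*} [NormedAddCommGroup F] [NormedSpace ℝ F]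
    {h : Sp N → F} {K : Set (Sp N)} (hK : K ⊆ Ω) (hh : ∀ x, x ∉ K → h x = 0) :
    ∫ x in (Ω : Set (Sp N)), h x = ∫ x, h x :=
  setIntegral_eq_integral_of_forall_compl_eq_zero fun x hx => hh x fun hxK => hx (hK hxK)

theorem gradient_eq_zero_of_notMem_tsupport {φ : Sp N → ℝ} {x : Sp N} (hx : x ∉ tsupport φ) :
    gradient φ x = 0 := by
  have : fderiv ℝ φ x = 0 := by
    by_contra h
    exact hx (support_fderiv_subset ℝ h)
  simp [gradient, this]

theorem memLp_of_continuous_compact {F : Type*} [NormedAddCommGroup F] {h : Sp N → F}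
    (hc : Continuous h) (hs : HasCompactSupport h) (q : ℝ≥0∞) (s : Set (Sp N)) :
    MemLp h q (volume.restrict s) :=
  (hc.memLp_of_hasCompactSupport hs).restrict s

/-- Classical integration by parts holds for the approximants, and both sides converge by Hölder's
inequality. -/
theorem IsCompactLimit.hasWeakGradient {r : ℝ} (hr : 1 < r) {w : Sp N → ℝ} {G : Sp N → Sp N}
    (h : IsCompactLimit r Ω w G) : HasWeakGradient Ω w G := by
  obtain ⟨K, hK, hKΩ, φ, hφ, hφK, hl, hl'⟩ := h.exists_seq
  have hrs := Real.HolderConjugate.conjExponent hr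
  have hφc : ∀ n, HasCompactSupport (φ n) := fun n => hK.of_isClosed_subset (isClosed_tsupport _)
    (hφK n)
  have hφ1 : ∀ n, ContDiff ℝ 1 (φ n) := fun n => (hφ n).of_le (by simp)
  have hr1 := ofReal_one_le hr.le
  refine ⟨?_, ?_, fun ζ => ?_⟩
  · exact locallyIntegrableOn_of_locallyIntegrable_restrict (h.memLp.locallyIntegrable hr1)
  · exact locallyIntegrableOn_of_locallyIntegrable_restrict (h.memLp_gradient.locallyIntegrable hr1)
  have hζ1 : ContDiff ℝ 1 ζ := ζ.contDiff.of_le (by simp)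
  have hζL : MemLp ζ (ENNReal.ofReal r.conjExponent) (volume.restrict (Ω : Set (Sp N))) :=
    memLp_of_continuous_compact ζ.continuous ζ.hasCompactSupport _ _
  have hgζL : MemLp (gradient ζ) (ENNReal.ofReal r.conjExponent)
      (volume.restrict (Ω : Set (Sp N))) :=
    memLp_of_continuous_compact (continuous_gradient hζ1)
      (hasCompactSupport_gradient ζ.hasCompactSupport) _ _
  have hφL : ∀ n, MemLp (φ n) (ENNReal.ofReal r) (volume.restrict (Ω : Set (Sp N))) :=
    fun n => memLp_of_continuous_compact (hφ n).continuous (hφc n) _ _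
  have hgφL : ∀ n, MemLp (gradient (φ n)) (ENNReal.ofReal r) (volume.restrict (Ω : Set (Sp N))) :=
    fun n => memLp_of_continuous_compact (continuous_gradient (hφ1 n))
      (hasCompactSupport_gradient (hφc n)) _ _
  have l1 := tendsto_integral_of_norm_sub_le_mul (ν := volume.restrict (Ω : Set (Sp N))) hrs
    (f := fun n x => φ n x - w x) (g := gradient ζ)
    (P := fun n x => φ n x • gradient ζ x) (P' := fun x => w x • gradient ζ x)
    (fun n => ((hφL n).sub h.memLp).1) hl hgζL
    (Eventually.of_forall fun n => integrable_of_norm_le_mul hrs (hφL n) hgζL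
      ((hφL n).1.smul hgζL.1) (ae_of_all _ fun x => (norm_smul _ _).le))
    (integrable_of_norm_le_mul hrs h.memLp hgζL (h.memLp.1.smul hgζL.1)
      (ae_of_all _ fun x => (norm_smul _ _).le))
    (fun n => ae_of_all _ fun x => by rw [← sub_smul, norm_smul])
  have l2 := tendsto_integral_of_norm_sub_le_mul (ν := volume.restrict (Ω : Set (Sp N))) hrs
    (f := fun n x => gradient (φ n) x - G x) (g := ζ)
    (P := fun n x => ζ x • gradient (φ n) x) (P' := fun x => ζ x • G x)
    (fun n => ((hgφL n).sub h.memLp_gradient).1) hl' hζL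
    (Eventually.of_forall fun n => integrable_of_norm_le_mul hrs (hgφL n) hζL
      (hζL.1.smul (hgφL n).1) (ae_of_all _ fun x => by rw [norm_smul, mul_comm]))
    (integrable_of_norm_le_mul hrs h.memLp_gradient hζL (hζL.1.smul h.memLp_gradient.1)
      (ae_of_all _ fun x => by rw [norm_smul, mul_comm]))
    (fun n => ae_of_all _ fun x => by rw [← smul_sub, norm_smul, mul_comm])
  refine tendsto_nhds_unique l1 (l2.neg.congr fun n => ?_)
  rw [setIntegral_eq_integral_of_tsupport hKΩ, setIntegral_eq_integral_of_tsupport hKΩ,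
    integral_smul_gradient_eq_neg (hφ1 n) hζ1 ζ.hasCompactSupport]
  · intro x hx
    rw [image_eq_zero_of_notMem_tsupport fun h => hx (hφK n h), zero_smul]
  · intro x hx
    rw [gradient_eq_zero_of_notMem_tsupport fun h => hx (hφK n h), smul_zero]

/-- The approximants vanish identically on the boundary, so they also exhibit a zero trace. Hence
such functions are admissible in the weak formulation whatever $\Gamma_D$ is. -/
theorem IsCompactLimit.memW1D {r : ℝ} (hr : 1 < r) {w : Sp N → ℝ} {G : Sp N → Sp N}
    (h : IsCompactLimit r Ω w G) (ΓD : Set (Sp N)) : MemW1D (ENNReal.ofReal r) Ω ΓD w G := by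
  refine ⟨⟨h.memLp, h.memLp_gradient, h.hasWeakGradient hr⟩, fun _ => 0, ⟨MemLp.zero, ?_⟩,
    ae_of_all _ fun _ _ => rfl⟩
  obtain ⟨K, hK, hKΩ, φ, hφ, hφK, hl, hl'⟩ := h.exists_seq
  refine ⟨φ, hφ, hl, hl', ?_⟩
  refine tendsto_const_nhds.congr fun n => ?_
  symm
  have : (fun x => φ n x - 0) =ᵐ[surface (Ω : Set (Sp N))] 0 := by
    rw [surface, Filter.EventuallyEq, ae_restrict_iff' isClosed_frontier.measurableSet]
    refine ae_of_all _ fun x hx => ?_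
    have hx' : x ∉ (Ω : Set (Sp N)) := by
      rw [Ω.isOpen.frontier_eq] at hx
      exact hx.2
    simp [image_eq_zero_of_notMem_tsupport fun h => hx' (hKΩ (hφK n h))]
  rw [eLpNorm_congr_ae this, eLpNorm_zero]

/-- A weak divergence may be tested with compactly supported Sobolev functions. -/
theorem IsCompactLimit.integral_inner_eq_neg {r s : ℝ} (hrs : r.HolderConjugate s) {w : Sp N → ℝ}
    {G : Sp N → Sp N} (h : IsCompactLimit r Ω w G) {V : Sp N → Sp N} {d : Sp N → ℝ}
    (hV : HasWeakDivergence Ω V d) (hVL : MemLp V (ENNReal.ofReal s) (volume.restrict Ω))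
    (hdL : MemLp d (ENNReal.ofReal s) (volume.restrict Ω)) :
    ∫ x in (Ω : Set (Sp N)), inner ℝ (V x) (G x) = - ∫ x in (Ω : Set (Sp N)), d x * w x := by
  obtain ⟨K, hK, hKΩ, φ, hφ, hφK, hl, hl'⟩ := h.exists_seq
  have hφc : ∀ n, HasCompactSupport (φ n) := fun n => hK.of_isClosed_subset (isClosed_tsupport _)
    (hφK n)
  have hφ1 : ∀ n, ContDiff ℝ 1 (φ n) := fun n => (hφ n).of_le (by simp)
  have hφL : ∀ n, MemLp (φ n) (ENNReal.ofReal r) (volume.restrict (Ω : Set (Sp N))) :=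
    fun n => memLp_of_continuous_compact (hφ n).continuous (hφc n) _ _
  have hgφL : ∀ n, MemLp (gradient (φ n)) (ENNReal.ofReal r) (volume.restrict (Ω : Set (Sp N))) :=
    fun n => memLp_of_continuous_compact (continuous_gradient (hφ1 n))
      (hasCompactSupport_gradient (hφc n)) _ _
  have l1 := tendsto_integral_of_norm_sub_le_mul (ν := volume.restrict (Ω : Set (Sp N))) hrs
    (f := fun n x => φ n x - w x) (g := d)
    (P := fun n x => d x * φ n x) (P' := fun x => d x * w x)
    (fun n => ((hφL n).sub h.memLp).1) hl hdL
    (Eventually.of_forall fun n => integrable_of_norm_le_mul hrs (hφL n) hdL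
      (hdL.1.mul (hφL n).1) (ae_of_all _ fun x => by rw [norm_mul, mul_comm]))
    (integrable_of_norm_le_mul hrs h.memLp hdL (hdL.1.mul h.memLp.1)
      (ae_of_all _ fun x => by rw [norm_mul, mul_comm]))
    (fun n => ae_of_all _ fun x => by rw [← mul_sub, norm_mul, mul_comm])
  have l2 := tendsto_integral_of_norm_sub_le_mul (ν := volume.restrict (Ω : Set (Sp N))) hrs
    (f := fun n x => gradient (φ n) x - G x) (g := V)
    (P := fun n x => inner ℝ (V x) (gradient (φ n) x)) (P' := fun x => inner ℝ (V x) (G x))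
    (fun n => ((hgφL n).sub h.memLp_gradient).1) hl' hVL
    (Eventually.of_forall fun n => integrable_of_norm_le_mul hrs (hgφL n) hVL
      (hVL.1.inner (hgφL n).1)
      (ae_of_all _ fun x => (norm_inner_le_norm _ _).trans_eq (mul_comm _ _)))
    (integrable_of_norm_le_mul hrs h.memLp_gradient hVL (hVL.1.inner h.memLp_gradient.1)
      (ae_of_all _ fun x => (norm_inner_le_norm _ _).trans_eq (mul_comm _ _)))
    (fun n => ae_of_all _ fun x => by
      rw [← inner_sub_right]; exact (norm_inner_le_norm _ _).trans_eq (mul_comm _ _))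
  refine tendsto_nhds_unique l2 (l1.neg.congr fun n => ?_)
  exact (hV.2.2 ⟨φ n, hφ n, hφc n, (hφK n).trans hKΩ⟩).symm

/-- True for the approximants by integrating by parts against the constant 1, which belongs to the
dual Lebesgue space because $\Omega$ has finite measure. -/
theorem IsCompactLimit.integral_gradient_eq_zero {r : ℝ} (hr : 1 < r) {w : Sp N → ℝ}
    {G : Sp N → Sp N} (h : IsCompactLimit r Ω w G)
    [IsFiniteMeasure (volume.restrict (Ω : Set (Sp N)))] :
    ∫ x in (Ω : Set (Sp N)), G x = 0 := by
  obtain ⟨K, hK, hKΩ, φ, hφ, hφK, hl, hl'⟩ := h.exists_seq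
  have hrs := Real.HolderConjugate.conjExponent hr
  have hφc : ∀ n, HasCompactSupport (φ n) := fun n => hK.of_isClosed_subset (isClosed_tsupport _)
    (hφK n)
  have hφ1 : ∀ n, ContDiff ℝ 1 (φ n) := fun n => (hφ n).of_le (by simp)
  have hr1 := ofReal_one_le hr.le
  have hgφL : ∀ n, MemLp (gradient (φ n)) (ENNReal.ofReal r) (volume.restrict (Ω : Set (Sp N))) :=
    fun n => memLp_of_continuous_compact (continuous_gradient (hφ1 n))
      (hasCompactSupport_gradient (hφc n)) _ _
  have l2 := tendsto_integral_of_norm_sub_le_mul (ν := volume.restrict (Ω : Set (Sp N))) hrs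
    (f := fun n x => gradient (φ n) x - G x) (g := fun _ => (1 : ℝ))
    (P := fun n x => gradient (φ n) x) (P' := G)
    (fun n => ((hgφL n).sub h.memLp_gradient).1) hl' (memLp_const _)
    (Eventually.of_forall fun n => (hgφL n).integrable hr1)
    (h.memLp_gradient.integrable hr1)
    (fun n => ae_of_all _ fun x => by simp)
  refine tendsto_nhds_unique l2 (tendsto_const_nhds.congr fun n => ?_)
  rw [setIntegral_eq_integral_of_tsupport hKΩ]
  · have := integral_smul_gradient_eq_neg (a := fun _ => (1 : ℝ)) contDiff_const (hφ1 n) (hφc n)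
    simpa using this.symm
  · intro x hx
    exact gradient_eq_zero_of_notMem_tsupport fun h => hx (hφK n h)

end Sobolev

/-- Dominated convergence in `L^r`. -/
theorem tendsto_eLpNorm_zero_of_dominated {α F F' : Type*} [MeasurableSpace α] {ν : Measure α}
    [NormedAddCommGroup F] [NormedAddCommGroup F'] {r : ℝ} (hr : 1 ≤ r) {f : ℕ → α → F} {g : α → F'}
    (hf : ∀ n, AEStronglyMeasurable (f n) ν) (hg : MemLp g (ENNReal.ofReal r) ν)
    (hfg : ∀ n, ∀ᵐ x ∂ν, ‖f n x‖ ≤ ‖g x‖) (hl : ∀ᵐ x ∂ν, Tendsto (fun n => f n x) atTop (𝓝 0)) :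
    Tendsto (fun n => eLpNorm (f n) (ENNReal.ofReal r) ν) atTop (𝓝 0) := by
  have hr0 : 0 < r := by linarith
  have h0 : ENNReal.ofReal r ≠ 0 := by simpa using hr0
  have e : ∀ n, eLpNorm (f n) (ENNReal.ofReal r) ν = (∫⁻ x, ‖f n x‖ₑ ^ r ∂ν) ^ (1 / r) := fun n => by
    rw [eLpNorm_eq_lintegral_rpow_enorm_toReal h0 ENNReal.ofReal_ne_top,
      ENNReal.toReal_ofReal hr0.le]
  simp_rw [e]
  have h1 : Tendsto (fun n => ∫⁻ x, ‖f n x‖ₑ ^ r ∂ν) atTop (𝓝 (∫⁻ x, 0 ∂ν)) := by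
    refine tendsto_lintegral_of_dominated_convergence' (fun x => ‖g x‖ₑ ^ r)
      (fun n => (hf n).enorm.pow_const r) (fun n => ?_) ?_ ?_
    · filter_upwards [hfg n] with x hx
      gcongr
      exact enorm_le_iff_norm_le.2 hx
    · have := lintegral_rpow_enorm_lt_top_of_eLpNorm_lt_top h0 ENNReal.ofReal_ne_top hg.2
      rw [ENNReal.toReal_ofReal hr0.le] at this
      exact this.ne
    · filter_upwards [hl] with x hx
      have := (ENNReal.continuous_rpow_const (y := r)).tendsto 0 |>.comp
        (by simpa using hx.enorm : Tendsto (fun n => ‖f n x‖ₑ) atTop (𝓝 0))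
      simpa [hr0, Function.comp_def] using this
  have h2 := (ENNReal.continuous_rpow_const (y := 1 / r)).tendsto _ |>.comp h1
  simpa [hr0, Function.comp_def] using h2

/-! ### Smooth approximation, chain rule, gradient on the zero set -/

section Sobolev

variable {N : ℕ} {Ω : Opens (Sp N)}

theorem memLp_indicator {F : Type*} [NormedAddCommGroup F] {q : ℝ≥0∞} {g : Sp N → F}
    (hg : MemLp g q (volume.restrict Ω)) : MemLp ((Ω : Set (Sp N)).indicator g) q :=
  (memLp_indicator_iff_restrict Ω.isOpen.measurableSet).2 hg

/-- Local approximation of a Sobolev function by smooth functions. -/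
theorem MemW1.exists_smooth_approx {r : ℝ} (hr : 1 ≤ r) {w : Sp N → ℝ} {G : Sp N → Sp N}
    (h : MemW1 (ENNReal.ofReal r) Ω w G) {K : Set (Sp N)} (hK : IsCompact K) (hKΩ : K ⊆ Ω) :
    ∃ φ : ℕ → Sp N → ℝ, (∀ n, ContDiff ℝ ∞ (φ n)) ∧
      Tendsto (fun n => eLpNorm (fun x => φ n x - w x) (ENNReal.ofReal r) (volume.restrict Ω))
        atTop (𝓝 0) ∧
      Tendsto (fun n => eLpNorm (fun x => gradient (φ n) x - G x) (ENNReal.ofReal r)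
        (volume.restrict K)) atTop (𝓝 0) ∧
      ∀ᵐ x ∂(volume.restrict (Ω : Set (Sp N))), Tendsto (fun n => φ n x) atTop (𝓝 (w x)) := by
  -- With radii at most `δ`, the gradient of the mollification is the mollified weak gradient at
  -- every point of `K`. Near the boundary of $\Omega$ this may fail because of the truncation, so
  -- gradients are only claimed to converge on `K`.
  obtain ⟨δ, hδ, hδK⟩ := hK.exists_cthickening_subset_open Ω.isOpen hKΩ
  obtain ⟨k, d, hk, hd, hd0, hdδ⟩ := exists_isKernel_seq (volume : Measure (Sp N)) hδ
  have hw := memLp_indicator h.1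
  have hG := memLp_indicator h.2.1
  have hwi := hw.locallyIntegrable (ofReal_one_le hr)
  have hm := Ω.isOpen.measurableSet
  let φ := fun n => mollify volume (k n) ((Ω : Set (Sp N)).indicator w)
  have hφ : ∀ n, ContDiff ℝ ∞ (φ n) := fun n =>
    contDiff_mollify (hk n).contDiff (hk n).hasCompactSupport hwi
  have t1 : Tendsto (fun n => eLpNorm (fun x => φ n x - w x) (ENNReal.ofReal r)
      (volume.restrict (Ω : Set (Sp N)))) atTop (𝓝 0) := by
    refine tendsto_of_tendsto_of_tendsto_of_le_of_le tendsto_const_nhds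
      (tendsto_eLpNorm_mollify_sub hk hd hr hw) (fun _ => zero_le) fun n => ?_
    refine le_trans (le_of_eq (eLpNorm_congr_ae ?_)) (eLpNorm_restrict_le _ _ _ (Ω : Set (Sp N)))
    filter_upwards [ae_restrict_mem hm] with x hx
    simp [φ, indicator_of_mem hx]
  have t2 : Tendsto (fun n => eLpNorm (fun x => gradient (φ n) x - G x) (ENNReal.ofReal r)
      (volume.restrict K)) atTop (𝓝 0) := by
    refine tendsto_of_tendsto_of_tendsto_of_le_of_le tendsto_const_nhds
      (tendsto_eLpNorm_mollify_sub hk hd hr hG) (fun _ => zero_le) fun n => ?_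
    refine le_trans (le_of_eq (eLpNorm_congr_ae ?_)) (eLpNorm_restrict_le _ _ _ K)
    filter_upwards [ae_restrict_mem hK.measurableSet] with x hx
    simp only [φ]
    rw [gradient_mollify h.2.2 hwi (hk n), indicator_of_mem (hKΩ hx)]
    exact (Metric.closedBall_subset_closedBall (hdδ n)).trans
      ((Metric.closedBall_subset_cthickening hx δ).trans hδK)
  have hmeas : TendstoInMeasure (volume.restrict (Ω : Set (Sp N))) φ atTop w :=
    tendstoInMeasure_of_tendsto_eLpNorm (by simp; linarith)
      (fun n => (hφ n).continuous.aestronglyMeasurable) h.1.1 t1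
  obtain ⟨ns, hns, hae⟩ := hmeas.exists_seq_tendsto_ae
  exact ⟨fun n => φ (ns n), fun n => hφ _, t1.comp hns.tendsto_atTop, t2.comp hns.tendsto_atTop,
    hae⟩

theorem gradient_comp_mul {H : ℝ → ℝ} (hH : Differentiable ℝ H) {a ξ : Sp N → ℝ}
    (ha : Differentiable ℝ a) (hξ : Differentiable ℝ ξ) (x : Sp N) :
    gradient (fun x => H (a x) * ξ x) x
      = H (a x) • gradient ξ x + (deriv H (a x) * ξ x) • gradient a x := by
  refine ext_inner_right ℝ fun v => ?_
  have h1 : HasFDerivAt (fun x => H (a x)) (deriv H (a x) • fderiv ℝ a x) x :=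
    (hH (a x)).hasDerivAt.comp_hasFDerivAt x (ha x).hasFDerivAt
  have h2 : fderiv ℝ (fun x => H (a x) * ξ x) x = _ := (h1.mul (hξ x).hasFDerivAt).fderiv
  rw [inner_gradient_left, h2, inner_add_left, real_inner_smul_left,
    real_inner_smul_left, inner_gradient_left, inner_gradient_left]
  simp
  ring

/-- The chain rule for `H ∘ w`, localized by a test function `ξ`. -/
theorem MemW1.isCompactLimit_comp_mul {r : ℝ} (hr : 1 ≤ r) {w : Sp N → ℝ} {G : Sp N → Sp N}
    (h : MemW1 (ENNReal.ofReal r) Ω w G) {H : ℝ → ℝ} (hH : ContDiff ℝ ∞ H) {M : ℝ}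
    (hHM : ∀ s, |H s| ≤ M) (hHM' : ∀ s, |deriv H s| ≤ M) (ξ : 𝓓(Ω, ℝ)) :
    IsCompactLimit r Ω (fun x => H (w x) * ξ x)
      (fun x => H (w x) • gradient ξ x + (deriv H (w x) * ξ x) • G x) := by
  have hM : 0 ≤ M := (abs_nonneg _).trans (hHM 0)
  obtain ⟨φ, hφ, l1, l2, l3⟩ := h.exists_smooth_approx hr ξ.hasCompactSupport ξ.tsupport_subset
  have hξ1 : ContDiff ℝ 1 ξ := ξ.contDiff.of_le (by simp)
  have hgξ := continuous_gradient hξ1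
  have hgξc := hasCompactSupport_gradient ξ.hasCompactSupport
  obtain ⟨C, hC⟩ := ξ.hasCompactSupport.exists_bound_of_continuous ξ.continuous
  obtain ⟨C', hC'⟩ := hgξc.exists_bound_of_continuous hgξ
  have hC0 : 0 ≤ C := (norm_nonneg _).trans (hC 0)
  have hC0' : 0 ≤ C' := (norm_nonneg _).trans (hC' 0)
  have hH1 : Differentiable ℝ H := hH.differentiable (by simp)
  have hH' : Continuous (deriv H) := hH.continuous_deriv (by simp)
  have hLip : ∀ a b, |H a - H b| ≤ M * |a - b| := fun a b => by
    have := Convex.norm_image_sub_le_of_norm_deriv_le (f := H) (s := univ) (C := M)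
      (fun x _ => hH1 x) (fun x _ => hHM' x) convex_univ (mem_univ b) (mem_univ a)
    simpa using this
  have hwm := h.1.1
  have hHw : AEStronglyMeasurable (fun x => H (w x)) (volume.restrict (Ω : Set (Sp N))) :=
    hH.continuous.comp_aestronglyMeasurable hwm
  have hHw' : AEStronglyMeasurable (fun x => deriv H (w x)) (volume.restrict (Ω : Set (Sp N))) :=
    hH'.comp_aestronglyMeasurable hwm
  have hφm : ∀ n (ν : Measure (Sp N)), AEStronglyMeasurable (φ n) ν := fun n ν =>
    (hφ n).continuous.aestronglyMeasurable
  have hGm := h.2.1.1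
  have hgφm : ∀ n (ν : Measure (Sp N)), AEStronglyMeasurable (gradient (φ n)) ν := fun n ν =>
    (continuous_gradient ((hφ n).of_le (by simp))).aestronglyMeasurable
  have hξm : ∀ ν : Measure (Sp N), AEStronglyMeasurable ξ ν := fun ν =>
    ξ.continuous.aestronglyMeasurable
  have hgξm : ∀ ν : Measure (Sp N), AEStronglyMeasurable (gradient ξ) ν := fun ν =>
    hgξ.aestronglyMeasurable
  refine ⟨?_, ?_, tsupport ξ, ξ.hasCompactSupport, ξ.tsupport_subset,
    fun n x => H (φ n x) * ξ x, fun n => (hH.comp (hφ n)).mul ξ.contDiff,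
    fun n => tsupport_mul_subset_right, ?_, ?_⟩
  · refine (memLp_of_continuous_compact ξ.continuous ξ.hasCompactSupport _ _).of_le_mul (c := M)
      (hHw.mul (hξm _)) (ae_of_all _ fun x => ?_)
    rw [norm_mul]
    gcongr
    exact hHM _
  · refine MemLp.add ?_ ?_
    · refine (memLp_of_continuous_compact hgξ hgξc _ _).of_le_mul (c := M)
        (hHw.smul (hgξm _)) (ae_of_all _ fun x => ?_)
      rw [norm_smul]
      gcongr
      exact hHM _
    · refine h.2.1.of_le_mul (c := M * C) ((hHw'.mul (hξm _)).smul hGm) (ae_of_all _ fun x => ?_)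
      rw [norm_smul, norm_mul]
      gcongr
      · exact hHM' _
      · exact hC _
  · have hb : ∀ n, eLpNorm (fun x => H (φ n x) * ξ x - H (w x) * ξ x) (ENNReal.ofReal r)
        (volume.restrict (Ω : Set (Sp N))) ≤ ENNReal.ofReal (M * C) *
        eLpNorm (fun x => φ n x - w x) (ENNReal.ofReal r) (volume.restrict (Ω : Set (Sp N))) := by
      refine fun n => eLpNorm_le_mul_eLpNorm_of_ae_le_mul (ae_of_all _ fun x => ?_) _
      rw [← sub_mul, norm_mul, mul_right_comm]
      gcongr
      · exact hLip _ _
      · exact hC _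
    refine tendsto_of_tendsto_of_tendsto_of_le_of_le tendsto_const_nhds ?_ (fun _ => zero_le) hb
    simpa using ENNReal.Tendsto.const_mul l1 (Or.inr ENNReal.ofReal_ne_top)
  -- Three sources of error. `f1` is controlled by the Lipschitz bound on `H`. `f2` uses the
  -- convergence of gradients, available on the support of `ξ` only, which suffices. In `f3` the
  -- difference of derivatives of `H` merely tends to zero almost everywhere, so dominated
  -- convergence with majorant `G` is used.
  · set f1 : ℕ → Sp N → Sp N := fun n x => (H (φ n x) - H (w x)) • gradient ξ x
    set f2 : ℕ → Sp N → Sp N := fun n x => (deriv H (φ n x) * ξ x) • (gradient (φ n) x - G x)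
    set f3 : ℕ → Sp N → Sp N := fun n x => ((deriv H (φ n x) - deriv H (w x)) * ξ x) • G x
    have e : ∀ n, (fun x => gradient (fun x => H (φ n x) * ξ x) x -
        (H (w x) • gradient ξ x + (deriv H (w x) * ξ x) • G x)) = f1 n + f2 n + f3 n := fun n => by
      funext x
      rw [gradient_comp_mul hH1 ((hφ n).differentiable (by simp))
        (ξ.contDiff.differentiable (by simp))]
      simp only [f1, f2, f3, Pi.add_apply, sub_smul, sub_mul, smul_sub]
      abel
    have m1 : ∀ n, AEStronglyMeasurable (f1 n) (volume.restrict (Ω : Set (Sp N))) := fun n =>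
      ((hH.continuous.comp_aestronglyMeasurable (hφm n _)).sub hHw).smul (hgξm _)
    have m2 : ∀ n, AEStronglyMeasurable (f2 n) (volume.restrict (Ω : Set (Sp N))) := fun n =>
      ((hH'.comp_aestronglyMeasurable (hφm n _)).mul (hξm _)).smul ((hgφm n _).sub hGm)
    have m3 : ∀ n, AEStronglyMeasurable (f3 n) (volume.restrict (Ω : Set (Sp N))) := fun n =>
      (((hH'.comp_aestronglyMeasurable (hφm n _)).sub hHw').mul (hξm _)).smul hGm
    have c1 : Tendsto (fun n => eLpNorm (f1 n) (ENNReal.ofReal r)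
        (volume.restrict (Ω : Set (Sp N)))) atTop (𝓝 0) := by
      have hb : ∀ n, eLpNorm (f1 n) (ENNReal.ofReal r)
          (volume.restrict (Ω : Set (Sp N))) ≤ ENNReal.ofReal (M * C') *
          eLpNorm (fun x => φ n x - w x) (ENNReal.ofReal r)
            (volume.restrict (Ω : Set (Sp N))) := by
        refine fun n => eLpNorm_le_mul_eLpNorm_of_ae_le_mul (ae_of_all _ fun x => ?_) _
        rw [norm_smul, mul_right_comm]
        gcongr
        · exact hLip _ _
        · exact hC' _
      refine tendsto_of_tendsto_of_tendsto_of_le_of_le tendsto_const_nhds ?_ (fun _ => zero_le) hb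
      simpa using ENNReal.Tendsto.const_mul l1 (Or.inr ENNReal.ofReal_ne_top)
    have c2 : Tendsto (fun n => eLpNorm (f2 n) (ENNReal.ofReal r)
        (volume.restrict (Ω : Set (Sp N)))) atTop (𝓝 0) := by
      have hb : ∀ n, eLpNorm (f2 n) (ENNReal.ofReal r)
          (volume.restrict (Ω : Set (Sp N))) ≤ ENNReal.ofReal (M * C) *
          eLpNorm (fun x => gradient (φ n) x - G x) (ENNReal.ofReal r)
            (volume.restrict (tsupport ξ)) := by
        intro n
        rw [← eLpNorm_indicator_eq_eLpNorm_restrict (isClosed_tsupport ξ).measurableSet]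
        refine (eLpNorm_restrict_le _ _ _ _).trans
          (eLpNorm_le_mul_eLpNorm_of_ae_le_mul (ae_of_all _ fun x => ?_) _)
        by_cases hx : x ∈ tsupport ξ
        · rw [indicator_of_mem hx, norm_smul, norm_mul]
          gcongr
          · exact hHM' _
          · exact hC _
        · simp [f2, image_eq_zero_of_notMem_tsupport hx, indicator_of_notMem hx]
      refine tendsto_of_tendsto_of_tendsto_of_le_of_le tendsto_const_nhds ?_ (fun _ => zero_le) hb
      simpa using ENNReal.Tendsto.const_mul l2 (Or.inr ENNReal.ofReal_ne_top)
    have c3 : Tendsto (fun n => eLpNorm (f3 n) (ENNReal.ofReal r)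
        (volume.restrict (Ω : Set (Sp N)))) atTop (𝓝 0) := by
      refine tendsto_eLpNorm_zero_of_dominated hr m3 (h.2.1.const_smul (2 * M * C))
        (fun n => ae_of_all _ fun x => ?_) ?_
      · have h1 : ‖deriv H (φ n x) - deriv H (w x)‖ ≤ 2 * M :=
          (norm_sub_le _ _).trans ((add_le_add (hHM' _) (hHM' _)).trans_eq (two_mul M).symm)
        rw [norm_smul, Pi.smul_apply, norm_smul, norm_mul,
          Real.norm_of_nonneg (by positivity : 0 ≤ 2 * M * C)]
        gcongr
        exact hC _
      · filter_upwards [l3] with x hx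
        have h1 : Tendsto (fun n => deriv H (φ n x) - deriv H (w x)) atTop (𝓝 0) := by
          have := ((hH'.tendsto _).comp hx).sub_const (deriv H (w x))
          simpa using this
        have := (h1.mul_const (ξ x)).smul_const (G x)
        simpa using this
    have c := (c1.add c2).add c3
    simp only [add_zero] at c
    refine tendsto_of_tendsto_of_tendsto_of_le_of_le tendsto_const_nhds c (fun _ => zero_le)
      fun n => ?_
    simp only [e]
    exact (eLpNorm_add_le ((m1 n).add (m2 n)) (m3 n) (ofReal_one_le hr)).trans
      (add_le_add_left (eLpNorm_add_le (m1 n) (m2 n) (ofReal_one_le hr)) _)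

/-- The weak gradient of a Sobolev function vanishes almost everywhere on its zero set. -/
theorem MemW1.ae_gradient_eq_zero {r : ℝ} (hr : 1 < r) {w : Sp N → ℝ} {G : Sp N → Sp N}
    (h : MemW1 (ENNReal.ofReal r) Ω w G) [IsFiniteMeasure (volume.restrict (Ω : Set (Sp N)))] :
    ∀ᵐ x ∂(volume.restrict (Ω : Set (Sp N))), w x = 0 → G x = 0 := by
  -- These functions tend to zero uniformly, while their derivatives are bounded by 1 and tend to
  -- the indicator of $\{0\}$. The gradient of $H_n(w)\xi$ has zero integral; in the limit only the
  -- integral of $\xi G$ over $\{w=0\}$ survives.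
  let H : ℕ → ℝ → ℝ := fun n s => ((n : ℝ) + 1)⁻¹ * Real.arctan ((n + 1) * s)
  have hd : ∀ n s, HasDerivAt (H n) (1 / (1 + ((n + 1) * s) ^ 2)) s := fun n s => by
    have h1 : HasDerivAt (fun s : ℝ => ((n : ℝ) + 1) * s) (n + 1) s := by
      simpa using (hasDerivAt_id s).const_mul ((n : ℝ) + 1)
    have h2 := (h1.arctan).const_mul ((n : ℝ) + 1)⁻¹
    have h3 : (n : ℝ) + 1 ≠ 0 := by positivity
    exact h2.congr_deriv (by field_simp)
  have hH : ∀ n, ContDiff ℝ ∞ (H n) := fun n =>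
    contDiff_const.mul (Real.contDiff_arctan.comp (contDiff_const.mul contDiff_id))
  have hab : ∀ n s, |H n s| ≤ ((n : ℝ) + 1)⁻¹ * 2 := fun n s => by
    simp only [H, abs_mul, abs_inv]
    rw [abs_of_pos (by positivity : (0 : ℝ) < n + 1)]
    gcongr
    rw [abs_le]
    have := Real.neg_pi_div_two_lt_arctan ((n + 1) * s)
    have := Real.arctan_lt_pi_div_two ((n + 1) * s)
    have := Real.pi_le_four
    constructor <;> linarith
  have hab' : ∀ n s, |deriv (H n) s| ≤ 1 := fun n s => by
    rw [(hd n s).deriv, abs_of_nonneg (by positivity), div_le_one (by positivity)]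
    nlinarith [sq_nonneg (((n : ℝ) + 1) * s)]
  have hr1 := ofReal_one_le hr.le
  have hGi : Integrable G (volume.restrict (Ω : Set (Sp N))) := h.2.1.integrable hr1
  have hwm := h.1.1
  have key : ∀ ξ : 𝓓(Ω, ℝ), ∫ x in (Ω : Set (Sp N)),
      ξ x • (if w x = 0 then G x else 0) = 0 := by
    intro ξ
    have hξ1 : ContDiff ℝ 1 ξ := ξ.contDiff.of_le (by simp)
    have hgξ := continuous_gradient hξ1
    have hgξc := hasCompactSupport_gradient ξ.hasCompactSupport
    obtain ⟨C, hC⟩ := ξ.hasCompactSupport.exists_bound_of_continuous ξ.continuous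
    have hC0 : 0 ≤ C := (norm_nonneg _).trans (hC 0)
    have hi := (hgξ.integrable_of_hasCompactSupport (μ := volume) hgξc).restrict
      (s := (Ω : Set (Sp N)))
    have hz : ∀ n, ∫ x in (Ω : Set (Sp N)),
        (H n (w x) • gradient ξ x + (deriv (H n) (w x) * ξ x) • G x) = 0 := fun n =>
      (h.isCompactLimit_comp_mul hr.le (hH n) (M := 2) (fun s => (hab n s).trans (by
        have : ((n : ℝ) + 1)⁻¹ ≤ 1 := inv_le_one_of_one_le₀ (by simp)
        linarith)) (fun s => (hab' n s).trans (by norm_num)) ξ).integral_gradient_eq_zero hr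
    have hlim : Tendsto (fun n => ∫ x in (Ω : Set (Sp N)),
        (H n (w x) • gradient ξ x + (deriv (H n) (w x) * ξ x) • G x)) atTop
        (𝓝 (∫ x in (Ω : Set (Sp N)), ξ x • (if w x = 0 then G x else 0))) := by
      refine tendsto_integral_of_dominated_convergence
        (fun x => 2 * ‖gradient ξ x‖ + 1 * C * ‖G x‖) (fun n => ?_)
        ((hi.norm.const_mul _).add (hGi.norm.const_mul _)) (fun n => ae_of_all _ fun x => ?_)
        (ae_of_all _ fun x => ?_)
      · refine AEStronglyMeasurable.add ?_ ?_
        · exact ((hH n).continuous.comp_aestronglyMeasurable hwm).smul hgξ.aestronglyMeasurable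
        · exact ((((hH n).continuous_deriv (by simp)).comp_aestronglyMeasurable hwm).mul
            ξ.continuous.aestronglyMeasurable).smul hGi.1
      · refine (norm_add_le _ _).trans ?_
        have h1 : ‖H n (w x)‖ ≤ 2 := (hab n _).trans (by
          have : ((n : ℝ) + 1)⁻¹ ≤ 1 := inv_le_one_of_one_le₀ (by simp)
          linarith)
        rw [norm_smul, norm_smul, norm_mul (deriv (H n) (w x)) (ξ x)]
        exact add_le_add (mul_le_mul_of_nonneg_right h1 (norm_nonneg _))
          (mul_le_mul_of_nonneg_right (mul_le_mul (hab' n _) (hC _) (norm_nonneg _) zero_le_one)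
            (norm_nonneg _))
      · have t0 : Tendsto (fun n : ℕ => ((n : ℝ) + 1)) atTop atTop :=
          tendsto_natCast_atTop_atTop.atTop_add tendsto_const_nhds
        have t1 : Tendsto (fun n => H n (w x)) atTop (𝓝 0) := by
          refine squeeze_zero_norm (fun n => hab n (w x)) ?_
          simpa using t0.inv_tendsto_atTop.mul_const 2
        have t2 : Tendsto (fun n => (deriv (H n) (w x) * ξ x) • G x) atTop
            (𝓝 (ξ x • (if w x = 0 then G x else 0))) := by
          by_cases hx : w x = 0
          · simp [(hd _ _).deriv, hx]
          · simp only [hx, if_false, smul_zero, (hd _ _).deriv]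
            have : Tendsto (fun n : ℕ => 1 / (1 + (((n : ℝ) + 1) * w x) ^ 2)) atTop (𝓝 0) := by
              refine Tendsto.div_atTop tendsto_const_nhds (tendsto_atTop_add_const_left _ _ ?_)
              have h1 : Tendsto (fun n : ℕ => ((n : ℝ) + 1) ^ 2 * (w x) ^ 2) atTop atTop :=
                ((tendsto_pow_atTop two_ne_zero).comp t0).atTop_mul_const (by positivity)
              simpa [mul_pow] using h1
            simpa using (this.mul_const (ξ x)).smul_const (G x)
        simpa using (t1.smul_const (gradient ξ x)).add t2
    refine tendsto_nhds_unique hlim ?_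
    simp only [hz]
    exact tendsto_const_nhds
  have hm : AEStronglyMeasurable (fun x => if w x = 0 then G x else 0)
      (volume.restrict (Ω : Set (Sp N))) := by
    have hs : NullMeasurableSet {x | w x = 0} (volume.restrict (Ω : Set (Sp N))) :=
      hwm.aemeasurable.nullMeasurable (measurableSet_singleton 0)
    have := hGi.1.indicator₀ hs
    refine this.congr (ae_of_all _ fun x => ?_)
    simp [indicator]
  have hgi : Integrable (fun x => if w x = 0 then G x else 0)
      (volume.restrict (Ω : Set (Sp N))) := by
    refine hGi.mono hm (ae_of_all _ fun x => ?_)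
    split_ifs <;> simp
  have h0 := Ω.isOpen.ae_eq_zero_of_integral_contDiff_smul_eq_zero (μ := volume)
    (f := fun x => if w x = 0 then G x else 0)
    (locallyIntegrableOn_of_locallyIntegrable_restrict hgi.locallyIntegrable) (fun g hg hgc hgΩ => by
      refine Eq.trans ?_ (key ⟨g, hg, hgc, hgΩ⟩)
      exact (setIntegral_eq_integral_of_tsupport (h := fun x => g x • (if w x = 0 then G x else 0))
        hgΩ fun x hx => by
          simp only [image_eq_zero_of_notMem_tsupport hx, zero_smul]).symm)
  rw [ae_restrict_iff' Ω.isOpen.measurableSet]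
  filter_upwards [h0] with x hx hxΩ hwx
  have := hx hxΩ
  rwa [if_pos hwx] at this

end Sobolev

/-! ### Increments of Sobolev functions -/

section Translation

variable {N : ℕ} {Ω : Opens (Sp N)}

theorem hasWeakGradient_top {ζ : Sp N → ℝ} (hζ : ContDiff ℝ 1 ζ) :
    HasWeakGradient (⊤ : Opens (Sp N)) ζ (gradient ζ) := by
  refine ⟨hζ.continuous.locallyIntegrable.locallyIntegrableOn _,
    (continuous_gradient hζ).locallyIntegrable.locallyIntegrableOn _, fun φ => ?_⟩
  simp only [Opens.coe_top, Measure.restrict_univ]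
  exact integral_smul_gradient_eq_neg hζ (φ.contDiff.of_le (by simp)) φ.hasCompactSupport

/-- Kernels of radius at most `δ` keep all mollifications supported in one compact thickening of the
support. The lemma admits test functions that are merely $C^1$, such as products of `φ` with `β` of
a smooth function. -/
theorem isCompactLimit_of_contDiff {r : ℝ} (hr : 1 ≤ r) {ζ : Sp N → ℝ} (hζ : ContDiff ℝ 1 ζ)
    (hζc : HasCompactSupport ζ) (hζΩ : tsupport ζ ⊆ Ω) :
    IsCompactLimit r Ω ζ (gradient ζ) := by
  obtain ⟨δ, hδ, hδK⟩ := hζc.exists_cthickening_subset_open Ω.isOpen hζΩ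
  obtain ⟨k, d, hk, hd, hd0, hdδ⟩ := exists_isKernel_seq (volume : Measure (Sp N)) hδ
  have hgc := hasCompactSupport_gradient hζc
  have hgζ := continuous_gradient hζ
  have hζL := hζ.continuous.memLp_of_hasCompactSupport (μ := volume) (p := ENNReal.ofReal r) hζc
  have hgL := hgζ.memLp_of_hasCompactSupport (μ := volume) (p := ENNReal.ofReal r) hgc
  refine ⟨hζL.restrict _, hgL.restrict _, Metric.cthickening δ (tsupport ζ), hζc.cthickening, hδK,
    fun n => mollify volume (k n) ζ, fun n => contDiff_mollify (hk n).contDiff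
      (hk n).hasCompactSupport hζ.continuous.locallyIntegrable, fun n => ?_, ?_, ?_⟩
  · refine closure_minimal (fun x hx => ?_) Metric.isClosed_cthickening
    by_contra hx'
    refine hx (integral_eq_zero_of_ae (ae_of_all _ fun y => ?_))
    by_cases hy : y ∈ tsupport ζ
    · simp only [Pi.zero_apply]
      rw [(hk n).eq_zero, zero_smul]
      by_contra hlt
      refine hx' (Metric.mem_cthickening_of_dist_le x y δ _ hy ?_)
      rw [dist_eq_norm]
      exact (not_lt.1 hlt).trans (hdδ n)
    · simp [image_eq_zero_of_notMem_tsupport hy]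
  · exact tendsto_of_tendsto_of_tendsto_of_le_of_le tendsto_const_nhds
      (tendsto_eLpNorm_mollify_sub hk hd hr hζL) (fun _ => zero_le)
      fun n => eLpNorm_restrict_le _ _ _ _
  · refine tendsto_of_tendsto_of_tendsto_of_le_of_le tendsto_const_nhds
      (tendsto_eLpNorm_mollify_sub hk hd hr hgL) (fun _ => zero_le)
      fun n => le_trans (le_of_eq ?_) (eLpNorm_restrict_le _ _ _ (Ω : Set (Sp N)))
    have hloc : LocallyIntegrable (((⊤ : Opens (Sp N)) : Set (Sp N)).indicator ζ) := by
      simpa using hζ.continuous.locallyIntegrable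
    have := fun x => gradient_mollify (hasWeakGradient_top hζ) hloc (hk n) (x := x)
      (by simp)
    simp only [Opens.coe_top, indicator_univ] at this
    simp only [this]

/-- The fundamental theorem of calculus along the segment from $x$ to $x-h$. -/
theorem enorm_translation_sub_le {φ : Sp N → ℝ} (hφ : ContDiff ℝ 1 φ) (x h : Sp N) :
    ‖φ (x - h) - φ x‖ₑ ≤ ‖h‖ₑ * ∫⁻ s in Ioc (0 : ℝ) 1, ‖gradient φ (x - s • h)‖ₑ := by
  have hd : ∀ s : ℝ, HasDerivAt (fun s : ℝ => φ (x - s • h)) (fderiv ℝ φ (x - s • h) (-h)) s := by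
    intro s
    have h1 : HasDerivAt (fun s : ℝ => x - s • h) (-h) s := by
      simpa using ((hasDerivAt_id s).smul_const h).const_sub x
    exact (hφ.differentiable one_ne_zero _).hasFDerivAt.comp_hasDerivAt s h1
  have hc : Continuous fun s : ℝ => fderiv ℝ φ (x - s • h) (-h) :=
    ((hφ.continuous_fderiv one_ne_zero).comp (by fun_prop)).clm_apply continuous_const
  have e := intervalIntegral.integral_eq_sub_of_hasDerivAt (a := 0) (b := 1) (fun s _ => hd s)
    (hc.intervalIntegrable _ _)
  simp only [one_smul, zero_smul, sub_zero] at e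
  rw [← e, intervalIntegral.integral_of_le zero_le_one]
  refine (enorm_integral_le_lintegral_enorm _).trans ?_
  rw [← lintegral_const_mul' _ _ enorm_ne_top]
  refine lintegral_mono fun s => ?_
  rw [← enorm_norm h, ← enorm_norm (gradient φ _), ← enorm_mul, norm_gradient]
  refine enorm_le_iff_norm_le.2 ?_
  rw [norm_mul, norm_norm, norm_norm, mul_comm]
  simpa using (fderiv ℝ φ (x - s • h)).le_opNorm (-h)

/-- Jensen's inequality on the unit interval, Tonelli's theorem and translation invariance. The
field `g` has to agree with the gradient only along segments issued from `K`, so it can be the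
mollification of a truncated weak gradient. -/
theorem eLpNorm_translation_sub_le_of_contDiff {r : ℝ} (hr : 1 ≤ r) {φ : Sp N → ℝ}
    (hφ : ContDiff ℝ 1 φ) {g : Sp N → Sp N} {K : Set (Sp N)}
    (hK : MeasurableSet K) {h : Sp N}
    (hgφ : ∀ x ∈ K, ∀ s ∈ Ioc (0 : ℝ) 1, gradient φ (x - s • h) = g (x - s • h)) :
    eLpNorm (fun x => φ (x - h) - φ x) (ENNReal.ofReal r) (volume.restrict K)
      ≤ ‖h‖ₑ * eLpNorm g (ENNReal.ofReal r) volume := by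
  have hr0 : 0 < r := by linarith
  rw [eLpNorm_ofReal_eq hr, eLpNorm_ofReal_eq hr, ENNReal.rpow_inv_le_iff hr0,
    ENNReal.mul_rpow_of_nonneg _ _ hr0.le, ← ENNReal.rpow_mul, inv_mul_cancel₀ hr0.ne',
    ENNReal.rpow_one]
  have hp : IsProbabilityMeasure (volume.restrict (Ioc (0 : ℝ) 1)) := ⟨by simp⟩
  have hc := continuous_gradient hφ
  calc ∫⁻ x in K, ‖φ (x - h) - φ x‖ₑ ^ r
      ≤ ∫⁻ x in K, ‖h‖ₑ ^ r * ∫⁻ s in Ioc (0 : ℝ) 1, ‖gradient φ (x - s • h)‖ₑ ^ r := by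
        refine lintegral_mono fun x => ?_
        refine (ENNReal.rpow_le_rpow (enorm_translation_sub_le hφ x h) hr0.le).trans ?_
        rw [ENNReal.mul_rpow_of_nonneg _ _ hr0.le]
        gcongr
        refine lintegral_rpow_le_of_isProbabilityMeasure hr ?_
        have : Continuous fun s : ℝ => gradient φ (x - s • h) := hc.comp (by fun_prop)
        exact this.enorm.measurable.aemeasurable
    _ = ‖h‖ₑ ^ r * ∫⁻ s in Ioc (0 : ℝ) 1, ∫⁻ x in K, ‖gradient φ (x - s • h)‖ₑ ^ r := by
        rw [lintegral_const_mul' _ _ (ENNReal.rpow_ne_top_of_nonneg hr0.le enorm_ne_top),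
          lintegral_lintegral_swap]
        have : Continuous fun z : Sp N × ℝ => gradient φ (z.1 - z.2 • h) := hc.comp (by fun_prop)
        exact (this.enorm.measurable.pow_const r).aemeasurable
    _ ≤ ‖h‖ₑ ^ r * ∫⁻ s in Ioc (0 : ℝ) 1, ∫⁻ x, ‖g x‖ₑ ^ r := by
        refine mul_le_mul_right (setLIntegral_mono' measurableSet_Ioc fun s hs => ?_) _
        calc ∫⁻ x in K, ‖gradient φ (x - s • h)‖ₑ ^ r
            = ∫⁻ x in K, ‖g (x - s • h)‖ₑ ^ r :=
              setLIntegral_congr_fun hK fun x hx => by simp only [hgφ x hx s hs]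
          _ ≤ ∫⁻ x, ‖g (x - s • h)‖ₑ ^ r := setLIntegral_le_lintegral _ _
          _ = ∫⁻ x, ‖g x‖ₑ ^ r := lintegral_sub_right_eq_self (fun x => ‖g x‖ₑ ^ r) _
    _ = ‖h‖ₑ ^ r * ∫⁻ x, ‖g x‖ₑ ^ r := by simp

/-- Differences of a Sobolev function are controlled by its gradient. -/
theorem MemW1.eLpNorm_translation_sub_le {r : ℝ} (hr : 1 ≤ r) {w : Sp N → ℝ} {G : Sp N → Sp N}
    (hw : MemW1 (ENNReal.ofReal r) Ω w G) {K : Set (Sp N)} (hK : MeasurableSet K) {δ : ℝ}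
    (hδ : 0 < δ) (hKΩ : ∀ x ∈ K, Metric.closedBall x (2 * δ) ⊆ Ω) {h : Sp N} (hh : ‖h‖ ≤ δ) :
    eLpNorm (fun x => (Ω : Set (Sp N)).indicator w (x - h) - (Ω : Set (Sp N)).indicator w x)
      (ENNReal.ofReal r) (volume.restrict K)
      ≤ ‖h‖ₑ * eLpNorm G (ENNReal.ofReal r) (volume.restrict Ω) := by
  obtain ⟨k, d, hk, hd, hd0, hdδ⟩ := exists_isKernel_seq (volume : Measure (Sp N)) hδ
  have hr1 := ofReal_one_le hr
  have hwL := memLp_indicator hw.1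
  have hGL := memLp_indicator hw.2.1
  have hwi := hwL.locallyIntegrable hr1
  set w' := (Ω : Set (Sp N)).indicator w
  set G' := (Ω : Set (Sp N)).indicator G
  have hGG : eLpNorm G (ENNReal.ofReal r) (volume.restrict (Ω : Set (Sp N)))
      = eLpNorm G' (ENNReal.ofReal r) volume :=
    (eLpNorm_indicator_eq_eLpNorm_restrict Ω.isOpen.measurableSet).symm
  rw [hGG]
  have hφ : ∀ n, ContDiff ℝ ∞ (mollify volume (k n) w') := fun n =>
    contDiff_mollify (hk n).contDiff (hk n).hasCompactSupport hwi
  have hg : ∀ n, ContDiff ℝ ∞ (mollify volume (k n) G') := fun n =>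
    contDiff_mollify (hk n).contDiff (hk n).hasCompactSupport (hGL.locallyIntegrable hr1)
  have l1 := tendsto_eLpNorm_mollify_sub hk hd hr hwL
  have l2 := tendsto_eLpNorm_mollify_sub hk hd hr hGL
  have hmp := measurePreserving_sub_right (volume : Measure (Sp N)) h
  -- The increment of `w'` costs two mollification errors (one of them shifted) plus the increment
  -- of the mollification. The margin `2 * δ` leaves room for a shift and a kernel, each of size at
  -- most `δ`.
  have hb : ∀ n, eLpNorm (fun x => w' (x - h) - w' x) (ENNReal.ofReal r) (volume.restrict K)
      ≤ eLpNorm (fun x => mollify volume (k n) w' x - w' x) (ENNReal.ofReal r) volume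
        + eLpNorm (fun x => mollify volume (k n) w' x - w' x) (ENNReal.ofReal r) volume
        + ‖h‖ₑ * (eLpNorm (fun x => mollify volume (k n) G' x - G' x) (ENNReal.ofReal r) volume
          + eLpNorm G' (ENNReal.ofReal r) volume) := by
    intro n
    set φ := mollify volume (k n) w'
    set g := mollify volume (k n) G'
    have m0 : AEStronglyMeasurable (fun x => φ x - w' x) volume :=
      (hφ n).continuous.aestronglyMeasurable.sub hwL.1
    have m1 : AEStronglyMeasurable (fun x => φ (x - h) - w' (x - h)) volume :=
      m0.comp_measurePreserving hmp
    have m2 : AEStronglyMeasurable (fun x => φ (x - h) - φ x) volume :=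
      (((hφ n).continuous.comp (by fun_prop : Continuous fun x : Sp N => x - h)).sub
        (hφ n).continuous).aestronglyMeasurable
    have e : (fun x => w' (x - h) - w' x)
        = ((fun x => φ x - w' x) - (fun x => φ (x - h) - w' (x - h)))
          + fun x => φ (x - h) - φ x := by
      funext x
      simp only [Pi.add_apply, Pi.sub_apply]
      ring
    have b1 : eLpNorm (fun x => φ (x - h) - w' (x - h)) (ENNReal.ofReal r) volume
        = eLpNorm (fun x => φ x - w' x) (ENNReal.ofReal r) volume :=
      eLpNorm_comp_measurePreserving (g := fun x => φ x - w' x) (f := fun x => x - h) m0 hmp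
    have hgφ : ∀ x ∈ K, ∀ s ∈ Ioc (0 : ℝ) 1, gradient φ (x - s • h) = g (x - s • h) := by
      intro x hx s hs
      refine gradient_mollify hw.2.2 hwi (hk n) (subset_trans (fun y hy => ?_) (hKΩ x hx))
      rw [Metric.mem_closedBall, dist_eq_norm] at hy ⊢
      have h1 : ‖s‖ ≤ 1 := by rw [Real.norm_of_nonneg hs.1.le]; exact hs.2
      have h2 : ‖s • h‖ ≤ 1 * δ := by
        rw [norm_smul]
        exact mul_le_mul h1 hh (norm_nonneg _) zero_le_one
      calc ‖y - x‖ = ‖(y - (x - s • h)) - s • h‖ := by rw [sub_sub, sub_add_cancel]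
        _ ≤ ‖y - (x - s • h)‖ + ‖s • h‖ := norm_sub_le _ _
        _ ≤ δ + 1 * δ := add_le_add (hy.trans (hdδ n)) h2
        _ = 2 * δ := by ring
    have b2 : eLpNorm (fun x => φ (x - h) - φ x) (ENNReal.ofReal r) (volume.restrict K)
        ≤ ‖h‖ₑ * eLpNorm g (ENNReal.ofReal r) volume :=
      eLpNorm_translation_sub_le_of_contDiff hr ((hφ n).of_le (by simp))
        hK hgφ
    have b3 : eLpNorm g (ENNReal.ofReal r) volume
        ≤ eLpNorm (fun x => g x - G' x) (ENNReal.ofReal r) volume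
          + eLpNorm G' (ENNReal.ofReal r) volume := by
      have := eLpNorm_add_le (((hg n).continuous.aestronglyMeasurable (μ := volume)).sub hGL.1)
        hGL.1 hr1
      rwa [sub_add_cancel] at this
    calc eLpNorm (fun x => w' (x - h) - w' x) (ENNReal.ofReal r) (volume.restrict K)
        ≤ eLpNorm ((fun x => φ x - w' x) - (fun x => φ (x - h) - w' (x - h))) (ENNReal.ofReal r)
            (volume.restrict K)
          + eLpNorm (fun x => φ (x - h) - φ x) (ENNReal.ofReal r) (volume.restrict K) := by
          rw [e]
          exact eLpNorm_add_le (m0.sub m1).restrict m2.restrict hr1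
      _ ≤ _ := by
          refine add_le_add ?_ (b2.trans (by gcongr))
          refine (eLpNorm_sub_le m0.restrict m1.restrict hr1).trans (add_le_add
            (eLpNorm_restrict_le _ _ _ _) ?_)
          exact (eLpNorm_restrict_le _ _ _ _).trans_eq b1
  have l3 := (l1.add l1).add (ENNReal.Tendsto.const_mul (l2.add_const
    (eLpNorm G' (ENNReal.ofReal r) volume)) (Or.inr (enorm_ne_top (x := h))))
  simp only [add_zero, zero_add] at l3
  exact ge_of_tendsto' l3 hb

end Translation

instance isAddHaarMeasure_volume_prod (N : ℕ) : (volume : Measure (ℝ × Sp N)).IsAddHaarMeasure :=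
  Measure.prod.instIsAddHaarMeasure volume volume

/-! ### Averages over short time shifts -/

section Steklov

variable {N : ℕ}

/-- For each value of the shift the map is a translation in time. It provides joint measurability
and integrability of the shifted integrands, as Fubini's theorem requires. -/
theorem measurePreserving_time_shear (h : ℝ) :
    MeasurePreserving (fun q : ℝ × (ℝ × Sp N) => (q.1, (q.2.1 - q.1, q.2.2)))
      ((volume.restrict (Ioc 0 h)).prod volume) ((volume.restrict (Ioc 0 h)).prod volume) := by
  refine (MeasurePreserving.id _).skew_product (g := fun (s : ℝ) (z : ℝ × Sp N) => (z.1 - s, z.2))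
    (by fun_prop) (ae_of_all _ fun s => ?_)
  have := (measurePreserving_sub_right (volume : Measure ℝ) s).prod
    (MeasurePreserving.id (volume : Measure (Sp N)))
  exact this.map_eq

theorem sub_time_eq (z : ℝ × Sp N) (s : ℝ) : z - (s, 0) = (z.1 - s, z.2) := by
  ext <;> simp

/-- If the averages over short backward time shifts of a pairing are nonnegative, then so is the
pairing itself. -/
theorem integral_pairing_nonneg_of_average {r s : ℝ} (hrs : r.HolderConjugate s)
    {f W : ℝ × Sp N → ℝ} {A D : ℝ × Sp N → Sp N} (hf : Integrable f)
    (hA : MemLp A (ENNReal.ofReal s)) (hW : AEStronglyMeasurable W) {C : ℝ}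
    (hWC : ∀ z, ‖W z‖ ≤ C) (hD : MemLp D (ENNReal.ofReal r)) {h₀ : ℝ} (hh₀ : 0 < h₀)
    (hav : ∀ h, 0 < h → h < h₀ → ∀ᵐ t : ℝ, 0 ≤ ∫ q in Ioc 0 h ×ˢ (univ : Set (Sp N)),
      (f (t - q.1, q.2) * W (t, q.2) - inner ℝ (A (t - q.1, q.2)) (D (t, q.2)))) :
    0 ≤ ∫ z, (f z * W z - inner ℝ (A z) (D z)) := by
  -- Only `f` and `A` are shifted, so continuity at $\sigma=0$ follows from continuity of
  -- translations in $L^1$ and $L^s$. The claim is $\Phi(0)\ge 0$.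
  set Φ : ℝ → ℝ := fun σ => ∫ z, (f (z - (σ, 0)) * W z - inner ℝ (A (z - (σ, 0))) (D z)) with hΦ
  have hmp : ∀ σ : ℝ, MeasurePreserving (fun z : ℝ × Sp N => z - (σ, 0)) volume volume :=
    fun σ => measurePreserving_sub_right volume _
  have hfσ : ∀ σ : ℝ, Integrable (fun z => f (z - (σ, 0))) := fun σ =>
    (hmp σ).integrable_comp_of_integrable hf
  have hAσ : ∀ σ : ℝ, MemLp (fun z => A (z - (σ, 0))) (ENNReal.ofReal s) := fun σ =>
    hA.comp_measurePreserving (hmp σ)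
  have i1 : ∀ {g : ℝ × Sp N → ℝ}, Integrable g → Integrable fun z => g z * W z := fun hg =>
    hg.mul_bdd (c := C) hW (ae_of_all _ hWC)
  have i2 : ∀ {g : ℝ × Sp N → Sp N}, MemLp g (ENNReal.ofReal s) →
      Integrable fun z => inner ℝ (g z) (D z) := fun hg =>
    integrable_of_norm_le_mul hrs.symm hg hD (hg.1.inner hD.1)
      (ae_of_all _ fun z => norm_inner_le_norm _ _)
  have hcont : Tendsto Φ (𝓝 0) (𝓝 (Φ 0)) := by
    have hshift : Tendsto (fun σ : ℝ => ((σ, 0) : ℝ × Sp N)) (𝓝 0) (𝓝 0) := by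
      have : Continuous fun σ : ℝ => ((σ, 0) : ℝ × Sp N) := by fun_prop
      exact this.tendsto' 0 0 rfl
    have l1 := (tendsto_eLpNorm_translation_sub le_rfl ENNReal.one_ne_top
      (memLp_one_iff_integrable.2 hf)).comp hshift
    have l2 := (tendsto_eLpNorm_translation_sub (ofReal_one_le hrs.symm.lt.le)
      ENNReal.ofReal_ne_top hA).comp hshift
    have l3 := (ENNReal.Tendsto.const_mul (a := ENNReal.ofReal C) l1
      (Or.inr ENNReal.ofReal_ne_top)).add (ENNReal.Tendsto.mul_const l2 (Or.inr hD.2.ne))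
    simp only [mul_zero, zero_mul, add_zero] at l3
    refine tendsto_integral_of_L1 _ ((i1 (hfσ 0)).sub (i2 (hAσ 0))).1
      (Eventually.of_forall fun σ => (i1 (hfσ σ)).sub (i2 (hAσ σ))) ?_
    refine tendsto_of_tendsto_of_tendsto_of_le_of_le tendsto_const_nhds l3 (fun _ => zero_le)
      fun σ => ?_
    have m1 : AEMeasurable (fun z => ‖f (z - (σ, 0)) - f z‖ₑ) :=
      ((hfσ σ).1.sub hf.1).enorm
    have hle : ∀ z, ‖(f (z - (σ, 0)) * W z - inner ℝ (A (z - (σ, 0))) (D z))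
        - (f (z - (0, 0)) * W z - inner ℝ (A (z - (0, 0))) (D z))‖ₑ
        ≤ ENNReal.ofReal C * ‖f (z - (σ, 0)) - f z‖ₑ + ‖A (z - (σ, 0)) - A z‖ₑ * ‖D z‖ₑ := by
      intro z
      have e : (f (z - (σ, 0)) * W z - inner ℝ (A (z - (σ, 0))) (D z))
          - (f (z - (0, 0)) * W z - inner ℝ (A (z - (0, 0))) (D z))
          = W z * (f (z - (σ, 0)) - f z) - inner ℝ (A (z - (σ, 0)) - A z) (D z) := by
        have : z - ((0 : ℝ), (0 : Sp N)) = z := sub_zero z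
        rw [this, inner_sub_left]
        ring
      rw [e]
      refine enorm_sub_le.trans (add_le_add ?_ ?_)
      · rw [enorm_mul]
        gcongr
        rw [← ofReal_norm]
        exact ENNReal.ofReal_le_ofReal (hWC z)
      · rw [← enorm_norm (A _ - A z), ← enorm_norm (D z), ← enorm_mul]
        exact enorm_le_iff_norm_le.2 ((norm_inner_le_norm _ _).trans (le_abs_self _))
    refine (lintegral_mono hle).trans ?_
    rw [lintegral_add_left' (m1.const_mul _), lintegral_const_mul' _ _ ENNReal.ofReal_ne_top]
    simp only [Function.comp_apply, eLpNorm_one_eq_lintegral_enorm]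
    refine add_le_add le_rfl ?_
    exact lintegral_enorm_mul_le hrs.symm ((hAσ σ).sub hA).1 hD.1
  -- By Fubini's theorem, the integral of `Φ` over short shifts equals the integral over $t$ of the
  -- averages that `hav` declares nonnegative.
  have hint : ∀ h, 0 < h → h < h₀ → IntegrableOn Φ (Ioc 0 h) ∧ 0 ≤ ∫ σ in Ioc 0 h, Φ σ := by
    intro h hh hlt
    set ν := volume.restrict (Ioc (0 : ℝ) h)
    have hsh := measurePreserving_time_shear (N := N) h
    have hfin : IsFiniteMeasure ν := ⟨by simp [ν]⟩
    have j1 : Integrable (fun q : ℝ × (ℝ × Sp N) => f (q.2.1 - q.1, q.2.2) * W q.2)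
        (ν.prod volume) :=
      (hsh.integrable_comp_of_integrable (hf.comp_snd ν)).mul_bdd (c := C)
        hW.comp_snd (ae_of_all _ fun q => hWC _)
    have j2 : Integrable (fun q : ℝ × (ℝ × Sp N) => inner ℝ (A (q.2.1 - q.1, q.2.2)) (D q.2))
        (ν.prod volume) := by
      have a1 : MemLp (fun q : ℝ × (ℝ × Sp N) => A (q.2.1 - q.1, q.2.2)) (ENNReal.ofReal s)
          (ν.prod volume) := (hA.comp_snd ν).comp_measurePreserving hsh
      have a2 : MemLp (fun q : ℝ × (ℝ × Sp N) => D q.2) (ENNReal.ofReal r) (ν.prod volume) :=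
        hD.comp_snd ν
      exact integrable_of_norm_le_mul hrs.symm a1 a2 (a1.1.inner a2.1)
        (ae_of_all _ fun z => norm_inner_le_norm _ _)
    have j := j1.sub j2
    have e1 : ∫ σ in Ioc 0 h, Φ σ = ∫ q : ℝ × (ℝ × Sp N),
        (f (q.2.1 - q.1, q.2.2) * W q.2 - inner ℝ (A (q.2.1 - q.1, q.2.2)) (D q.2))
          ∂(ν.prod volume) := by
      have := integral_prod _ j
      simp only [Pi.sub_apply] at this
      rw [this]
      simp only [hΦ, sub_time_eq]
      rfl
    have hsw : MeasurePreserving (fun q : ℝ × (ℝ × Sp N) => (q.2.1, (q.1, q.2.2)))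
        ((volume : Measure ℝ).prod (ν.prod (volume : Measure (Sp N))))
        (ν.prod ((volume : Measure ℝ).prod (volume : Measure (Sp N)))) := by
      have p1 := measurePreserving_prodAssoc ν (volume : Measure ℝ) (volume : Measure (Sp N))
      have p2 := (measurePreserving_prodAssoc (volume : Measure ℝ) ν
        (volume : Measure (Sp N))).symm
      have p3 := (Measure.measurePreserving_swap (μ := (volume : Measure ℝ)) (ν := ν)).prod
        (MeasurePreserving.id (volume : Measure (Sp N)))
      exact p1.comp (p3.comp p2)
    have hemb : MeasurableEmbedding (fun q : ℝ × (ℝ × Sp N) => (q.2.1, (q.1, q.2.2))) := by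
      have : MeasurableEmbedding (fun q : ℝ × (ℝ × Sp N) => (q.2.1, (q.1, q.2.2))) :=
        (MeasurableEquiv.mk ⟨fun q : ℝ × (ℝ × Sp N) => (q.2.1, (q.1, q.2.2)),
          fun q : ℝ × (ℝ × Sp N) => (q.2.1, (q.1, q.2.2)), fun _ => rfl, fun _ => rfl⟩
          (by simp only [Equiv.coe_fn_mk]; fun_prop)
          (by simp only [Equiv.coe_fn_symm_mk]; fun_prop)).measurableEmbedding
      exact this
    have e2 := hsw.integral_comp hemb (fun q : ℝ × (ℝ × Sp N) =>
        (f (q.2.1 - q.1, q.2.2) * W q.2 - inner ℝ (A (q.2.1 - q.1, q.2.2)) (D q.2)))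
    have j' := hsw.integrable_comp_of_integrable j
    have j'' : IntegrableOn Φ (Ioc 0 h) := by
      have := j.integral_prod_left
      simp only [hΦ, sub_time_eq]
      exact this
    refine ⟨j'', ?_⟩
    rw [e1]
    refine le_of_le_of_eq ?_ e2
    have e3 := integral_prod _ j'
    refine le_of_le_of_eq ?_ e3.symm
    refine integral_nonneg_of_ae ?_
    filter_upwards [hav h hh hlt] with t ht
    have hν : ν.prod (volume : Measure (Sp N))
        = volume.restrict (Ioc 0 h ×ˢ (univ : Set (Sp N))) := by
      rw [Measure.volume_eq_prod, ← Measure.prod_restrict, Measure.restrict_univ]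
    rw [hν]
    exact ht
  have h0 : 0 ≤ Φ 0 := by
    by_contra hneg
    push Not at hneg
    -- If $\Phi(0)<0$, then $\Phi\le\Phi(0)/2<0$ for all small shifts, and its integral over them
    -- would be negative.
    obtain ⟨η, hη, hlt⟩ := Metric.eventually_nhds_iff.1
      (hcont.eventually (gt_mem_nhds (show Φ 0 < Φ 0 / 2 by linarith)))
    set h := min (η / 2) (h₀ / 2)
    have hh : 0 < h := by positivity
    obtain ⟨hi, h1⟩ := hint h hh ((min_le_right _ _).trans_lt (by linarith))
    have h2 : ∀ σ ∈ Ioc 0 h, Φ σ ≤ Φ 0 / 2 := fun σ hσ => (hlt (by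
      rw [Real.dist_eq, sub_zero, abs_of_pos hσ.1]
      exact hσ.2.trans_lt ((min_le_left _ _).trans_lt (by linarith)))).le
    have h3 := setIntegral_mono_on hi (integrableOn_const (C := Φ 0 / 2) (by simp))
      measurableSet_Ioc h2
    rw [setIntegral_const, smul_eq_mul, Real.volume_real_Ioc_of_le hh.le] at h3
    nlinarith
  have e0 : Φ 0 = ∫ z, (f z * W z - inner ℝ (A z) (D z)) := by
    simp only [hΦ]
    have : ∀ z : ℝ × Sp N, z - ((0 : ℝ), (0 : Sp N)) = z := fun z => sub_zero z
    simp only [this]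
  rwa [e0] at h0

end Steklov

/-! ### Smooth steps and primitives on an interval -/

section OneDimensional

/-- A smooth approximation of the Heaviside function jumping at `s`. -/
noncomputable def smoothStep (n : ℕ) (s τ : ℝ) : ℝ := Real.smoothTransition (((n : ℝ) + 1) * (τ - s))

theorem contDiff_smoothStep (n : ℕ) (s : ℝ) : ContDiff ℝ ∞ (smoothStep n s) :=
  Real.smoothTransition.contDiff.comp (contDiff_const.mul (contDiff_id.sub contDiff_const))

theorem smoothStep_of_le {n : ℕ} {s τ : ℝ} (h : τ ≤ s) : smoothStep n s τ = 0 :=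
  Real.smoothTransition.zero_of_nonpos (mul_nonpos_of_nonneg_of_nonpos (by positivity) (by linarith))

theorem smoothStep_of_ge {n : ℕ} {s τ : ℝ} (h : s + ((n : ℝ) + 1)⁻¹ ≤ τ) : smoothStep n s τ = 1 := by
  refine Real.smoothTransition.one_of_one_le ?_
  have h0 : (0 : ℝ) < n + 1 := by positivity
  have h1 : ((n : ℝ) + 1)⁻¹ ≤ τ - s := by linarith
  calc (1 : ℝ) = (n + 1) * ((n : ℝ) + 1)⁻¹ := by field_simp
    _ ≤ _ := by gcongr

theorem monotone_smoothStep (n : ℕ) (s : ℝ) : Monotone (smoothStep n s) := fun a b hab =>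
  Real.smoothTransition.monotone (by gcongr)

theorem norm_smoothStep_le (n : ℕ) (s τ : ℝ) : ‖smoothStep n s τ‖ ≤ 1 := by
  rw [smoothStep, Real.norm_of_nonneg (Real.smoothTransition.nonneg _)]
  exact Real.smoothTransition.le_one _

theorem tendsto_inv_nat_succ : Tendsto (fun n : ℕ => ((n : ℝ) + 1)⁻¹) atTop (𝓝 0) := by
  simpa using tendsto_one_div_add_atTop_nhds_zero_nat (𝕜 := ℝ)

theorem deriv_smoothStep_nonneg (n : ℕ) (s τ : ℝ) : 0 ≤ deriv (smoothStep n s) τ :=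
  (monotone_smoothStep n s).deriv_nonneg

theorem deriv_smoothStep_eq_zero_of_lt {n : ℕ} {s τ : ℝ} (h : τ < s) :
    deriv (smoothStep n s) τ = 0 := by
  have : smoothStep n s =ᶠ[𝓝 τ] fun _ => 0 := by
    filter_upwards [gt_mem_nhds h] with x hx using smoothStep_of_le hx.le
  rw [this.deriv_eq, deriv_const]

theorem deriv_smoothStep_eq_zero_of_gt {n : ℕ} {s τ : ℝ} (h : s + ((n : ℝ) + 1)⁻¹ < τ) :
    deriv (smoothStep n s) τ = 0 := by
  have : smoothStep n s =ᶠ[𝓝 τ] fun _ => 1 := by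
    filter_upwards [lt_mem_nhds h] with x hx using smoothStep_of_ge hx.le
  rw [this.deriv_eq, deriv_const]

/-- The steps rise to the right of `s` and vanish at `s` itself, so the limit is the indicator of
the open half-line. With `s = 0` and argument `v` this gives exactly $1_{v>0}$. -/
theorem tendsto_smoothStep (s τ : ℝ) :
    Tendsto (fun n => smoothStep n s τ) atTop (𝓝 ((Ioi s).indicator (fun _ => 1) τ)) := by
  by_cases h : s < τ
  · rw [indicator_of_mem (by exact h)]
    refine tendsto_const_nhds.congr' ?_
    filter_upwards [tendsto_inv_nat_succ.eventually (gt_mem_nhds (sub_pos.2 h))] with n hn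
    exact (smoothStep_of_ge (by linarith)).symm
  · rw [indicator_of_notMem (by exact h)]
    exact tendsto_const_nhds.congr fun n => (smoothStep_of_le (not_lt.1 h)).symm

/-- The derivatives are nonnegative, concentrate in $[s, s+1/(n+1)]$ and have mass one on $(0,T)$
for large $n$: an approximate identity at $s$. -/
theorem tendsto_integral_deriv_smoothStep {T s : ℝ} (hs : s ∈ Ioo 0 T) {m : ℝ → ℝ}
    (hm : ContinuousAt m s) (hmi : IntegrableOn m (Ioo 0 T)) :
    Tendsto (fun n => ∫ τ in Ioo 0 T, deriv (smoothStep n s) τ * m τ) atTop (𝓝 (m s)) := by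
  have hnhds : Ioo 0 T ∈ 𝓝 s := isOpen_Ioo.mem_nhds hs
  have hcd : ∀ n, Continuous (deriv (smoothStep n s)) := fun n =>
    (contDiff_smoothStep n s).continuous_deriv (by simp)
  have := tendsto_setIntegral_peak_smul_of_integrableOn_of_tendsto (μ := volume) (l := atTop)
    (φ := fun n => deriv (smoothStep n s)) (g := m) (a := m s) (x₀ := s)
    measurableSet_Ioo measurableSet_Ioo
    subset_rfl (by exact self_mem_nhdsWithin) (by simp) (Eventually.of_forall fun n x _ =>
      deriv_smoothStep_nonneg n s x) ?_ ?_
    (Eventually.of_forall fun n => (hcd n).aestronglyMeasurable) hmi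
    (hm.tendsto.mono_left nhdsWithin_le_nhds)
  · simpa only [smul_eq_mul] using this
  · intro u hu hsu
    obtain ⟨ε, hε, hεu⟩ := Metric.isOpen_iff.1 hu s hsu
    rw [Metric.tendstoUniformlyOn_iff]
    intro η hη
    filter_upwards [tendsto_inv_nat_succ.eventually (gt_mem_nhds hε)] with n hn x hx
    have hxε : x ∉ Metric.ball s ε := fun h => hx.2 (hεu h)
    rw [Metric.mem_ball, Real.dist_eq, not_lt] at hxε
    have : deriv (smoothStep n s) x = 0 := by
      rcases le_abs.1 hxε with h | h
      · exact deriv_smoothStep_eq_zero_of_gt (by linarith)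
      · exact deriv_smoothStep_eq_zero_of_lt (by linarith)
    simpa [this] using hη
  · refine tendsto_const_nhds.congr' ?_
    filter_upwards [tendsto_inv_nat_succ.eventually (gt_mem_nhds (sub_pos.2 hs.2))] with n hn
    rw [← integral_Ioc_eq_integral_Ioo, ← intervalIntegral.integral_of_le (hs.1.trans hs.2).le,
      intervalIntegral.integral_eq_sub_of_hasDerivAt
        (fun x _ => ((contDiff_smoothStep n s).differentiable (by simp) x).hasDerivAt)
        ((hcd n).intervalIntegrable _ _),
      smoothStep_of_ge (by linarith), smoothStep_of_le hs.1.le, sub_zero]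

/-- The difference of two smooth steps, as a test function. -/
noncomputable def smoothStepTest {T : ℝ} (n : ℕ) (s t : ℝ) (hs : s ≤ t)
    (ht : t + ((n : ℝ) + 1)⁻¹ < T) : 𝓓((⟨Iio T, isOpen_Iio⟩ : Opens ℝ), ℝ) :=
  have hsub : tsupport (fun τ => smoothStep n s τ - smoothStep n t τ)
      ⊆ Icc s (t + ((n : ℝ) + 1)⁻¹) := by
    refine closure_minimal (fun τ hτ => ?_) isClosed_Icc
    by_contra h
    refine hτ ?_
    rw [mem_Icc, not_and_or, not_le, not_le] at h
    rcases h with h | h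
    · simp [smoothStep_of_le h.le, smoothStep_of_le (h.le.trans hs)]
    · change smoothStep n s τ - smoothStep n t τ = 0
      rw [smoothStep_of_ge h.le, smoothStep_of_ge (by linarith), sub_self]
  { toFun := fun τ => smoothStep n s τ - smoothStep n t τ
    contDiff' := (contDiff_smoothStep n s).sub (contDiff_smoothStep n t)
    hasCompactSupport' := isCompact_Icc.of_isClosed_subset (isClosed_tsupport _) hsub
    tsupport_subset' := hsub.trans fun τ hτ => hτ.2.trans_lt ht }

/-- A continuous function with integrable weak derivative is a primitive of it. -/
theorem sub_eq_setIntegral_of_weak_deriv {T : ℝ} {m F : ℝ → ℝ} (hm : ContinuousOn m (Ioo 0 T))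
    (hmi : IntegrableOn m (Ioo 0 T)) (hF : IntegrableOn F (Ioo 0 T))
    (h : ∀ ψ : 𝓓((⟨Iio T, isOpen_Iio⟩ : Opens ℝ), ℝ), ψ 0 = 0 →
      - ∫ τ in Ioo 0 T, m τ * deriv ψ τ = ∫ τ in Ioo 0 T, F τ * ψ τ)
    {s t : ℝ} (hs : 0 < s) (hst : s ≤ t) (ht : t < T) :
    m t - m s = ∫ τ in Ioc s t, F τ := by
  have hsm : s ∈ Ioo 0 T := ⟨hs, hst.trans_lt ht⟩
  have htm : t ∈ Ioo 0 T := ⟨hs.trans_le hst, ht⟩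
  -- The test function is the step at `s` minus the step at `t`. It tends to the indicator of
  -- $(s,t]$, and minus its derivative is an approximate identity at `t` minus one at `s`.
  have l1 := (tendsto_integral_deriv_smoothStep htm (hm.continuousAt (isOpen_Ioo.mem_nhds htm))
    hmi).sub (tendsto_integral_deriv_smoothStep hsm (hm.continuousAt (isOpen_Ioo.mem_nhds hsm)) hmi)
  have l2 : Tendsto (fun n => ∫ τ in Ioo 0 T, F τ * (smoothStep n s τ - smoothStep n t τ)) atTop
      (𝓝 (∫ τ in Ioo 0 T, F τ * (Ioc s t).indicator (fun _ => 1) τ)) := by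
    refine tendsto_integral_of_dominated_convergence (fun τ => ‖F τ‖ * 2) (fun n => ?_)
      (hF.norm.mul_const _) (fun n => ae_of_all _ fun τ => ?_) (ae_of_all _ fun τ => ?_)
    · exact hF.1.mul ((contDiff_smoothStep n s).continuous.sub
        (contDiff_smoothStep n t).continuous).aestronglyMeasurable
    · rw [norm_mul]
      gcongr
      exact (norm_sub_le _ _).trans ((add_le_add (norm_smoothStep_le _ _ _)
        (norm_smoothStep_le _ _ _)).trans_eq (by norm_num))
    · have e : (Ioc s t).indicator (fun _ => (1 : ℝ)) τ
          = (Ioi s).indicator (fun _ => 1) τ - (Ioi t).indicator (fun _ => 1) τ := by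
        simp only [indicator, mem_Ioc, mem_Ioi]
        split_ifs <;> first | (exfalso; grind) | norm_num
      rw [e]
      exact ((tendsto_smoothStep s τ).sub (tendsto_smoothStep t τ)).const_mul _
  have e2 : ∫ τ in Ioo 0 T, F τ * (Ioc s t).indicator (fun _ => 1) τ = ∫ τ in Ioc s t, F τ := by
    have : (fun τ => F τ * (Ioc s t).indicator (fun _ => 1) τ) = (Ioc s t).indicator F := by
      funext τ
      simp [indicator]
    rw [this, setIntegral_indicator measurableSet_Ioc, inter_eq_right.2]
    exact fun τ hτ => ⟨hs.trans hτ.1, hτ.2.trans_lt ht⟩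
  rw [e2] at l2
  refine tendsto_nhds_unique l1 (l2.congr' ?_)
  filter_upwards [tendsto_inv_nat_succ.eventually (gt_mem_nhds (sub_pos.2 ht))] with n hn
  have h1 := h (smoothStepTest n s t hst (by linarith))
    (by
      change smoothStep n s 0 - smoothStep n t 0 = 0
      rw [smoothStep_of_le hs.le, smoothStep_of_le (hs.le.trans hst), sub_zero])
  change - ∫ τ in Ioo 0 T, m τ * deriv (fun τ => smoothStep n s τ - smoothStep n t τ) τ
    = ∫ τ in Ioo 0 T, F τ * (smoothStep n s τ - smoothStep n t τ) at h1
  rw [← h1]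
  have hi : ∀ s, IntegrableOn (fun τ => deriv (smoothStep n s) τ * m τ) (Ioo 0 T) := by
    intro s
    have hcd : Continuous (deriv (smoothStep n s)) :=
      (contDiff_smoothStep n s).continuous_deriv (by simp)
    obtain ⟨C, hC⟩ := isCompact_Icc.exists_bound_of_continuousOn (s := Icc 0 T) hcd.continuousOn
    refine hmi.bdd_mul (c := C) hcd.aestronglyMeasurable ?_
    filter_upwards [ae_restrict_mem measurableSet_Ioo] with τ hτ using hC τ ⟨hτ.1.le, hτ.2.le⟩
  rw [← integral_sub (hi t) (hi s), ← integral_neg]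
  refine integral_congr_ae (ae_of_all _ fun τ => ?_)
  have : deriv (fun τ => smoothStep n s τ - smoothStep n t τ) τ
      = deriv (smoothStep n s) τ - deriv (smoothStep n t) τ :=
    deriv_fun_sub ((contDiff_smoothStep n s).differentiable (by simp) τ)
      ((contDiff_smoothStep n t).differentiable (by simp) τ)
  simp only [this]
  ring

end OneDimensional

/-! ### Bounds on weak solutions and the equation integrated in time -/

section WeakSolution

variable {N : ℕ} {p T : ℝ} {Ω : Opens (Sp N)} {ΓD : Set (Sp N)} {V : Sp N → Sp N}
  {f : ℝ → Sp N → ℝ} {u₀ : Sp N → ℝ} {u v : ℝ → Sp N → ℝ} {Dv : ℝ → Sp N → Sp N}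

theorem restrict_cylinder (T : ℝ) (Ω : Opens (Sp N)) :
    (volume.restrict (cylinder T Ω : Set (ℝ × Sp N)))
      = (volume.restrict (Ioo 0 T)).prod (volume.restrict (Ω : Set (Sp N))) := by
  rw [Measure.prod_restrict]
  rfl

theorem isFiniteMeasure_restrict (hΩ : Bornology.IsBounded (Ω : Set (Sp N))) :
    IsFiniteMeasure (volume.restrict (Ω : Set (Sp N))) :=
  ⟨by simpa using hΩ.measure_lt_top⟩

theorem IsWeakSolution.ae_mem_Icc (h : IsWeakSolution p T Ω ΓD V f u₀ u v Dv) :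
    ∀ᵐ z ∂(volume.restrict (cylinder T Ω : Set (ℝ × Sp N))), u z.1 z.2 ∈ Icc (0 : ℝ) 1 := by
  filter_upwards [h.u_mem_sign] with z hz
  unfold signPlus at hz
  split_ifs at hz with h1 h2
  · rw [hz]; simp
  · exact hz
  · rw [hz]; simp

theorem IsWeakSolution.ae_eq_one (h : IsWeakSolution p T Ω ΓD V f u₀ u v Dv) :
    ∀ᵐ z ∂(volume.restrict (cylinder T Ω : Set (ℝ × Sp N))), 0 < v z.1 z.2 → u z.1 z.2 = 1 := by
  filter_upwards [h.u_mem_sign] with z hz hv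
  rw [signPlus, if_pos hv] at hz
  exact hz

theorem norm_pflux (hp : 2 < p) (ζ : Sp N) : ‖pflux p ζ‖ = ‖ζ‖ ^ (p - 1) := by
  rw [pflux, norm_smul, Real.norm_of_nonneg (by positivity)]
  by_cases h : ‖ζ‖ = 0
  · rw [h, mul_zero, Real.zero_rpow (by linarith)]
  · nth_rewrite 2 [← Real.rpow_one ‖ζ‖]
    rw [← Real.rpow_add (by positivity)]
    congr 1
    ring

theorem continuous_pflux (hp : 2 < p) : Continuous (pflux p : Sp N → Sp N) :=
  (continuous_norm.rpow_const fun _ => Or.inr (by linarith)).smul continuous_id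

theorem holderConjugate_div (hp : 2 < p) : p.HolderConjugate (p / (p - 1)) :=
  Real.HolderConjugate.conjExponent (by linarith)

/-- The norm of the flux is $|\nabla v|^{p-1}$, and $(p-1)p' = p$. -/
theorem IsWeakSolution.memLp_pflux (hp : 2 < p) (h : IsWeakSolution p T Ω ΓD V f u₀ u v Dv) :
    MemLp (fun z : ℝ × Sp N => pflux p (Dv z.1 z.2)) (ENNReal.ofReal (p / (p - 1)))
      (volume.restrict (cylinder T Ω : Set (ℝ × Sp N))) := by
  have h1 := h.Dv_memLp.norm_rpow_div (ENNReal.ofReal (p - 1))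
  rw [ENNReal.toReal_ofReal (by linarith), ← ENNReal.ofReal_div_of_pos (by linarith)] at h1
  refine h1.of_le ((continuous_pflux hp).comp_aestronglyMeasurable h.Dv_memLp.1)
    (ae_of_all _ fun z => ?_)
  rw [norm_pflux hp, Real.norm_of_nonneg (by positivity)]

theorem MemW1Vec.memLp {q : ℝ≥0∞} (hV : MemW1Vec q Ω V) : MemLp V q (volume.restrict Ω) := by
  refine MemLp.of_eval_piLp fun i => ?_
  obtain ⟨G, hG⟩ := hV i
  exact hG.1

theorem memLp_snd {F : Type*} [NormedAddCommGroup F] {q : ℝ≥0∞} {g : Sp N → F}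
    (hg : MemLp g q (volume.restrict Ω)) :
    MemLp (fun z : ℝ × Sp N => g z.2) q (volume.restrict (cylinder T Ω : Set (ℝ × Sp N))) := by
  rw [restrict_cylinder]
  exact hg.comp_snd _

theorem IsWeakSolution.memLp_smul (h : IsWeakSolution p T Ω ΓD V f u₀ u v Dv) {q : ℝ≥0∞}
    {B : ℝ × Sp N → Sp N} (hB : MemLp B q (volume.restrict (cylinder T Ω : Set (ℝ × Sp N)))) :
    MemLp (fun z : ℝ × Sp N => u z.1 z.2 • B z) q
      (volume.restrict (cylinder T Ω : Set (ℝ × Sp N))) := by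
  refine hB.of_le (h.u_bdd.1.smul hB.1) ?_
  filter_upwards [h.ae_mem_Icc] with z hz
  rw [norm_smul, Real.norm_of_nonneg hz.1]
  exact mul_le_of_le_one_left (norm_nonneg _) hz.2

/-- The total flux `|∇v|^{p-2}∇v - uV` belongs to `L^{p'}(Q)`. -/
theorem IsWeakSolution.memLp_flux (hp : 2 < p)
    (h : IsWeakSolution p T Ω ΓD V f u₀ u v Dv)
    (hV : MemW1Vec (ENNReal.ofReal (p / (p - 1))) Ω V) :
    MemLp (fun z : ℝ × Sp N => pflux p (Dv z.1 z.2) - u z.1 z.2 • V z.2)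
      (ENNReal.ofReal (p / (p - 1))) (volume.restrict (cylinder T Ω : Set (ℝ × Sp N))) :=
  (h.memLp_pflux hp).sub (h.memLp_smul (memLp_snd hV.memLp))

theorem integral_cylinder {F : Type*} [NormedAddCommGroup F] [NormedSpace ℝ F]
    {g : ℝ × Sp N → F} (hg : IntegrableOn g (cylinder T Ω : Set (ℝ × Sp N))) :
    ∫ z in (cylinder T Ω : Set (ℝ × Sp N)), g z
      = ∫ t in Ioo 0 T, ∫ x in (Ω : Set (Sp N)), g (t, x) := by
  have hg' := hg
  rw [IntegrableOn, restrict_cylinder] at hg'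
  rw [restrict_cylinder, integral_prod _ hg']

/-- For a fixed $w$, the weak formulation identifies the weak derivative of $t\mapsto\int u(t)w$,
and continuity of $u$ into $L^1$ turns this into an identity for every pair of times. Boundedness of
$w$ makes the source term integrable although $f$ is only in $L^1$. -/
theorem IsWeakSolution.integral_sub_eq (hp : 2 < p)
    (hΩ : Bornology.IsBounded (Ω : Set (Sp N)))
    (h : IsWeakSolution p T Ω ΓD V f u₀ u v Dv)
    (hV : MemW1Vec (ENNReal.ofReal (p / (p - 1))) Ω V)
    (hf : IntegrableOn (fun z : ℝ × Sp N => f z.1 z.2) (cylinder T Ω : Set (ℝ × Sp N)))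
    {w : Sp N → ℝ} {Dw : Sp N → Sp N} (hw : MemW1D (ENNReal.ofReal p) Ω ΓD w Dw) {C : ℝ}
    (hC : ∀ x, ‖w x‖ ≤ C) {s t : ℝ} (hs : 0 < s) (hst : s ≤ t) (ht : t < T) :
    (∫ x in (Ω : Set (Sp N)), u t x * w x) - ∫ x in (Ω : Set (Sp N)), u s x * w x
      = ∫ q in Ioc s t ×ˢ (Ω : Set (Sp N)),
        (f q.1 q.2 * w q.2 - inner ℝ (pflux p (Dv q.1 q.2) - u q.1 q.2 • V q.2) (Dw q.2)) := by
  have hfin := isFiniteMeasure_restrict hΩ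
  have hpq := holderConjugate_div hp
  have hC0 : 0 ≤ C := (norm_nonneg _).trans (hC 0)
  have hwm : AEStronglyMeasurable (fun z : ℝ × Sp N => w z.2)
      (volume.restrict (cylinder T Ω : Set (ℝ × Sp N))) := (memLp_snd hw.1.1).1
  have hfw : IntegrableOn (fun z : ℝ × Sp N => f z.1 z.2 * w z.2)
      (cylinder T Ω : Set (ℝ × Sp N)) := hf.mul_bdd (c := C) hwm (ae_of_all _ fun z => hC _)
  have hui : IntegrableOn (fun z : ℝ × Sp N => u z.1 z.2) (cylinder T Ω : Set (ℝ × Sp N)) := by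
    have : IsFiniteMeasure (volume.restrict (cylinder T Ω : Set (ℝ × Sp N))) := by
      rw [restrict_cylinder]; infer_instance
    exact h.u_bdd.integrable le_top
  have huw : IntegrableOn (fun z : ℝ × Sp N => u z.1 z.2 * w z.2)
      (cylinder T Ω : Set (ℝ × Sp N)) := hui.mul_bdd (c := C) hwm (ae_of_all _ fun z => hC _)
  have hA := h.memLp_flux hp hV
  have hDw := memLp_snd (T := T) hw.1.2.1
  have hAD : IntegrableOn (fun z : ℝ × Sp N =>
      inner ℝ (pflux p (Dv z.1 z.2) - u z.1 z.2 • V z.2) (Dw z.2))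
      (cylinder T Ω : Set (ℝ × Sp N)) :=
    integrable_of_norm_le_mul hpq.symm hA hDw (hA.1.inner hDw.1)
      (ae_of_all _ fun z => norm_inner_le_norm _ _)
  have hI := hfw.sub hAD
  have ψbdd : ∀ g : ℝ → ℝ, Continuous g → HasCompactSupport g → ∀ {k : ℝ × Sp N → ℝ},
      IntegrableOn k (cylinder T Ω : Set (ℝ × Sp N)) →
      IntegrableOn (fun z => k z * g z.1) (cylinder T Ω : Set (ℝ × Sp N)) := by
    intro g hg hgc k hk
    obtain ⟨c, hc⟩ := hgc.exists_bound_of_continuous hg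
    exact hk.mul_bdd (c := c) (hg.comp continuous_fst).aestronglyMeasurable
      (ae_of_all _ fun z => hc _)
  have key := sub_eq_setIntegral_of_weak_deriv (T := T)
    (m := fun t => ∫ x in (Ω : Set (Sp N)), u t x * w x)
    (F := fun t => ∫ x in (Ω : Set (Sp N)), (f t x * w x
      - inner ℝ (pflux p (Dv t x) - u t x • V x) (Dw x))) ?_ ?_ ?_ ?_ hs hst ht
  · rw [key]
    have hsub : Ioc s t ×ˢ (Ω : Set (Sp N)) ⊆ (cylinder T Ω : Set (ℝ × Sp N)) :=
      prod_mono (fun τ hτ => ⟨hs.trans hτ.1, hτ.2.trans_lt ht⟩) subset_rfl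
    have := setIntegral_prod (μ := (volume : Measure ℝ)) (ν := (volume : Measure (Sp N))) _
      (hI.mono_set hsub)
    exact this.symm
  · intro t₀ ht₀
    have hsl := h.u_slice
    have hcont := (h.u_cont t₀ ⟨ht₀.1.le, ht₀.2⟩).mono_left
      (nhdsWithin_mono t₀ (Ioo_subset_Ico_self : Ioo 0 T ⊆ Ico 0 T))
    have hwΩ : AEStronglyMeasurable w (volume.restrict (Ω : Set (Sp N))) := hw.1.1.1
    have i0 : ∀ t ∈ Ico 0 T, Integrable (fun x => u t x * w x)
        (volume.restrict (Ω : Set (Sp N))) := fun t ht =>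
      (memLp_one_iff_integrable.1 (hsl t ht)).mul_bdd (c := C) hwΩ (ae_of_all _ hC)
    refine tendsto_integral_of_L1 _ (i0 t₀ ⟨ht₀.1.le, ht₀.2⟩).1 ?_ ?_
    · filter_upwards [self_mem_nhdsWithin] with t ht using i0 t ⟨ht.1.le, ht.2⟩
    · have l := ENNReal.Tendsto.const_mul (a := ENNReal.ofReal C) hcont
        (Or.inr ENNReal.ofReal_ne_top)
      rw [mul_zero] at l
      refine tendsto_of_tendsto_of_tendsto_of_le_of_le tendsto_const_nhds l (fun _ => zero_le)
        fun t => ?_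
      simp only [eLpNorm_one_eq_lintegral_enorm]
      rw [← lintegral_const_mul' _ _ ENNReal.ofReal_ne_top]
      refine lintegral_mono fun x => ?_
      rw [← sub_mul, enorm_mul, mul_comm]
      gcongr
      rw [← ofReal_norm]
      exact ENNReal.ofReal_le_ofReal (hC x)
  · have := huw
    rw [IntegrableOn, restrict_cylinder] at this
    exact this.integral_prod_left
  · have := hI
    rw [IntegrableOn, restrict_cylinder] at this
    exact this.integral_prod_left
  · intro ψ hψ
    have hψ' : Continuous (deriv ψ) := ψ.contDiff.continuous_deriv (by simp)
    have hwf := h.weak_form w Dw hw ψ (ψbdd ψ ψ.continuous ψ.hasCompactSupport hfw)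
    have j1 := ψbdd (deriv ψ) hψ' ψ.hasCompactSupport.deriv huw
    have j2 := ψbdd ψ ψ.continuous ψ.hasCompactSupport hfw
    have j3 := ψbdd ψ ψ.continuous ψ.hasCompactSupport hAD
    have j4 := ψbdd ψ ψ.continuous ψ.hasCompactSupport hI
    simp only [hψ, mul_zero, integral_zero, add_zero] at hwf
    have e1 := integral_cylinder j1
    have e4 := integral_cylinder j4
    have e5 : ∫ z in (cylinder T Ω : Set (ℝ × Sp N)), (f z.1 z.2 * w z.2
        - inner ℝ (pflux p (Dv z.1 z.2) - u z.1 z.2 • V z.2) (Dw z.2)) * ψ z.1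
        = (∫ z in (cylinder T Ω : Set (ℝ × Sp N)), f z.1 z.2 * w z.2 * ψ z.1)
          - ∫ z in (cylinder T Ω : Set (ℝ × Sp N)),
            inner ℝ (pflux p (Dv z.1 z.2) - u z.1 z.2 • V z.2) (Dw z.2) * ψ z.1 := by
      rw [← integral_sub j2 j3]
      simp only [sub_mul]
    simp only [integral_mul_const, Pi.sub_apply] at e1 e4
    rw [← e1, ← e4, e5]
    linarith

end WeakSolution

/-! ### Testing the equation with a function of v -/

section Kato

variable {N : ℕ} {p T : ℝ} {Ω : Opens (Sp N)} {ΓD : Set (Sp N)} {V : Sp N → Sp N}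
  {f : ℝ → Sp N → ℝ} {u₀ : Sp N → ℝ} {u v : ℝ → Sp N → ℝ} {Dv : ℝ → Sp N → Sp N}

theorem isFiniteMeasure_restrict_cylinder (hΩ : Bornology.IsBounded (Ω : Set (Sp N))) :
    IsFiniteMeasure (volume.restrict (cylinder T Ω : Set (ℝ × Sp N))) := by
  have := isFiniteMeasure_restrict hΩ
  rw [restrict_cylinder]
  infer_instance

theorem ae_slice {P : ℝ × Sp N → Prop}
    (h : ∀ᵐ z ∂(volume.restrict (cylinder T Ω : Set (ℝ × Sp N))), P z) :
    ∀ᵐ t : ℝ, t ∈ Ioo 0 T → ∀ᵐ x ∂(volume.restrict (Ω : Set (Sp N))), P (t, x) := by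
  rw [restrict_cylinder] at h
  have := Measure.ae_ae_of_ae_prod h
  rwa [ae_restrict_iff' measurableSet_Ioo] at this

theorem setIntegral_time_reflect {g : ℝ × Sp N → ℝ} {S : Set (Sp N)}
    (t h : ℝ) :
    ∫ q in Ioc 0 h ×ˢ S, g (t - q.1, q.2) = ∫ q in Ioc (t - h) t ×ˢ S, g q := by
  have hmp : MeasurePreserving (fun q : ℝ × Sp N => (t - q.1, q.2)) volume volume :=
    (Measure.measurePreserving_sub_left (volume : Measure ℝ) t).prod
      (MeasurePreserving.id (volume : Measure (Sp N)))
  have hemb : MeasurableEmbedding (fun q : ℝ × Sp N => (t - q.1, q.2)) :=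
    (MeasurableEquiv.mk ⟨fun q : ℝ × Sp N => (t - q.1, q.2), fun q : ℝ × Sp N => (t - q.1, q.2),
      fun _ => by simp, fun _ => by simp⟩
      (by simp only [Equiv.coe_fn_mk]; fun_prop)
      (by simp only [Equiv.coe_fn_symm_mk]; fun_prop)).measurableEmbedding
  have h1 := hmp.setIntegral_preimage_emb hemb g (Ico (t - h) t ×ˢ S)
  have h2 : (fun q : ℝ × Sp N => (t - q.1, q.2)) ⁻¹' (Ico (t - h) t ×ˢ S) = Ioc 0 h ×ˢ S := by
    ext q
    simp only [mem_preimage, mem_prod, mem_Ico, mem_Ioc]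
    constructor <;> rintro ⟨⟨a, b⟩, c⟩ <;> exact ⟨⟨by linarith, by linarith⟩, c⟩
  rw [h2] at h1
  rw [h1]
  -- Reflecting time exchanges the closed and open ends of the interval; the two versions differ by
  -- a null time slice.
  have h3 : (volume : Measure (ℝ × Sp N)).restrict (Ico (t - h) t ×ˢ S)
      = volume.restrict (Ioc (t - h) t ×ˢ S) := by
    rw [Measure.volume_eq_prod, ← Measure.prod_restrict, ← Measure.prod_restrict,
      restrict_Ico_eq_restrict_Ioc]
  rw [h3]

/-- On almost every time slice this is the weak gradient of $H(v)\xi$. The first term is bounded on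
a set of finite measure, the second is at most a multiple of $|\nabla v|$. -/
theorem IsWeakSolution.memLp_comp_mul (hΩ : Bornology.IsBounded (Ω : Set (Sp N)))
    (h : IsWeakSolution p T Ω ΓD V f u₀ u v Dv) {H : ℝ → ℝ} (hH : ContDiff ℝ ∞ H) {M : ℝ}
    (hHM : ∀ s, |H s| ≤ M) (hHM' : ∀ s, |deriv H s| ≤ M) (ξ : 𝓓(Ω, ℝ)) :
    MemLp (fun z : ℝ × Sp N =>
      H (v z.1 z.2) • gradient ξ z.2 + (deriv H (v z.1 z.2) * ξ z.2) • Dv z.1 z.2)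
      (ENNReal.ofReal p) (volume.restrict (cylinder T Ω : Set (ℝ × Sp N))) := by
  have hfinQ := isFiniteMeasure_restrict_cylinder (T := T) hΩ
  have hM : 0 ≤ M := (abs_nonneg _).trans (hHM 0)
  have hξ1 : ContDiff ℝ 1 ξ := ξ.contDiff.of_le (by simp)
  have hgξ := continuous_gradient hξ1
  obtain ⟨C, hC⟩ := ξ.hasCompactSupport.exists_bound_of_continuous ξ.continuous
  obtain ⟨C', hC'⟩ := (hasCompactSupport_gradient
    ξ.hasCompactSupport).exists_bound_of_continuous hgξ
  have hvm := h.v_memLp.1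
  have hHv := hH.continuous.comp_aestronglyMeasurable hvm
  have hHv' := (hH.continuous_deriv (by simp)).comp_aestronglyMeasurable hvm
  refine MemLp.add ?_ ?_
  · refine MemLp.of_bound (hHv.smul (hgξ.comp continuous_snd).aestronglyMeasurable) (M * C')
      (ae_of_all _ fun z => ?_)
    rw [norm_smul]
    exact mul_le_mul (hHM _) (hC' _) (norm_nonneg _) hM
  · refine h.Dv_memLp.of_le_mul (c := M * C)
      ((hHv'.mul (ξ.continuous.comp continuous_snd).aestronglyMeasurable).smul h.Dv_memLp.1)
      (ae_of_all _ fun z => ?_)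
    rw [norm_smul, norm_mul]
    exact mul_le_mul_of_nonneg_right (mul_le_mul (hHM' _) (hC _) (norm_nonneg _) hM)
      (norm_nonneg _)

/-- The equation tested with `H(v)ξψ`; the time derivative of `u` does not contribute, because `u`
is at its maximal value where `v` is positive. -/
theorem IsWeakSolution.integral_comp_mul_nonneg (hp : 2 < p)
    (hΩ : Bornology.IsBounded (Ω : Set (Sp N)))
    (h : IsWeakSolution p T Ω ΓD V f u₀ u v Dv)
    (hV : MemW1Vec (ENNReal.ofReal (p / (p - 1))) Ω V)
    (hf : IntegrableOn (fun z : ℝ × Sp N => f z.1 z.2) (cylinder T Ω : Set (ℝ × Sp N)))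
    {H : ℝ → ℝ} (hH : ContDiff ℝ ∞ H) {M : ℝ} (hHM : ∀ s, |H s| ≤ M)
    (hHM' : ∀ s, |deriv H s| ≤ M) (hH0 : ∀ s, 0 ≤ H s) (hH1 : ∀ s ≤ 0, H s = 0)
    (ξ : 𝓓(Ω, ℝ)) (hξ : ∀ x, 0 ≤ ξ x)
    (ψ : 𝓓((⟨Ioo 0 T, isOpen_Ioo⟩ : Opens ℝ), ℝ)) (hψ : ∀ t, 0 ≤ ψ t) :
    0 ≤ ∫ z in (cylinder T Ω : Set (ℝ × Sp N)),
      (f z.1 z.2 * (ψ z.1 * (H (v z.1 z.2) * ξ z.2))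
        - inner ℝ (pflux p (Dv z.1 z.2) - u z.1 z.2 • V z.2)
          (ψ z.1 • (H (v z.1 z.2) • gradient ξ z.2 + (deriv H (v z.1 z.2) * ξ z.2) • Dv z.1 z.2))) := by
  have hfin := isFiniteMeasure_restrict hΩ
  have hfinQ := isFiniteMeasure_restrict_cylinder (T := T) hΩ
  have hpq := holderConjugate_div hp
  have hM : 0 ≤ M := (abs_nonneg _).trans (hHM 0)
  have hmQ : MeasurableSet (cylinder T Ω : Set (ℝ × Sp N)) := (cylinder T Ω).isOpen.measurableSet
  have hξ1 : ContDiff ℝ 1 ξ := ξ.contDiff.of_le (by simp)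
  have hgξ := continuous_gradient hξ1
  obtain ⟨C, hC⟩ := ξ.hasCompactSupport.exists_bound_of_continuous ξ.continuous
  obtain ⟨C', hC'⟩ := (hasCompactSupport_gradient
    ξ.hasCompactSupport).exists_bound_of_continuous hgξ
  obtain ⟨B, hB⟩ := ψ.hasCompactSupport.exists_bound_of_continuous ψ.continuous
  have hC0 : 0 ≤ C := (norm_nonneg _).trans (hC 0)
  have hC0' : 0 ≤ C' := (norm_nonneg _).trans (hC' 0)
  have hB0 : 0 ≤ B := (norm_nonneg _).trans (hB 0)
  have hvm := h.v_memLp.1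
  have hψm : ∀ ν : Measure (ℝ × Sp N), AEStronglyMeasurable (fun z : ℝ × Sp N => ψ z.1) ν :=
    fun ν => (ψ.continuous.comp continuous_fst).aestronglyMeasurable
  have hξm : ∀ ν : Measure (ℝ × Sp N), AEStronglyMeasurable (fun z : ℝ × Sp N => ξ z.2) ν :=
    fun ν => (ξ.continuous.comp continuous_snd).aestronglyMeasurable
  have hgξm : ∀ ν : Measure (ℝ × Sp N),
      AEStronglyMeasurable (fun z : ℝ × Sp N => gradient ξ z.2) ν :=
    fun ν => (hgξ.comp continuous_snd).aestronglyMeasurable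
  have hHv := hH.continuous.comp_aestronglyMeasurable hvm
  have hHv' := (hH.continuous_deriv (by simp)).comp_aestronglyMeasurable hvm
  have hA := h.memLp_flux hp hV
  set w : ℝ × Sp N → ℝ := fun z => H (v z.1 z.2) * ξ z.2 with hw
  set Dw : ℝ × Sp N → Sp N := fun z =>
    H (v z.1 z.2) • gradient ξ z.2 + (deriv H (v z.1 z.2) * ξ z.2) • Dv z.1 z.2 with hDw
  set A : ℝ × Sp N → Sp N := fun z => pflux p (Dv z.1 z.2) - u z.1 z.2 • V z.2 with hAdef
  have hwC : ∀ z, ‖w z‖ ≤ M * C := fun z => by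
    rw [norm_mul]
    exact mul_le_mul (hHM _) (hC _) (norm_nonneg _) hM
  have hDwL : MemLp Dw (ENNReal.ofReal p)
      (volume.restrict (cylinder T Ω : Set (ℝ × Sp N))) := h.memLp_comp_mul hΩ hH hHM hHM' ξ
  have hψDwL : MemLp (fun z => ψ z.1 • Dw z) (ENNReal.ofReal p)
      (volume.restrict (cylinder T Ω : Set (ℝ × Sp N))) := by
    refine hDwL.of_le_mul (c := B) ((hψm _).smul hDwL.1) (ae_of_all _ fun z => ?_)
    rw [norm_smul]
    exact mul_le_mul_of_nonneg_right (hB _) (norm_nonneg _)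
  -- the support of `ψ` is at a positive distance from the initial time
  obtain ⟨a, ha, haψ⟩ : ∃ a > 0, ∀ t, ψ t ≠ 0 → a < t ∧ t < T := by
    have hK : IsCompact (tsupport ψ) := ψ.hasCompactSupport
    have hsub : tsupport ψ ⊆ Ioo 0 T := ψ.tsupport_subset
    by_cases hne : (tsupport ψ).Nonempty
    · obtain ⟨m, hm, hmin⟩ := hK.exists_isLeast hne
      refine ⟨m / 2, half_pos (hsub hm).1, fun t ht => ?_⟩
      have := subset_tsupport ψ ht
      exact ⟨(half_lt_self (hsub hm).1).trans_le (hmin this), (hsub this).2⟩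
    · refine ⟨1, one_pos, fun t ht => (hne ⟨t, subset_tsupport ψ ht⟩).elim⟩
  -- Everything is extended by zero outside the cylinder. With shifts shorter than `a`, the interval
  -- $(t-h,t]$ stays in $(0,T)$ whenever $\psi(t)\ne 0$.
  have main := integral_pairing_nonneg_of_average hpq
    (f := (cylinder T Ω : Set (ℝ × Sp N)).indicator fun z => f z.1 z.2)
    (W := (cylinder T Ω : Set (ℝ × Sp N)).indicator fun z => ψ z.1 * w z)
    (A := (cylinder T Ω : Set (ℝ × Sp N)).indicator A)
    (D := (cylinder T Ω : Set (ℝ × Sp N)).indicator fun z => ψ z.1 • Dw z)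
    ((integrable_indicator_iff hmQ).2 hf) ((memLp_indicator_iff_restrict hmQ).2 hA)
    ((aestronglyMeasurable_indicator_iff hmQ).2 ((hψm _).mul (hHv.mul (hξm _))))
    (C := B * (M * C)) (fun z => ?_) ((memLp_indicator_iff_restrict hmQ).2 hψDwL) ha ?_
  · rw [← integral_indicator hmQ]
    refine le_of_le_of_eq main (integral_congr_ae (ae_of_all _ fun z => ?_))
    by_cases hz : z ∈ (cylinder T Ω : Set (ℝ × Sp N))
    · simp only [indicator_of_mem hz]
      rfl
    · simp [indicator_of_notMem hz]
  · refine (norm_indicator_le_norm_self _ _).trans ?_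
    rw [norm_mul]
    exact mul_le_mul (hB _) (hwC _) (norm_nonneg _) hB0
  · intro η hη hηa
    have k1 : ∀ᵐ t : ℝ, t ∈ Ioo 0 T → MemW1D (ENNReal.ofReal p) Ω ΓD (v t) (Dv t) := by
      have := h.v_slice
      rwa [ae_restrict_iff' measurableSet_Ioo] at this
    have k2 := ae_slice h.ae_eq_one
    -- The bounds on `u` are needed at the earlier time `t - η`; null sets of times are stable under
    -- translation.
    have k3 := (measurePreserving_sub_right (volume : Measure ℝ) η).quasiMeasurePreserving.ae
      (ae_slice h.ae_mem_Icc)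
    filter_upwards [k1, k2, k3] with t h1 h2 h3
    by_cases hψt : ψ t = 0
    · have : ∀ q : ℝ × Sp N, (cylinder T Ω : Set (ℝ × Sp N)).indicator
          (fun z => ψ z.1 * w z) (t, q.2) = 0 := fun q => by simp [indicator, hψt]
      have h' : ∀ q : ℝ × Sp N, (cylinder T Ω : Set (ℝ × Sp N)).indicator
          (fun z => ψ z.1 • Dw z) (t, q.2) = 0 := fun q => by simp [indicator, hψt]
      simp [this, h']
    obtain ⟨hat, htT⟩ := haψ t hψt
    have ht : t ∈ Ioo 0 T := ⟨ha.trans hat, htT⟩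
    have ht' : t - η ∈ Ioo 0 T := ⟨by linarith, by linarith⟩
    specialize h1 ht
    specialize h2 ht
    specialize h3 ht'
    -- The test function is frozen at the final time `t` of the interval, so it is independent of
    -- time and no time regularity of `v` is needed.
    have hcl := h1.1.isCompactLimit_comp_mul (by linarith : 1 ≤ p) hH hHM hHM' ξ
    have hE := h.integral_sub_eq hp hΩ hV hf (hcl.memW1D (by linarith) ΓD) (C := M * C)
      (fun x => hwC (t, x)) (s := t - η) (t := t) ht'.1 (by linarith) htT
    have hmΩ : MeasurableSet (Ω : Set (Sp N)) := Ω.isOpen.measurableSet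
    have e1 : ∫ q in Ioc 0 η ×ˢ (univ : Set (Sp N)),
        ((cylinder T Ω : Set (ℝ × Sp N)).indicator (fun z => f z.1 z.2) (t - q.1, q.2)
          * (cylinder T Ω : Set (ℝ × Sp N)).indicator (fun z => ψ z.1 * w z) (t, q.2)
        - inner ℝ ((cylinder T Ω : Set (ℝ × Sp N)).indicator A (t - q.1, q.2))
          ((cylinder T Ω : Set (ℝ × Sp N)).indicator (fun z => ψ z.1 • Dw z) (t, q.2)))
        = ∫ q in Ioc 0 η ×ˢ (Ω : Set (Sp N)), ψ t * (f (t - q.1) q.2 * w (t, q.2)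
          - inner ℝ (A (t - q.1, q.2)) (Dw (t, q.2))) := by
      rw [← integral_indicator (measurableSet_Ioc.prod MeasurableSet.univ),
        ← integral_indicator (measurableSet_Ioc.prod hmΩ)]
      refine integral_congr_ae (ae_of_all _ fun q => ?_)
      by_cases hq : q.1 ∈ Ioc 0 η
      · have hq1 : t - q.1 ∈ Ioo 0 T := ⟨by linarith [hq.2], by linarith [hq.1]⟩
        by_cases hx : q.2 ∈ (Ω : Set (Sp N))
        · have c1 : (t - q.1, q.2) ∈ (cylinder T Ω : Set (ℝ × Sp N)) := ⟨hq1, hx⟩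
          have c2 : (t, q.2) ∈ (cylinder T Ω : Set (ℝ × Sp N)) := ⟨ht, hx⟩
          have c3 : q ∈ Ioc 0 η ×ˢ (univ : Set (Sp N)) := ⟨hq, mem_univ _⟩
          have c4 : q ∈ Ioc 0 η ×ˢ (Ω : Set (Sp N)) := ⟨hq, hx⟩
          simp only [indicator_of_mem c1, indicator_of_mem c2, indicator_of_mem c3,
            indicator_of_mem c4, inner_smul_right]
          ring
        · have c2 : (t, q.2) ∉ (cylinder T Ω : Set (ℝ × Sp N)) := fun h => hx h.2
          have c4 : q ∉ Ioc 0 η ×ˢ (Ω : Set (Sp N)) := fun h => hx h.2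
          simp [indicator_of_notMem c2, indicator_of_notMem c4]
      · have c3 : q ∉ Ioc 0 η ×ˢ (univ : Set (Sp N)) := fun h => hq h.1
        have c4 : q ∉ Ioc 0 η ×ˢ (Ω : Set (Sp N)) := fun h => hq h.1
        rw [indicator_of_notMem c3, indicator_of_notMem c4]
    rw [e1, integral_const_mul]
    refine mul_nonneg (hψ t) ?_
    have e2 := setIntegral_time_reflect (g := fun q : ℝ × Sp N => f q.1 q.2 * w (t, q.2)
      - inner ℝ (A q) (Dw (t, q.2))) (S := (Ω : Set (Sp N))) t η
    rw [e2]
    refine le_of_le_of_eq ?_ hE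
    have hwm : AEStronglyMeasurable (fun x => w (t, x)) (volume.restrict (Ω : Set (Sp N))) :=
      hcl.memLp.1
    have i0 : ∀ s ∈ Ioo 0 T, Integrable (fun x => u s x * w (t, x))
        (volume.restrict (Ω : Set (Sp N))) := fun s hs =>
      (memLp_one_iff_integrable.1 (h.u_slice s ⟨hs.1.le, hs.2⟩)).mul_bdd (c := M * C) hwm
        (ae_of_all _ fun x => hwC (t, x))
    rw [sub_nonneg]
    refine integral_mono_ae (i0 _ ht') (i0 _ ht) ?_
    filter_upwards [h2, h3] with x hx2 hx3
    -- Where $v(t)>0$, $u(t)=1$ dominates $u(t-\eta)\le 1$; elsewhere the test function vanishes.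
    by_cases hv : 0 < v t x
    · have : u t x = 1 := hx2 hv
      simp only [this]
      exact mul_le_mul_of_nonneg_right hx3.2 (mul_nonneg (hH0 _) (hξ _))
    · simp [hH1 _ (not_lt.1 hv)]

end Kato

/-! ### The Kato-type inequality for the p-Laplacian of v -/

section Kato

variable {N : ℕ} {p T : ℝ} {Ω : Opens (Sp N)} {ΓD : Set (Sp N)} {V : Sp N → Sp N} {divV : Sp N → ℝ}
  {f : ℝ → Sp N → ℝ} {u₀ : Sp N → ℝ} {u v : ℝ → Sp N → ℝ} {Dv : ℝ → Sp N → Sp N}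

/-- The stationary result holds on almost every time slice. The zero set of `v` is measurable in
space-time, so Tonelli's theorem applied to the norm of the truncated gradient transfers it to the
cylinder. -/
theorem IsWeakSolution.ae_gradient_eq_zero (hp : 2 < p)
    (hΩ : Bornology.IsBounded (Ω : Set (Sp N)))
    (h : IsWeakSolution p T Ω ΓD V f u₀ u v Dv) :
    ∀ᵐ z ∂(volume.restrict (cylinder T Ω : Set (ℝ × Sp N))), v z.1 z.2 = 0 → Dv z.1 z.2 = 0 := by
  have hfin := isFiniteMeasure_restrict hΩ
  have hs : NullMeasurableSet {z : ℝ × Sp N | v z.1 z.2 = 0}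
      (volume.restrict (cylinder T Ω : Set (ℝ × Sp N))) :=
    h.v_memLp.1.aemeasurable.nullMeasurable (measurableSet_singleton 0)
  set g : ℝ × Sp N → ℝ≥0∞ := fun z =>
    ‖{z : ℝ × Sp N | v z.1 z.2 = 0}.indicator (fun z => Dv z.1 z.2) z‖ₑ
  have hg : AEMeasurable g (volume.restrict (cylinder T Ω : Set (ℝ × Sp N))) :=
    (h.Dv_memLp.1.indicator₀ hs).enorm
  have h0 : ∫⁻ z, g z ∂(volume.restrict (cylinder T Ω : Set (ℝ × Sp N))) = 0 := by
    rw [restrict_cylinder] at hg ⊢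
    rw [lintegral_prod _ hg]
    refine (lintegral_congr_ae ?_).trans lintegral_zero
    filter_upwards [h.v_slice] with t ht
    refine (lintegral_congr_ae ?_).trans lintegral_zero
    filter_upwards [ht.1.ae_gradient_eq_zero (by linarith)] with x hx
    by_cases hv : v t x = 0
    · simp [g, indicator, hv, hx hv]
    · simp [g, indicator, hv]
  rw [lintegral_eq_zero_iff' hg] at h0
  filter_upwards [h0] with z hz hv
  simpa [g, indicator, hv] using hz

theorem integrableOn_mul_continuous {k : ℝ × Sp N → ℝ} {S : Set (ℝ × Sp N)}
    (hk : IntegrableOn k S) {ψ : ℝ → ℝ} (hψ : Continuous ψ) (hψc : HasCompactSupport ψ) :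
    IntegrableOn (fun z => k z * ψ z.1) S := by
  obtain ⟨c, hc⟩ := hψc.exists_bound_of_continuous hψ
  exact hk.mul_bdd (c := c) (hψ.comp continuous_fst).aestronglyMeasurable
    (ae_of_all _ fun z => hc _)

/-- The distributional inequality for `-Δ_p v`, tested with `H(v)`. -/
theorem IsWeakSolution.integral_comp_pflux_le (hp : 2 < p)
    (hΩ : Bornology.IsBounded (Ω : Set (Sp N)))
    (h : IsWeakSolution p T Ω ΓD V f u₀ u v Dv)
    (hV : MemW1Vec (ENNReal.ofReal (p / (p - 1))) Ω V)
    (hdivV : HasWeakDivergence Ω V divV)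
    (hdivV_bdd : MemLp divV ⊤ (volume.restrict (Ω : Set (Sp N))))
    (hf : IntegrableOn (fun z : ℝ × Sp N => f z.1 z.2) (cylinder T Ω : Set (ℝ × Sp N)))
    {H : ℝ → ℝ} (hH : ContDiff ℝ ∞ H) {M : ℝ} (hHM : ∀ s, |H s| ≤ M)
    (hHM' : ∀ s, |deriv H s| ≤ M) (hH0 : ∀ s, 0 ≤ H s) (hH1 : ∀ s ≤ 0, H s = 0)
    (hH' : ∀ s, 0 ≤ deriv H s)
    (ξ : 𝓓(Ω, ℝ)) (hξ : ∀ x, 0 ≤ ξ x)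
    (ψ : 𝓓((⟨Ioo 0 T, isOpen_Ioo⟩ : Opens ℝ), ℝ)) (hψ : ∀ t, 0 ≤ ψ t) :
    ∫ z in (cylinder T Ω : Set (ℝ × Sp N)),
        H (v z.1 z.2) * (inner ℝ (pflux p (Dv z.1 z.2)) (gradient ξ z.2) * ψ z.1)
      ≤ ∫ z in (cylinder T Ω : Set (ℝ × Sp N)),
        H (v z.1 z.2) * ((f z.1 z.2 - divV z.2) * ξ z.2 * ψ z.1) := by
  have hfin := isFiniteMeasure_restrict hΩ
  have hfinQ := isFiniteMeasure_restrict_cylinder (T := T) hΩ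
  have hpq := holderConjugate_div hp
  have hM : 0 ≤ M := (abs_nonneg _).trans (hHM 0)
  have hξ1 : ContDiff ℝ 1 ξ := ξ.contDiff.of_le (by simp)
  have hgξ := continuous_gradient hξ1
  obtain ⟨C, hC⟩ := ξ.hasCompactSupport.exists_bound_of_continuous ξ.continuous
  obtain ⟨C', hC'⟩ := (hasCompactSupport_gradient
    ξ.hasCompactSupport).exists_bound_of_continuous hgξ
  have hvm := h.v_memLp.1
  have hHv := hH.continuous.comp_aestronglyMeasurable hvm
  have hξm : AEStronglyMeasurable (fun z : ℝ × Sp N => ξ z.2)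
      (volume.restrict (cylinder T Ω : Set (ℝ × Sp N))) :=
    (ξ.continuous.comp continuous_snd).aestronglyMeasurable
  have hgξL : MemLp (fun z : ℝ × Sp N => gradient ξ z.2) (ENNReal.ofReal p)
      (volume.restrict (cylinder T Ω : Set (ℝ × Sp N))) :=
    MemLp.of_bound (hgξ.comp continuous_snd).aestronglyMeasurable C' (ae_of_all _ fun z => hC' _)
  have key := h.integral_comp_mul_nonneg hp hΩ hV hf hH hHM hHM' hH0 hH1 ξ hξ ψ hψ
  set Q : Set (ℝ × Sp N) := (cylinder T Ω : Set (ℝ × Sp N))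
  set w : ℝ × Sp N → ℝ := fun z => H (v z.1 z.2) * ξ z.2
  set Dw : ℝ × Sp N → Sp N := fun z =>
    H (v z.1 z.2) • gradient ξ z.2 + (deriv H (v z.1 z.2) * ξ z.2) • Dv z.1 z.2
  have hDwL : MemLp Dw (ENNReal.ofReal p) (volume.restrict Q) := h.memLp_comp_mul hΩ hH hHM hHM' ξ
  have hA := h.memLp_flux hp hV
  have hP := h.memLp_pflux hp
  have hVL : MemLp (fun z : ℝ × Sp N => V z.2) (ENNReal.ofReal (p / (p - 1))) (volume.restrict Q) :=
    memLp_snd hV.memLp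
  have hwm : AEStronglyMeasurable w (volume.restrict Q) := hHv.mul hξm
  have hwC : ∀ z, ‖w z‖ ≤ M * C := fun z => by
    rw [norm_mul]
    exact mul_le_mul (hHM _) (hC _) (norm_nonneg _) hM
  have hd : IntegrableOn (fun z : ℝ × Sp N => divV z.2) Q :=
    (memLp_snd hdivV_bdd).integrable le_top
  have i1 : IntegrableOn (fun z : ℝ × Sp N => f z.1 z.2 * w z * ψ z.1) Q :=
    integrableOn_mul_continuous (hf.mul_bdd (c := M * C) hwm (ae_of_all _ hwC)) ψ.continuous
      ψ.hasCompactSupport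
  have i2' : IntegrableOn (fun z : ℝ × Sp N => divV z.2 * w z) Q :=
    hd.mul_bdd (c := M * C) hwm (ae_of_all _ hwC)
  have i2 : IntegrableOn (fun z : ℝ × Sp N => divV z.2 * w z * ψ z.1) Q :=
    integrableOn_mul_continuous i2' ψ.continuous ψ.hasCompactSupport
  have i3' : IntegrableOn (fun z : ℝ × Sp N => inner ℝ (V z.2) (Dw z)) Q :=
    integrable_of_norm_le_mul hpq.symm hVL hDwL (hVL.1.inner hDwL.1)
      (ae_of_all _ fun z => norm_inner_le_norm _ _)
  have i3 := integrableOn_mul_continuous i3' ψ.continuous ψ.hasCompactSupport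
  have i4' : IntegrableOn (fun z : ℝ × Sp N =>
      inner ℝ (pflux p (Dv z.1 z.2)) (gradient ξ z.2)) Q :=
    integrable_of_norm_le_mul hpq.symm hP hgξL (hP.1.inner hgξL.1)
      (ae_of_all _ fun z => norm_inner_le_norm _ _)
  have i4 : IntegrableOn (fun z : ℝ × Sp N =>
      H (v z.1 z.2) * (inner ℝ (pflux p (Dv z.1 z.2)) (gradient ξ z.2) * ψ z.1)) Q :=
    (integrableOn_mul_continuous i4' ψ.continuous ψ.hasCompactSupport).bdd_mul (c := M) hHv
      (ae_of_all _ fun z => hHM _)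
  have i5' : IntegrableOn (fun z : ℝ × Sp N =>
      inner ℝ (pflux p (Dv z.1 z.2) - u z.1 z.2 • V z.2) (Dw z)) Q :=
    integrable_of_norm_le_mul hpq.symm hA hDwL (hA.1.inner hDwL.1)
      (ae_of_all _ fun z => norm_inner_le_norm _ _)
  have i5 := integrableOn_mul_continuous i5' ψ.continuous ψ.hasCompactSupport
  -- On almost every time slice `Dw` is the gradient of the compactly supported Sobolev function
  -- `w`, which may test the weak divergence of `V`.
  have hdiv : ∫ z in Q, inner ℝ (V z.2) (Dw z) * ψ z.1 = - ∫ z in Q, divV z.2 * w z * ψ z.1 := by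
    rw [integral_cylinder i3, integral_cylinder i2, ← integral_neg]
    refine integral_congr_ae ?_
    filter_upwards [h.v_slice] with t ht
    rw [integral_mul_const, integral_mul_const, ← neg_mul]
    congr 1
    exact (ht.1.isCompactLimit_comp_mul (by linarith) hH hHM hHM' ξ).integral_inner_eq_neg hpq
      hdivV hV.memLp (hdivV_bdd.mono_exponent le_top)
  have hle : ∫ z in Q, (f z.1 z.2 * (ψ z.1 * w z)
        - inner ℝ (pflux p (Dv z.1 z.2) - u z.1 z.2 • V z.2) (ψ z.1 • Dw z))
      ≤ ∫ z in Q, (f z.1 z.2 * w z * ψ z.1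
        - H (v z.1 z.2) * (inner ℝ (pflux p (Dv z.1 z.2)) (gradient ξ z.2) * ψ z.1)
        + inner ℝ (V z.2) (Dw z) * ψ z.1) := by
    refine integral_mono_ae ?_ ((i1.sub i4).add i3) ?_
    · refine (i1.sub i5).congr (ae_of_all _ fun z => ?_)
      simp only [Pi.sub_apply, inner_smul_right]
      ring
    · filter_upwards [h.ae_gradient_eq_zero hp hΩ, h.v_nonneg, h.ae_eq_one] with z hz0 hz1 hz2
      -- On $\{v>0\}$, $u=1$; on $\{v=0\}$, $H(0)=0$ and $\nabla v=0$ make `Dw` vanish. This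
      -- eliminates `u` from the transport term.
      have e1 : inner ℝ (u z.1 z.2 • V z.2) (Dw z) = inner ℝ (V z.2) (Dw z) := by
        rcases hz1.lt_or_eq with hv | hv
        · rw [hz2 hv, one_smul]
        · have : Dw z = 0 := by simp [Dw, ← hv, hH1 0 le_rfl, hz0 hv.symm]
          rw [this, inner_zero_right, inner_zero_right]
      -- The discarded term is $H'(v)\,\xi\,|\nabla v|^p\ge 0$.
      have e2 : H (v z.1 z.2) * inner ℝ (pflux p (Dv z.1 z.2)) (gradient ξ z.2)
          ≤ inner ℝ (pflux p (Dv z.1 z.2)) (Dw z) := by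
        simp only [Dw, inner_add_right, inner_smul_right]
        refine le_add_of_nonneg_right (mul_nonneg (mul_nonneg (hH' _) (hξ _)) ?_)
        rw [pflux, real_inner_smul_left]
        exact mul_nonneg (by positivity) real_inner_self_nonneg
      have e3 := mul_le_mul_of_nonneg_right e2 (hψ z.1)
      simp only [inner_smul_right, inner_sub_left, e1]
      nlinarith
  have e0 := key.trans hle
  have e1 : ∫ z in Q, (f z.1 z.2 * w z * ψ z.1
        - H (v z.1 z.2) * (inner ℝ (pflux p (Dv z.1 z.2)) (gradient ξ z.2) * ψ z.1)
        + inner ℝ (V z.2) (Dw z) * ψ z.1)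
      = (∫ z in Q, f z.1 z.2 * w z * ψ z.1)
        - (∫ z in Q, H (v z.1 z.2) * (inner ℝ (pflux p (Dv z.1 z.2)) (gradient ξ z.2) * ψ z.1))
        + ∫ z in Q, inner ℝ (V z.2) (Dw z) * ψ z.1 := by
    have a1 := integral_add (i1.sub i4) i3
    simp only [Pi.sub_apply] at a1
    rw [a1, integral_sub i1 i4]
  have e2 : ∫ z in Q, H (v z.1 z.2) * ((f z.1 z.2 - divV z.2) * ξ z.2 * ψ z.1)
      = (∫ z in Q, f z.1 z.2 * w z * ψ z.1) - ∫ z in Q, divV z.2 * w z * ψ z.1 := by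
    rw [← integral_sub i1 i2]
    refine integral_congr_ae (ae_of_all _ fun z => ?_)
    simp only [w]
    ring
  rw [e1, hdiv] at e0
  rw [e2]
  linarith

/-- The inequality `-Δ_p v ≤ 1_{v > 0} (f - ∇ · V)` in the sense of distributions. -/
theorem IsWeakSolution.integral_pflux_le (hp : 2 < p)
    (hΩ : Bornology.IsBounded (Ω : Set (Sp N)))
    (h : IsWeakSolution p T Ω ΓD V f u₀ u v Dv)
    (hV : MemW1Vec (ENNReal.ofReal (p / (p - 1))) Ω V)
    (hdivV : HasWeakDivergence Ω V divV)
    (hdivV_bdd : MemLp divV ⊤ (volume.restrict (Ω : Set (Sp N))))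
    (hf : IntegrableOn (fun z : ℝ × Sp N => f z.1 z.2) (cylinder T Ω : Set (ℝ × Sp N)))
    (ξ : 𝓓(Ω, ℝ)) (hξ : ∀ x, 0 ≤ ξ x)
    (ψ : 𝓓((⟨Ioo 0 T, isOpen_Ioo⟩ : Opens ℝ), ℝ)) (hψ : ∀ t, 0 ≤ ψ t) :
    ∫ z in (cylinder T Ω : Set (ℝ × Sp N)),
        inner ℝ (pflux p (Dv z.1 z.2)) (gradient ξ z.2) * ψ z.1
      ≤ ∫ z in (cylinder T Ω : Set (ℝ × Sp N)),
        (Ioi (0 : ℝ)).indicator (fun _ => 1) (v z.1 z.2)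
          * ((f z.1 z.2 - divV z.2) * ξ z.2 * ψ z.1) := by
  have hfinQ := isFiniteMeasure_restrict_cylinder (T := T) hΩ
  have hpq := holderConjugate_div hp
  have hξ1 : ContDiff ℝ 1 ξ := ξ.contDiff.of_le (by simp)
  have hgξ := continuous_gradient hξ1
  obtain ⟨C, hC⟩ := ξ.hasCompactSupport.exists_bound_of_continuous ξ.continuous
  obtain ⟨C', hC'⟩ := (hasCompactSupport_gradient
    ξ.hasCompactSupport).exists_bound_of_continuous hgξ
  have hvm := h.v_memLp.1
  have hHv : ∀ n, AEStronglyMeasurable (fun z : ℝ × Sp N => smoothStep n 0 (v z.1 z.2))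
      (volume.restrict (cylinder T Ω : Set (ℝ × Sp N))) := fun n =>
    (contDiff_smoothStep n 0).continuous.comp_aestronglyMeasurable hvm
  have hgξL : MemLp (fun z : ℝ × Sp N => gradient ξ z.2) (ENNReal.ofReal p)
      (volume.restrict (cylinder T Ω : Set (ℝ × Sp N))) :=
    MemLp.of_bound (hgξ.comp continuous_snd).aestronglyMeasurable C' (ae_of_all _ fun z => hC' _)
  have hP := h.memLp_pflux hp
  have i1 : IntegrableOn (fun z : ℝ × Sp N =>
      inner ℝ (pflux p (Dv z.1 z.2)) (gradient ξ z.2) * ψ z.1)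
      (cylinder T Ω : Set (ℝ × Sp N)) :=
    integrableOn_mul_continuous (integrable_of_norm_le_mul hpq.symm hP hgξL (hP.1.inner hgξL.1)
      (ae_of_all _ fun z => norm_inner_le_norm _ _)) ψ.continuous ψ.hasCompactSupport
  have hd : IntegrableOn (fun z : ℝ × Sp N => divV z.2) (cylinder T Ω : Set (ℝ × Sp N)) :=
    (memLp_snd hdivV_bdd).integrable le_top
  have i2 : IntegrableOn (fun z : ℝ × Sp N => (f z.1 z.2 - divV z.2) * ξ z.2 * ψ z.1)
      (cylinder T Ω : Set (ℝ × Sp N)) :=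
    integrableOn_mul_continuous ((hf.sub hd).mul_bdd (c := C)
      (ξ.continuous.comp continuous_snd).aestronglyMeasurable (ae_of_all _ fun z => hC _))
      ψ.continuous ψ.hasCompactSupport
  have lim : ∀ k : ℝ × Sp N → ℝ, IntegrableOn k (cylinder T Ω : Set (ℝ × Sp N)) →
      Tendsto (fun n => ∫ z in (cylinder T Ω : Set (ℝ × Sp N)),
        smoothStep n 0 (v z.1 z.2) * k z) atTop
        (𝓝 (∫ z in (cylinder T Ω : Set (ℝ × Sp N)),
          (Ioi (0 : ℝ)).indicator (fun _ => 1) (v z.1 z.2) * k z)) := fun k hk => by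
    refine tendsto_integral_of_dominated_convergence (fun z => ‖k z‖)
      (fun n => (hHv n).mul hk.1) hk.norm (fun n => ae_of_all _ fun z => ?_)
      (ae_of_all _ fun z => ?_)
    · rw [norm_mul]
      exact mul_le_of_le_one_left (norm_nonneg _) (norm_smoothStep_le _ _ _)
    · exact (tendsto_smoothStep 0 _).mul_const _
  -- The flux vanishes almost everywhere on $\{v=0\}$, so the indicator of $\{v>0\}$, which is the
  -- limit of the steps, can be inserted for free.
  have hfl : ∫ z in (cylinder T Ω : Set (ℝ × Sp N)),
        inner ℝ (pflux p (Dv z.1 z.2)) (gradient ξ z.2) * ψ z.1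
      = ∫ z in (cylinder T Ω : Set (ℝ × Sp N)),
        (Ioi (0 : ℝ)).indicator (fun _ => 1) (v z.1 z.2)
          * (inner ℝ (pflux p (Dv z.1 z.2)) (gradient ξ z.2) * ψ z.1) := by
    refine integral_congr_ae ?_
    filter_upwards [h.ae_gradient_eq_zero hp hΩ, h.v_nonneg] with z hz0 hz1
    rcases hz1.lt_or_eq with hv | hv
    · simp [indicator, hv]
    · simp [hz0 hv.symm, pflux]
  rw [hfl]
  refine le_of_tendsto_of_tendsto' (lim _ i1) (lim _ i2) fun n => ?_
  -- The bound may depend on `n`: it serves only to make each step admissible, and does not enter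
  -- the limit.
  obtain ⟨M, hM⟩ : ∃ M, ∀ s, |deriv (smoothStep n 0) s| ≤ M := by
    have hcd : Continuous (deriv (smoothStep n 0)) :=
      (contDiff_smoothStep n 0).continuous_deriv (by simp)
    have hcs : HasCompactSupport (deriv (smoothStep n 0)) := by
      refine HasCompactSupport.of_support_subset_isCompact
        (isCompact_Icc (a := (0 : ℝ)) (b := ((n : ℝ) + 1)⁻¹)) fun s hs => ?_
      by_contra hn
      rw [mem_Icc, not_and_or, not_le, not_le] at hn
      rcases hn with hn | hn
      · exact hs (deriv_smoothStep_eq_zero_of_lt hn)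
      · exact hs (deriv_smoothStep_eq_zero_of_gt (by simpa using hn))
    exact hcs.exists_bound_of_continuous hcd
  exact h.integral_comp_pflux_le hp hΩ hV hdivV hdivV_bdd hf (contDiff_smoothStep n 0)
    (M := max 1 M) (fun s => (norm_smoothStep_le n 0 s).trans (le_max_left _ _))
    (fun s => (hM s).trans (le_max_right _ _)) (fun s => Real.smoothTransition.nonneg _)
    (fun s hs => smoothStep_of_le hs) (deriv_smoothStep_nonneg n 0) ξ hξ ψ hψ

end Kato

/-! ### Calculus in space-time and mollified divergences -/

section SpaceTime

variable {N : ℕ} {T : ℝ} {Ω : Opens (Sp N)}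

theorem fderiv_apply_zero_right {ζ : ℝ × Sp N → ℝ} {z : ℝ × Sp N} (h : DifferentiableAt ℝ ζ z) :
    deriv (fun s => ζ (s, z.2)) z.1 = fderiv ℝ ζ z (1, 0) := by
  have h1 : HasDerivAt (fun s : ℝ => (s, z.2)) ((1, 0) : ℝ × Sp N) z.1 :=
    (hasDerivAt_id z.1).prodMk (hasDerivAt_const z.1 z.2)
  exact (h.hasFDerivAt.comp_hasDerivAt z.1 h1).deriv

theorem inner_gradient_slice {ζ : ℝ × Sp N → ℝ} {z : ℝ × Sp N} (h : DifferentiableAt ℝ ζ z)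
    (a : Sp N) : inner ℝ a (gradient (fun y => ζ (z.1, y)) z.2) = fderiv ℝ ζ z (0, a) := by
  rw [inner_gradient_eq_fderiv]
  have h1 : HasFDerivAt (fun y : Sp N => (z.1, y)) (ContinuousLinearMap.inr ℝ ℝ (Sp N)) z.2 :=
    hasFDerivAt_prodMk_right z.1 z.2
  have h2 : HasFDerivAt (fun y => ζ (z.1, y)) _ z.2 := h.hasFDerivAt.comp z.2 h1
  rw [h2.fderiv]
  rfl

theorem clm_apply_eq_sum (ℓ : ℝ × Sp N →L[ℝ] ℝ) (a : Sp N) :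
    ℓ (0, a) = ∑ i, ℓ (0, EuclideanSpace.single i 1) * a i := by
  have h : a = ∑ i, a i • EuclideanSpace.single i (1 : ℝ) := by
    ext j
    simp [Finset.sum_apply, Pi.single_apply]
  have : ((0, a) : ℝ × Sp N) = ∑ i, a i • ((0, EuclideanSpace.single i 1) : ℝ × Sp N) := by
    ext1
    · simp [Prod.fst_sum]
    · simp only [Prod.snd_sum, Prod.smul_snd]
      exact h
  rw [this, map_sum]
  simp only [map_smul, smul_eq_mul, mul_comm]

theorem norm_fderiv_apply_le {ζ : ℝ × Sp N → ℝ} {C : ℝ} {z : ℝ × Sp N}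
    (hC : ‖fderiv ℝ ζ z‖ ≤ C) (a : Sp N) : ‖fderiv ℝ ζ z (0, a)‖ ≤ C * ‖a‖ := by
  refine (ContinuousLinearMap.le_of_opNorm_le _ hC _).trans_eq ?_
  simp [Prod.norm_def]

theorem aestronglyMeasurable_fderiv_apply {ζ : ℝ × Sp N → ℝ} (hζ : ContDiff ℝ 1 ζ)
    {ν : Measure (ℝ × Sp N)} {B : ℝ × Sp N → Sp N} (hB : AEStronglyMeasurable B ν) :
    AEStronglyMeasurable (fun z => fderiv ℝ ζ z (0, B z)) ν := by
  have h : Continuous fun q : (ℝ × Sp N) × Sp N => fderiv ℝ ζ q.1 (0, q.2) :=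
    ((hζ.continuous_fderiv one_ne_zero).comp continuous_fst).clm_apply (by fun_prop)
  exact h.comp_aestronglyMeasurable (aestronglyMeasurable_id.prodMk hB)

theorem integrable_fderiv_apply {ζ : ℝ × Sp N → ℝ} (hζ : ContDiff ℝ 1 ζ)
    (hζc : HasCompactSupport ζ) {ν : Measure (ℝ × Sp N)} {B : ℝ × Sp N → Sp N}
    (hB : Integrable B ν) : Integrable (fun z => fderiv ℝ ζ z (0, B z)) ν := by
  obtain ⟨C, hC⟩ := (hζc.fderiv ℝ).exists_bound_of_continuous (hζ.continuous_fderiv one_ne_zero)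
  exact (hB.norm.const_mul C).mono' (aestronglyMeasurable_fderiv_apply hζ hB.1)
    (ae_of_all _ fun z => norm_fderiv_apply_le (hC z) _)

/-- The weak divergence of a stationary vector field, tested with functions of space and time. -/
theorem HasWeakDivergence.integral_fderiv_eq_neg {r s : ℝ} (hrs : r.HolderConjugate s)
    (hΩ : Bornology.IsBounded (Ω : Set (Sp N))) {V : Sp N → Sp N} {d : Sp N → ℝ}
    (hV : HasWeakDivergence Ω V d) (hVL : MemLp V (ENNReal.ofReal s) (volume.restrict Ω))
    (hdL : MemLp d ⊤ (volume.restrict (Ω : Set (Sp N)))) {ζ : ℝ × Sp N → ℝ} (hζ : ContDiff ℝ 1 ζ)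
    (hζc : HasCompactSupport ζ) (hζQ : tsupport ζ ⊆ cylinder T Ω) :
    ∫ z in (cylinder T Ω : Set (ℝ × Sp N)), fderiv ℝ ζ z (0, V z.2)
      = - ∫ z in (cylinder T Ω : Set (ℝ × Sp N)), d z.2 * ζ z := by
  have hfin := isFiniteMeasure_restrict hΩ
  have hfinQ := isFiniteMeasure_restrict_cylinder (T := T) hΩ
  have hdi : IntegrableOn (fun z : ℝ × Sp N => d z.2) (cylinder T Ω : Set (ℝ × Sp N)) :=
    (memLp_snd hdL).integrable le_top
  obtain ⟨C, hC⟩ := hζc.exists_bound_of_continuous hζ.continuous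
  have i1 : IntegrableOn (fun z : ℝ × Sp N => d z.2 * ζ z) (cylinder T Ω : Set (ℝ × Sp N)) :=
    hdi.mul_bdd (c := C) hζ.continuous.aestronglyMeasurable (ae_of_all _ hC)
  have i2 : IntegrableOn (fun z : ℝ × Sp N => fderiv ℝ ζ z (0, V z.2))
      (cylinder T Ω : Set (ℝ × Sp N)) :=
    integrable_fderiv_apply hζ hζc ((memLp_snd hVL).integrable (ofReal_one_le hrs.symm.lt.le))
  rw [integral_cylinder i1, integral_cylinder i2, ← integral_neg]
  refine integral_congr_ae (ae_of_all _ fun t => ?_)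
  have hsl : ContDiff ℝ 1 fun y : Sp N => ζ (t, y) := hζ.comp (contDiff_prodMk_right t)
  -- Each time slice of `ζ` is a $C^1$ function with compact support in $\Omega$, so the stationary
  -- identity applies slice by slice.
  have hts : tsupport (fun y : Sp N => ζ (t, y)) ⊆ (fun y : Sp N => (t, y)) ⁻¹' tsupport ζ :=
    closure_minimal (fun y hy => subset_tsupport _ hy)
      ((isClosed_tsupport ζ).preimage (by fun_prop))
  have hcs : HasCompactSupport fun y : Sp N => ζ (t, y) :=
    (hζc.isCompact.image continuous_snd).of_isClosed_subset (isClosed_tsupport _)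
      fun y hy => ⟨(t, y), hts hy, rfl⟩
  have := (isCompactLimit_of_contDiff hrs.lt.le hsl hcs
    fun y hy => (hζQ (hts hy)).2).integral_inner_eq_neg hrs hV hVL (hdL.mono_exponent le_top)
  simp only
  rw [← this]
  refine integral_congr_ae (ae_of_all _ fun x => ?_)
  exact (inner_gradient_slice (z := (t, x)) (hζ.differentiable one_ne_zero _) _).symm

/-- The spatial divergence of the mollification of a vector field. -/
noncomputable def mollifyDiv (k : ℝ × Sp N → ℝ) (B : ℝ × Sp N → Sp N) (z : ℝ × Sp N) : ℝ :=
  ∫ z', fderiv ℝ k (z - z') (0, B z')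

theorem integrable_mollifyDiv {k : ℝ × Sp N → ℝ} (hk : ContDiff ℝ 1 k) (hkc : HasCompactSupport k)
    {B : ℝ × Sp N → Sp N} (hB : LocallyIntegrable B) (z : ℝ × Sp N) :
    Integrable fun z' => fderiv ℝ k (z - z') (0, B z') := by
  let L : (ℝ × Sp N →L[ℝ] ℝ) →L[ℝ] Sp N →L[ℝ] ℝ :=
    (ContinuousLinearMap.compL ℝ (Sp N) (ℝ × Sp N) ℝ).flip (ContinuousLinearMap.inr ℝ ℝ (Sp N))
  exact (hkc.fderiv ℝ).convolutionExists_right L.flip hB (hk.continuous_fderiv one_ne_zero) z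

theorem locallyIntegrable_apply {B : ℝ × Sp N → Sp N} (hB : LocallyIntegrable B) (i : Fin N) :
    LocallyIntegrable fun z => B z i := fun z => by
  obtain ⟨s, hs, h⟩ := hB z
  exact ⟨s, hs, (EuclideanSpace.proj (𝕜 := ℝ) i).integrable_comp h⟩

/-- Reduces the divergence to scalar mollifications, whose regularity and integration by parts are
at hand. -/
theorem mollifyDiv_eq_sum {k : ℝ × Sp N → ℝ} (hk : ContDiff ℝ ∞ k) (hkc : HasCompactSupport k)
    {B : ℝ × Sp N → Sp N} (hB : LocallyIntegrable B) (z : ℝ × Sp N) :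
    mollifyDiv k B z
      = ∑ i, fderiv ℝ (mollify volume k fun z => B z i) z (0, EuclideanSpace.single i 1) := by
  have hBi := locallyIntegrable_apply hB
  simp only [mollifyDiv, fderiv_mollify hk hkc (hBi _), clm_apply_eq_sum _ (B _), smul_eq_mul]
  refine integral_finsetSum _ fun i _ => ?_
  exact (hkc.fderiv_apply ℝ _).convolutionExists_right (ContinuousLinearMap.mul ℝ ℝ).flip (hBi i)
    (((hk.of_le (by simp)).continuous_fderiv one_ne_zero).clm_apply continuous_const) z

theorem continuous_mollifyDiv {k : ℝ × Sp N → ℝ} (hk : ContDiff ℝ ∞ k) (hkc : HasCompactSupport k)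
    {B : ℝ × Sp N → Sp N} (hB : LocallyIntegrable B) : Continuous (mollifyDiv k B) := by
  rw [show mollifyDiv k B = _ from funext (mollifyDiv_eq_sum hk hkc hB)]
  refine continuous_finsetSum _ fun i _ => ?_
  exact (((contDiff_mollify hk hkc (locallyIntegrable_apply hB i)).continuous_fderiv
    (by simp)).clm_apply continuous_const)

theorem integral_mul_fderiv_eq_neg {a b : ℝ × Sp N → ℝ} (ha : ContDiff ℝ 1 a)
    (hb : ContDiff ℝ 1 b) (hac : HasCompactSupport a) (e : ℝ × Sp N) :
    ∫ z, a z * fderiv ℝ b z e = - ∫ z, fderiv ℝ a z e * b z := by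
  have ha' := (ha.continuous_fderiv one_ne_zero).clm_apply (continuous_const (y := e))
  have hb' := (hb.continuous_fderiv one_ne_zero).clm_apply (continuous_const (y := e))
  refine integral_mul_fderiv_eq_neg_fderiv_mul_of_integrable ?_ ?_ ?_
    (fun z _ => ha.differentiable one_ne_zero z) fun z _ => hb.differentiable one_ne_zero z
  · exact (ha'.mul hb.continuous).integrable_of_hasCompactSupport (hac.fderiv_apply ℝ e).mul_right
  · exact (ha.continuous.mul hb').integrable_of_hasCompactSupport hac.mul_right
  · exact (ha.continuous.mul hb.continuous).integrable_of_hasCompactSupport hac.mul_right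

theorem IsKernel.integrable_mollify {k g : ℝ × Sp N → ℝ} {δ : ℝ} (hk : IsKernel volume k δ)
    (hg : Integrable g) : Integrable (mollify volume k g) := by
  have := hk.integrable.integrable_convolution (ContinuousLinearMap.mul ℝ ℝ) hg
  rw [← convolution_flip] at this
  exact this

/-- Integrating by parts component by component puts the derivative on `φ`; then the mollified
components converge in $L^1$. -/
theorem tendsto_integral_mul_mollifyDiv {k : ℕ → ℝ × Sp N → ℝ} {δ : ℕ → ℝ}
    (hk : ∀ n, IsKernel volume (k n) (δ n)) (hδ : Tendsto δ atTop (𝓝 0))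
    {B : ℝ × Sp N → Sp N} (hB : Integrable B) {φ : ℝ × Sp N → ℝ} (hφ : ContDiff ℝ 1 φ)
    (hφc : HasCompactSupport φ) :
    Tendsto (fun n => ∫ z, φ z * mollifyDiv (k n) B z) atTop
      (𝓝 (- ∫ z, fderiv ℝ φ z (0, B z))) := by
  have hBi : ∀ i, Integrable fun z => B z i := fun i =>
    (EuclideanSpace.proj (𝕜 := ℝ) i).integrable_comp hB
  have hBl := fun i => (hBi i).locallyIntegrable
  set e : Fin N → ℝ × Sp N := fun i => (0, EuclideanSpace.single i 1)
  have hφ' : ∀ i, Continuous fun z => fderiv ℝ φ z (e i) := fun i =>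
    (hφ.continuous_fderiv one_ne_zero).clm_apply continuous_const
  have hm : ∀ n i, ContDiff ℝ 1 (mollify volume (k n) fun z => B z i) := fun n i =>
    (contDiff_mollify (hk n).contDiff (hk n).hasCompactSupport (hBl i)).of_le (by simp)
  have hfc : ∀ i, ∃ C, ∀ z, ‖fderiv ℝ φ z (e i)‖ ≤ C := fun i =>
    (hφc.fderiv_apply ℝ (e i)).exists_bound_of_continuous (hφ' i)
  choose C hC using hfc
  have e1 : ∀ n, ∫ z, φ z * mollifyDiv (k n) B z
      = - ∑ i, ∫ z, fderiv ℝ φ z (e i) * mollify volume (k n) (fun z => B z i) z := fun n => by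
    simp only [mollifyDiv_eq_sum (hk n).contDiff (hk n).hasCompactSupport hB.locallyIntegrable,
      Finset.mul_sum]
    rw [integral_finsetSum, ← Finset.sum_neg_distrib]
    · exact Finset.sum_congr rfl fun i _ => integral_mul_fderiv_eq_neg hφ (hm n i) hφc _
    · intro i _
      exact (hφ.continuous.mul (((hm n i).continuous_fderiv one_ne_zero).clm_apply
        continuous_const)).integrable_of_hasCompactSupport hφc.mul_right
  have e2 : ∫ z, fderiv ℝ φ z (0, B z) = ∑ i, ∫ z, fderiv ℝ φ z (e i) * B z i := by
    rw [← integral_finsetSum]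
    · exact integral_congr_ae (ae_of_all _ fun z => clm_apply_eq_sum _ _)
    · exact fun i _ => (hBi i).bdd_mul (c := C i) (hφ' i).aestronglyMeasurable
        (ae_of_all _ (hC i))
  simp only [e1, e2]
  refine (tendsto_finsetSum _ fun i _ => ?_).neg
  refine tendsto_integral_mul_of_bounded (fun n => (hφ' i).aestronglyMeasurable)
    (fun n => ae_of_all _ (hC i)) (ae_of_all _ fun z => tendsto_const_nhds) (fun n => ?_) (hBi i)
    (tendsto_integral_mollify_sub hk hδ (hBi i))
  exact (hk n).integrable_mollify (hBi i)

end SpaceTime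

/-! ### The commutator estimate -/

section Commutator

variable {N : ℕ} {T : ℝ} {Ω : Opens (Sp N)}

theorem norm_le_sum_norm_apply (x : Sp N) : ‖x‖ ≤ ∑ i, ‖x i‖ := by
  have h : x = ∑ i, x i • EuclideanSpace.single i (1 : ℝ) := by
    ext j
    simp [Finset.sum_apply, Pi.single_apply]
  calc ‖x‖ = ‖∑ i, x i • EuclideanSpace.single i (1 : ℝ)‖ := by rw [← h]
    _ ≤ ∑ i, ‖x i‖ := (norm_sum_le _ _).trans_eq (by simp [norm_smul])

/-- The scalar estimate is summed over components. The constant is the sum of the norms of the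
component gradients, so it depends neither on the set nor on the margin or the shift. -/
theorem MemW1Vec.exists_eLpNorm_translation_sub_le {r : ℝ} (hr : 1 ≤ r) {V : Sp N → Sp N}
    (hV : MemW1Vec (ENNReal.ofReal r) Ω V) : ∃ L : ℝ≥0∞, L ≠ ⊤ ∧ ∀ {K : Set (Sp N)},
      MeasurableSet K → ∀ {δ : ℝ}, 0 < δ → (∀ x ∈ K, Metric.closedBall x (2 * δ) ⊆ Ω) →
      ∀ {h : Sp N}, ‖h‖ ≤ δ →
        eLpNorm (fun x => (Ω : Set (Sp N)).indicator V (x - h) - (Ω : Set (Sp N)).indicator V x)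
          (ENNReal.ofReal r) (volume.restrict K) ≤ ‖h‖ₑ * L := by
  have hVL := memLp_indicator hV.memLp
  choose G hG using hV
  refine ⟨∑ i, eLpNorm (G i) (ENNReal.ofReal r) (volume.restrict Ω),
    ENNReal.sum_ne_top.2 fun i _ => (hG i).2.1.2.ne, fun {K} hK {δ} hδ hKΩ {h} hh => ?_⟩
  have e : ∀ (i : Fin N) (x : Sp N), (Ω : Set (Sp N)).indicator (fun x => V x i) x
      = (Ω : Set (Sp N)).indicator V x i := fun i x => by
    simp only [indicator]; split_ifs <;> simp
  have hm : AEStronglyMeasurable (fun x => (Ω : Set (Sp N)).indicator V (x - h)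
      - (Ω : Set (Sp N)).indicator V x) (volume.restrict K) :=
    ((hVL.1.comp_measurePreserving (measurePreserving_sub_right volume h)).sub hVL.1).restrict
  refine (eLpNorm_mono_real (g := ∑ i : Fin N, fun x => ‖(Ω : Set (Sp N)).indicator V (x - h) i
    - (Ω : Set (Sp N)).indicator V x i‖) fun x => ?_).trans
    ((eLpNorm_sum_le (fun i _ => ?_) (ofReal_one_le hr)).trans ?_)
  · rw [Finset.sum_apply]
    exact norm_le_sum_norm_apply _
  · exact ((EuclideanSpace.proj (𝕜 := ℝ) i).continuous.comp_aestronglyMeasurable hm).norm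
  · rw [Finset.mul_sum]
    refine Finset.sum_le_sum fun i _ => ?_
    rw [eLpNorm_norm]
    have := (hG i).eLpNorm_translation_sub_le hr hK hδ hKΩ hh
    simpa only [e] using this

/-- The projection to space pushes the product measure forward to `T` times the measure on `K'`. -/
theorem eLpNorm_snd_le {F : Type*} [NormedAddCommGroup F] {q : ℝ≥0∞} (hq : q ≠ ⊤) {g : Sp N → F}
    {K : Set (ℝ × Sp N)} {K' : Set (Sp N)} (hK : K ⊆ Ioo 0 T ×ˢ K')
    (hg : AEStronglyMeasurable g (volume.restrict K')) :
    eLpNorm (fun z : ℝ × Sp N => g z.2) q (volume.restrict K)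
      ≤ ENNReal.ofReal T ^ (1 / q).toReal * eLpNorm g q (volume.restrict K') := by
  refine (eLpNorm_mono_measure _ (Measure.restrict_mono hK le_rfl)).trans ?_
  have e : (volume : Measure (ℝ × Sp N)).restrict (Ioo 0 T ×ˢ K')
      = (volume.restrict (Ioo 0 T)).prod (volume.restrict K') := by
    rw [Measure.prod_restrict]; rfl
  have hmap : Measure.map Prod.snd (((volume : Measure ℝ).restrict (Ioo 0 T)).prod
      (volume.restrict K')) = ENNReal.ofReal T • volume.restrict K' := by
    rw [Measure.map_snd_prod]; simp
  rw [e]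
  have := eLpNorm_map_measure (p := q) (f := Prod.snd) (g := g)
    (μ := ((volume : Measure ℝ).restrict (Ioo 0 T)).prod (volume.restrict K'))
    (by rw [hmap]; exact hg.mono_ac (Measure.smul_absolutelyContinuous)) measurable_snd.aemeasurable
  rw [hmap, eLpNorm_smul_measure_of_ne_top hq] at this
  exact this.symm.le

theorem locallyIntegrable_snd {F : Type*} [NormedAddCommGroup F] {g : Sp N → F}
    (hg : Integrable g) : LocallyIntegrable fun z : ℝ × Sp N => g z.2 := fun z => by
  refine ⟨Ioo (z.1 - 1) (z.1 + 1) ×ˢ univ, prod_mem_nhds (Ioo_mem_nhds (by linarith) (by linarith))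
    univ_mem, ?_⟩
  rw [IntegrableOn, Measure.volume_eq_prod, ← Measure.prod_restrict, Measure.restrict_univ]
  exact hg.comp_snd _

/-- The commutator `∫ (u(z') - u(z)) (W(z') - W(z)) · ∇ₓk(z - z') dz'`. -/
noncomputable def commutator (k u : ℝ × Sp N → ℝ) (W : ℝ × Sp N → Sp N) (z : ℝ × Sp N) : ℝ :=
  ∫ z', (u z' - u z) * fderiv ℝ k (z - z') (0, W z' - W z)

theorem integral_fderiv_comp_sub_eq_zero {k : ℝ × Sp N → ℝ} (hk : ContDiff ℝ 1 k)
    (hkc : HasCompactSupport k) (z e : ℝ × Sp N) : ∫ z', fderiv ℝ k (z - z') e = 0 := by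
  rw [integral_sub_left_eq_self (fun z' => fderiv ℝ k z' e) volume z]
  have := integral_mul_fderiv_eq_neg hk (contDiff_const (c := (1 : ℝ))) hkc e
  simpa using this.symm

/-- Expansion of the two increments. The fourth term carries the constants $u(z)$ and $W(z)$, and
the kernel gradient has zero integral. -/
theorem commutator_eq {k : ℝ × Sp N → ℝ} (hk : ContDiff ℝ ∞ k) (hkc : HasCompactSupport k)
    {u : ℝ × Sp N → ℝ} (hu : LocallyIntegrable u) {W : ℝ × Sp N → Sp N}
    (hW : LocallyIntegrable W) (huW : LocallyIntegrable fun z => u z • W z) (z : ℝ × Sp N) :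
    commutator k u W z = mollifyDiv k (fun z => u z • W z) z
      - fderiv ℝ (mollify volume k u) z (0, W z) - u z * mollifyDiv k W z := by
  have hk1 : ContDiff ℝ 1 k := hk.of_le (by simp)
  have i1 := integrable_mollifyDiv hk1 hkc huW z
  have i2 := integrable_mollifyDiv hk1 hkc hW z
  have i3 : Integrable fun z' => fderiv ℝ k (z - z') (0, W z) • u z' :=
    (hkc.fderiv_apply ℝ _).convolutionExists_right (ContinuousLinearMap.mul ℝ ℝ).flip hu
      ((hk1.continuous_fderiv one_ne_zero).clm_apply continuous_const) z
  have i4 : Integrable fun z' => fderiv ℝ k (z - z') (0, W z) := by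
    have : Integrable fun z' => fderiv ℝ k z' (0, W z) :=
      ((hk1.continuous_fderiv one_ne_zero).clm_apply
        continuous_const).integrable_of_hasCompactSupport (hkc.fderiv_apply ℝ _)
    exact this.comp_sub_left z
  have e1 := integral_sub i1 i3
  have e2 := integral_sub (i1.sub i3) (i2.const_mul (u z))
  have e3 := integral_add ((i1.sub i3).sub (i2.const_mul (u z))) (i4.const_mul (u z))
  simp only [Pi.sub_apply] at e2 e3
  rw [integral_const_mul (u z), integral_fderiv_comp_sub_eq_zero hk1 hkc, mul_zero, add_zero, e2,
    e1, integral_const_mul] at e3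
  rw [fderiv_mollify hk hkc hu, mollifyDiv, mollifyDiv, ← e3]
  refine integral_congr_ae (ae_of_all _ fun z' => ?_)
  have h1 : ((0, W z' - W z) : ℝ × Sp N) = (0, W z') - (0, W z) := by simp
  have h2 : ((0, u z' • W z') : ℝ × Sp N) = u z' • (0, W z') := by simp
  simp only [h1, h2, map_sub, map_smul, smul_eq_mul]
  ring

/-- After the change of variables $h = z - z'$, Hölder's inequality is applied in $z$ for each fixed
shift. The increment of `W` contributes the factor $|h_x|$, exactly what makes the integral of the
spatial kernel gradient bounded uniformly in the radius. -/
theorem lintegral_commutator_le {r s : ℝ} (hrs : r.HolderConjugate s) {k : ℝ × Sp N → ℝ} {δ : ℝ}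
    (hk : IsKernel volume k δ) {u : ℝ × Sp N → ℝ} (hu : AEStronglyMeasurable u)
    {W : ℝ × Sp N → Sp N} (hW : AEStronglyMeasurable W) {K : Set (ℝ × Sp N)} {A L C : ℝ≥0∞}
    (hA : ∀ h, ‖h‖ ≤ δ → eLpNorm (fun z => u (z - h) - u z) (ENNReal.ofReal r) ≤ A)
    (hL : ∀ h, ‖h‖ ≤ δ → eLpNorm (fun z => W (z - h) - W z) (ENNReal.ofReal s)
      (volume.restrict K) ≤ ‖h.2‖ₑ * L)
    (hC : ∫⁻ h, ‖(fderiv ℝ k h).comp (ContinuousLinearMap.inr ℝ ℝ (Sp N))‖ₑ * ‖h.2‖ₑ ≤ C) :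
    ∫⁻ z in K, ‖commutator k u W z‖ₑ ≤ A * L * C := by
  have hk1 : ContDiff ℝ 1 k := hk.contDiff.of_le (by simp)
  set m : ℝ × Sp N → ℝ≥0∞ := fun h =>
    ‖(fderiv ℝ k h).comp (ContinuousLinearMap.inr ℝ ℝ (Sp N))‖ₑ
  have hm : Measurable m :=
    ((hk1.continuous_fderiv one_ne_zero).clm_comp continuous_const).enorm.measurable
  -- Only shifts of size at most `δ` contribute, which is where `hA` and `hL` are available.
  have hm0 : ∀ h, δ < ‖h‖ → m h = 0 := fun h hh => by
    have : fderiv ℝ k h = 0 := by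
      by_contra hne
      have := hk.tsupport_subset (support_fderiv_subset ℝ hne)
      rw [mem_closedBall_zero_iff] at this
      exact absurd this (not_le.2 hh)
    simp only [m, this, ContinuousLinearMap.zero_comp]
    exact (ofReal_norm _).symm.trans (by simp)
  have hac : Measure.AbsolutelyContinuous (((volume : Measure (ℝ × Sp N)).restrict K).prod
      (volume : Measure (ℝ × Sp N))) ((volume : Measure (ℝ × Sp N)).prod volume) :=
    Measure.AbsolutelyContinuous.prod Measure.restrict_le_self.absolutelyContinuous
      Measure.AbsolutelyContinuous.rfl
  have meas : ∀ {F : Type} [NormedAddCommGroup F] {g : ℝ × Sp N → F}, AEStronglyMeasurable g →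
      AEStronglyMeasurable (fun q : (ℝ × Sp N) × (ℝ × Sp N) => g (q.1 - q.2) - g q.1)
        ((volume.restrict K).prod volume) := fun hg =>
    ((hg.comp_quasiMeasurePreserving (quasiMeasurePreserving_sub volume volume)).sub
      hg.comp_fst).mono_ac hac
  have hum := meas hu
  have hWm := meas hW
  calc ∫⁻ z in K, ‖commutator k u W z‖ₑ
      ≤ ∫⁻ z in K, ∫⁻ h, m h * (‖u (z - h) - u z‖ₑ * ‖W (z - h) - W z‖ₑ) := by
        refine lintegral_mono fun z => (enorm_integral_le_lintegral_enorm _).trans ?_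
        have := lintegral_sub_left_eq_self (μ := volume)
          (fun z' => ‖(u z' - u z) * fderiv ℝ k (z - z') (0, W z' - W z)‖ₑ) z
        rw [← this]
        refine lintegral_mono fun h => ?_
        rw [enorm_mul, sub_sub_cancel, mul_left_comm]
        gcongr
        exact ((fderiv ℝ k h).comp (ContinuousLinearMap.inr ℝ ℝ (Sp N))).le_opENorm _
    _ = ∫⁻ h, ∫⁻ z in K, m h * (‖u (z - h) - u z‖ₑ * ‖W (z - h) - W z‖ₑ) := by
        refine lintegral_lintegral_swap ?_
        exact (hm.comp measurable_snd).aemeasurable.mul (hum.enorm.mul hWm.enorm)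
    _ ≤ ∫⁻ h, A * L * (m h * ‖h.2‖ₑ) := by
        refine lintegral_mono fun h => ?_
        by_cases hh : ‖h‖ ≤ δ
        · have h1 : AEStronglyMeasurable (fun z => u (z - h) - u z) (volume.restrict K) :=
            ((hu.comp_measurePreserving (measurePreserving_sub_right volume h)).sub hu).restrict
          have h2 : AEStronglyMeasurable (fun z => W (z - h) - W z) (volume.restrict K) :=
            ((hW.comp_measurePreserving (measurePreserving_sub_right volume h)).sub hW).restrict
          have h3 : AEMeasurable (fun z => ‖u (z - h) - u z‖ₑ * ‖W (z - h) - W z‖ₑ)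
              (volume.restrict K) := h1.enorm.mul h2.enorm
          rw [lintegral_const_mul'' _ h3]
          calc m h * ∫⁻ z in K, ‖u (z - h) - u z‖ₑ * ‖W (z - h) - W z‖ₑ
              ≤ m h * (A * (‖h.2‖ₑ * L)) := by
                gcongr
                refine (lintegral_enorm_mul_le hrs h1 h2).trans ?_
                gcongr
                · exact (eLpNorm_mono_measure _ Measure.restrict_le_self).trans (hA h hh)
                · exact hL h hh
            _ = A * L * (m h * ‖h.2‖ₑ) := by ring
        · simp [hm0 h (not_le.1 hh)]
    _ ≤ A * L * C := by
        have h3 : Measurable fun h : ℝ × Sp N => m h * ‖h.2‖ₑ := hm.mul (by fun_prop)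
        rw [lintegral_const_mul _ h3]
        gcongr

/-- The factors from `W` and from the kernels stay bounded, while the $L^r$ modulus of continuity of
`u` at scale $\delta_n$ tends to zero. No limit of difference quotients of `W` has to be identified.
-/
theorem tendsto_lintegral_commutator {r s : ℝ} (hrs : r.HolderConjugate s)
    {k : ℕ → ℝ × Sp N → ℝ} {δ : ℕ → ℝ} (hk : ∀ n, IsKernel volume (k n) (δ n))
    (hδ : Tendsto δ atTop (𝓝 0)) {u : ℝ × Sp N → ℝ} (hu : MemLp u (ENNReal.ofReal r))
    {W : ℝ × Sp N → Sp N} (hW : AEStronglyMeasurable W) {K : Set (ℝ × Sp N)} {L C : ℝ≥0∞}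
    (hLt : L ≠ ⊤) (hCt : C ≠ ⊤)
    (hL : ∀ n h, ‖h‖ ≤ δ n → eLpNorm (fun z => W (z - h) - W z) (ENNReal.ofReal s)
      (volume.restrict K) ≤ ‖h.2‖ₑ * L)
    (hC : ∀ n, ∫⁻ h, ‖(fderiv ℝ (k n) h).comp (ContinuousLinearMap.inr ℝ ℝ (Sp N))‖ₑ * ‖h.2‖ₑ
      ≤ C) :
    Tendsto (fun n => ∫⁻ z in K, ‖commutator (k n) u W z‖ₑ) atTop (𝓝 0) := by
  set A : ℕ → ℝ≥0∞ := fun n => ⨆ h : ℝ × Sp N, ⨆ _ : ‖h‖ ≤ δ n,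
    eLpNorm (fun z => u (z - h) - u z) (ENNReal.ofReal r) volume
  have hA : Tendsto A atTop (𝓝 0) := by
    have ht := tendsto_eLpNorm_translation_sub (ofReal_one_le hrs.lt.le) ENNReal.ofReal_ne_top hu
    rw [ENNReal.tendsto_nhds_zero] at ht ⊢
    intro ε hε
    obtain ⟨η, hη, h⟩ := Metric.eventually_nhds_iff.1 (ht ε hε)
    filter_upwards [hδ.eventually (gt_mem_nhds hη)] with n hn
    exact iSup₂_le fun h' hh' => h (by simpa using hh'.trans_lt hn)
  have hlim : Tendsto (fun n => A n * L * C) atTop (𝓝 0) := by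
    simpa using ENNReal.Tendsto.mul_const (ENNReal.Tendsto.mul_const hA (Or.inr hLt)) (Or.inr hCt)
  refine tendsto_of_tendsto_of_tendsto_of_le_of_le tendsto_const_nhds hlim (fun _ => zero_le)
    fun n => ?_
  exact lintegral_commutator_le hrs (hk n) hu.1 hW
    (fun h hh => le_iSup₂ (f := fun (h : ℝ × Sp N) (_ : ‖h‖ ≤ δ n) =>
      eLpNorm (fun z => u (z - h) - u z) (ENNReal.ofReal r) volume) h hh) (hL n) (hC n)

/-- The divergence of the mollified stationary field is the mollified weak divergence. -/
theorem HasWeakDivergence.mollifyDiv_eq {r s : ℝ} (hrs : r.HolderConjugate s)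
    (hΩ : Bornology.IsBounded (Ω : Set (Sp N))) {V : Sp N → Sp N} {d : Sp N → ℝ}
    (hV : HasWeakDivergence Ω V d) (hVL : MemLp V (ENNReal.ofReal s) (volume.restrict Ω))
    (hdL : MemLp d ⊤ (volume.restrict (Ω : Set (Sp N)))) {k : ℝ × Sp N → ℝ} {δ : ℝ}
    (hk : IsKernel volume k δ) {z : ℝ × Sp N}
    (hz : Metric.closedBall z δ ⊆ (cylinder T Ω : Set (ℝ × Sp N))) :
    mollifyDiv k (fun z => (Ω : Set (Sp N)).indicator V z.2) z
      = mollify volume k ((cylinder T Ω : Set (ℝ × Sp N)).indicator fun z => d z.2) z := by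
  have hk1 : ContDiff ℝ 1 k := hk.contDiff.of_le (by simp)
  -- Reflecting the kernel about `z` changes the sign of its derivative, which cancels the sign in
  -- the definition of the weak divergence.
  let ζ := hk.testFunction z hz
  have hζ1 : ContDiff ℝ 1 ζ := ζ.contDiff.of_le (by simp)
  have key := hV.integral_fderiv_eq_neg hrs hΩ hVL hdL hζ1 ζ.hasCompactSupport ζ.tsupport_subset
  have hd : ∀ z' a, fderiv ℝ ζ z' a = - fderiv ℝ k (z - z') a := fun z' a => by
    have h1 : HasFDerivAt (fun y => k (z - y))
        ((fderiv ℝ k (z - z')).comp (-ContinuousLinearMap.id ℝ _)) z' :=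
      (hk1.differentiable one_ne_zero (z - z')).hasFDerivAt.comp z'
        ((hasFDerivAt_id z').const_sub z)
    have h2 : fderiv ℝ ζ z' = _ := h1.fderiv
    rw [h2]
    simp
  simp only [hd, integral_neg, neg_inj] at key
  have hQ := (cylinder T Ω).isOpen.measurableSet
  rw [← integral_indicator hQ, ← integral_indicator hQ] at key
  refine Eq.trans (integral_congr_ae (ae_of_all _ fun z' => ?_)) (key.trans
    (integral_congr_ae (ae_of_all _ fun z' => ?_)))
  · by_cases hz' : z' ∈ (cylinder T Ω : Set (ℝ × Sp N))
    · have hz2 : z'.2 ∈ (Ω : Set (Sp N)) := hz'.2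
      simp only [indicator_of_mem hz', indicator_of_mem hz2]
    · have : fderiv ℝ k (z - z') = 0 := by
        by_contra hne
        have := hk.tsupport_subset (support_fderiv_subset ℝ hne)
        rw [mem_closedBall_zero_iff, ← dist_eq_norm, dist_comm] at this
        exact hz' (hz this)
      simp [indicator_of_notMem hz', this]
  · simp only [indicator, smul_eq_mul]
    split_ifs
    · exact mul_comm _ _
    · simp

end Commutator

/-! ### Kernels that are products in time and space -/

section ProductKernel

variable {N : ℕ} {η : ℝ → ℝ} {ρ : Sp N → ℝ}

theorem fderiv_mul_apply (hη : Differentiable ℝ η) (hρ : Differentiable ℝ ρ) (z a : ℝ × Sp N) :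
    fderiv ℝ (fun z : ℝ × Sp N => η z.1 * ρ z.2) z a
      = deriv η z.1 * a.1 * ρ z.2 + η z.1 * fderiv ℝ ρ z.2 a.2 := by
  have h1 : HasFDerivAt (fun z : ℝ × Sp N => η z.1)
      ((fderiv ℝ η z.1).comp (ContinuousLinearMap.fst ℝ ℝ (Sp N))) z :=
    (hη z.1).hasFDerivAt.comp z hasFDerivAt_fst
  have h2 : HasFDerivAt (fun z : ℝ × Sp N => ρ z.2)
      ((fderiv ℝ ρ z.2).comp (ContinuousLinearMap.snd ℝ ℝ (Sp N))) z :=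
    (hρ z.2).hasFDerivAt.comp z hasFDerivAt_snd
  have h3 : HasFDerivAt (fun z : ℝ × Sp N => η z.1 * ρ z.2) _ z := h1.mul h2
  rw [h3.fderiv]
  simp only [add_apply, smul_apply,
    ContinuousLinearMap.comp_apply, ContinuousLinearMap.coe_fst', ContinuousLinearMap.coe_snd',
    smul_eq_mul, fderiv_eq_smul_deriv]
  ring

/-- The spatial derivative falls on `ρ` alone and `η` integrates to one, so the scale-invariant
bound for `ρ` is inherited. -/
theorem lintegral_fderiv_mul_le {δ C : ℝ} (hη : IsKernel volume η δ) (hρ : IsKernel volume ρ δ)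
    (hC : ∫ x, ‖fderiv ℝ ρ x‖ * ‖x‖ ≤ C) :
    ∫⁻ h : ℝ × Sp N, ‖(fderiv ℝ (fun z : ℝ × Sp N => η z.1 * ρ z.2) h).comp
      (ContinuousLinearMap.inr ℝ ℝ (Sp N))‖ₑ * ‖h.2‖ₑ ≤ ENNReal.ofReal C := by
  have hη1 : Differentiable ℝ η := hη.contDiff.differentiable (by simp)
  have hρ1 : Differentiable ℝ ρ := hρ.contDiff.differentiable (by simp)
  have hcρ : Continuous (fderiv ℝ ρ) := hρ.contDiff.continuous_fderiv (by simp)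
  have e : ∀ h : ℝ × Sp N, ‖(fderiv ℝ (fun z : ℝ × Sp N => η z.1 * ρ z.2) h).comp
      (ContinuousLinearMap.inr ℝ ℝ (Sp N))‖ₑ * ‖h.2‖ₑ
      = ENNReal.ofReal (η h.1) * ENNReal.ofReal (‖fderiv ℝ ρ h.2‖ * ‖h.2‖) := fun h => by
    have : (fderiv ℝ (fun z : ℝ × Sp N => η z.1 * ρ z.2) h).comp
        (ContinuousLinearMap.inr ℝ ℝ (Sp N)) = η h.1 • fderiv ℝ ρ h.2 := by
      ext a
      simp [fderiv_mul_apply hη1 hρ1]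
    rw [this, ← ofReal_norm, ← ofReal_norm, norm_smul, Real.norm_of_nonneg (hη.nonneg _),
      ← ENNReal.ofReal_mul (mul_nonneg (hη.nonneg _) (norm_nonneg _)), mul_assoc,
      ENNReal.ofReal_mul (hη.nonneg _)]
  simp only [e]
  rw [Measure.volume_eq_prod, lintegral_prod_mul (f := fun t => ENNReal.ofReal (η t))
    (g := fun x => ENNReal.ofReal (‖fderiv ℝ ρ x‖ * ‖x‖)), hη.lintegral_eq_one, one_mul,
    ← ofReal_integral_eq_lintegral_ofReal]
  · exact ENNReal.ofReal_le_ofReal hC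
  · exact (hcρ.norm.mul continuous_norm).integrable_of_hasCompactSupport
      (hρ.hasCompactSupport.fderiv ℝ).norm.mul_right
  · exact ae_of_all _ fun x => by positivity
  · exact hη.contDiff.continuous.measurable.ennreal_ofReal.aemeasurable
  · exact (hcρ.norm.mul continuous_norm).measurable.ennreal_ofReal.aemeasurable

/-- The product form is dictated by the weak formulation, which is tested only with $\xi(x)\psi(t)$:
a translated product kernel is such a test function. -/
theorem exists_product_kernel_seq (N : ℕ) {δ : ℝ} (hδ : 0 < δ) :
    ∃ (η : ℕ → ℝ → ℝ) (ρ : ℕ → Sp N → ℝ) (d : ℕ → ℝ) (C : ℝ≥0∞),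
      (∀ n, IsKernel volume (η n) (d n)) ∧ (∀ n, IsKernel volume (ρ n) (d n)) ∧
      Tendsto d atTop (𝓝 0) ∧ (∀ n, 0 < d n) ∧ (∀ n, d n ≤ δ) ∧ C ≠ ⊤ ∧
      ∀ n, ∫⁻ h : ℝ × Sp N, ‖(fderiv ℝ (fun z : ℝ × Sp N => η n z.1 * ρ n z.2) h).comp
        (ContinuousLinearMap.inr ℝ ℝ (Sp N))‖ₑ * ‖h.2‖ₑ ≤ C := by
  obtain ⟨C, h⟩ := exists_isKernel_fderiv_bound (volume : Measure (Sp N))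
  obtain ⟨η, d, hη, hd, hd0, hdδ⟩ := exists_isKernel_seq (volume : Measure ℝ) hδ
  choose ρ hρ using fun n => h _ (hd0 n)
  exact ⟨η, ρ, d, ENNReal.ofReal C, hη, fun n => (hρ n).1, hd, hd0, hdδ, ENNReal.ofReal_ne_top,
    fun n => lintegral_fderiv_mul_le (hη n) (hρ n).1 (hρ n).2⟩

theorem mollify_indicator (Q : Opens (ℝ × Sp N)) (g : ℝ × Sp N → ℝ) (z : ℝ × Sp N) :
    mollify volume (fun z : ℝ × Sp N => η z.1 * ρ z.2) ((Q : Set (ℝ × Sp N)).indicator g) z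
      = ∫ z' in (Q : Set (ℝ × Sp N)), g z' * ρ (z.2 - z'.2) * η (z.1 - z'.1) := by
  rw [← integral_indicator Q.isOpen.measurableSet]
  refine integral_congr_ae (ae_of_all _ fun z' => ?_)
  simp only [indicator, smul_eq_mul, Prod.fst_sub, Prod.snd_sub]
  split_ifs
  · ring
  · simp

theorem mollifyDiv_indicator (hη : Differentiable ℝ η) (hρ : Differentiable ℝ ρ)
    (Q : Opens (ℝ × Sp N)) (B : ℝ × Sp N → Sp N) (z : ℝ × Sp N) :
    mollifyDiv (fun z : ℝ × Sp N => η z.1 * ρ z.2) ((Q : Set (ℝ × Sp N)).indicator B) z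
      = - ∫ z' in (Q : Set (ℝ × Sp N)),
        inner ℝ (B z') (gradient (fun y => ρ (z.2 - y)) z'.2) * η (z.1 - z'.1) := by
  rw [← integral_indicator Q.isOpen.measurableSet, ← integral_neg]
  refine integral_congr_ae (ae_of_all _ fun z' => ?_)
  simp only [fderiv_mul_apply hη hρ, gradient_comp_sub_left hρ, inner_neg_right,
    inner_gradient_eq_fderiv, indicator, Prod.fst_sub, Prod.snd_sub]
  split_ifs
  · ring
  · simp

theorem fderiv_mollify_indicator {δ : ℝ} (hη : IsKernel volume η δ) (hρ : IsKernel volume ρ δ)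
    (Q : Opens (ℝ × Sp N)) {g : ℝ × Sp N → ℝ}
    (hg : LocallyIntegrable ((Q : Set (ℝ × Sp N)).indicator g)) (z : ℝ × Sp N) :
    fderiv ℝ (mollify volume (fun z : ℝ × Sp N => η z.1 * ρ z.2)
      ((Q : Set (ℝ × Sp N)).indicator g)) z (1, 0)
      = - ∫ z' in (Q : Set (ℝ × Sp N)),
        g z' * ρ (z.2 - z'.2) * deriv (fun s => η (z.1 - s)) z'.1 := by
  have hK : IsKernel volume (fun z : ℝ × Sp N => η z.1 * ρ z.2) δ := hη.prod hρ
  rw [fderiv_mollify hK.contDiff hK.hasCompactSupport hg,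
    ← integral_indicator Q.isOpen.measurableSet, ← integral_neg]
  refine integral_congr_ae (ae_of_all _ fun z' => ?_)
  simp only [fderiv_mul_apply (hη.contDiff.differentiable (by simp))
    (hρ.contDiff.differentiable (by simp)), indicator, Prod.fst_sub, Prod.snd_sub,
    deriv_comp_const_sub]
  split_ifs
  · simp only [mul_one, map_zero, mul_zero, add_zero, smul_eq_mul]
    ring
  · simp

theorem mollifyDiv_sub {k : ℝ × Sp N → ℝ} (hk : ContDiff ℝ 1 k) (hkc : HasCompactSupport k)
    {B B' : ℝ × Sp N → Sp N} (hB : LocallyIntegrable B) (hB' : LocallyIntegrable B')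
    (z : ℝ × Sp N) :
    mollifyDiv k (fun z => B z - B' z) z = mollifyDiv k B z - mollifyDiv k B' z := by
  rw [mollifyDiv, mollifyDiv, mollifyDiv, ← integral_sub (integrable_mollifyDiv hk hkc hB z)
    (integrable_mollifyDiv hk hkc hB' z)]
  refine integral_congr_ae (ae_of_all _ fun z' => ?_)
  simp only [← map_sub, Prod.mk_sub_mk, sub_zero]

theorem closedBall_subset_of_cylinder {T : ℝ} {Ω : Opens (Sp N)} {z : ℝ × Sp N} {δ : ℝ}
    (hδ : 0 ≤ δ) (hz : Metric.closedBall z δ ⊆ (cylinder T Ω : Set (ℝ × Sp N))) :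
    Metric.closedBall z.1 δ ⊆ Ioo 0 T ∧ Metric.closedBall z.2 δ ⊆ (Ω : Set (Sp N)) := by
  have h : Metric.closedBall z.1 δ ×ˢ Metric.closedBall z.2 δ
      ⊆ Ioo 0 T ×ˢ (Ω : Set (Sp N)) := by
    rw [closedBall_prod_same]
    exact hz
  exact ⟨fun t ht => (h (mk_mem_prod ht (Metric.mem_closedBall_self hδ))).1,
    fun x hx => (h (mk_mem_prod (Metric.mem_closedBall_self hδ) hx)).2⟩

end ProductKernel

/-! ### The equation and the Kato-type inequality after mollification -/

section MollifiedEquation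

variable {N : ℕ} {p T : ℝ} {Ω : Opens (Sp N)} {ΓD : Set (Sp N)} {V : Sp N → Sp N} {divV : Sp N → ℝ}
  {f : ℝ → Sp N → ℝ} {u₀ : Sp N → ℝ} {u v : ℝ → Sp N → ℝ} {Dv : ℝ → Sp N → Sp N}

/-- The equation satisfied by the mollification of `u`. -/
theorem IsWeakSolution.fderiv_mollify_eq (hp : 2 < p)
    (hΩ : Bornology.IsBounded (Ω : Set (Sp N)))
    (h : IsWeakSolution p T Ω ΓD V f u₀ u v Dv)
    (hV : MemW1Vec (ENNReal.ofReal (p / (p - 1))) Ω V)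
    (hf : IntegrableOn (fun z : ℝ × Sp N => f z.1 z.2) (cylinder T Ω : Set (ℝ × Sp N)))
    {η : ℝ → ℝ} {ρ : Sp N → ℝ} {δ : ℝ} (hη : IsKernel volume η δ) (hρ : IsKernel volume ρ δ)
    (hδ : 0 ≤ δ) {z : ℝ × Sp N}
    (hz : Metric.closedBall z δ ⊆ (cylinder T Ω : Set (ℝ × Sp N))) :
    fderiv ℝ (mollify volume (fun z : ℝ × Sp N => η z.1 * ρ z.2)
        ((cylinder T Ω : Set (ℝ × Sp N)).indicator fun z => u z.1 z.2)) z (1, 0)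
      = mollify volume (fun z : ℝ × Sp N => η z.1 * ρ z.2)
          ((cylinder T Ω : Set (ℝ × Sp N)).indicator fun z => f z.1 z.2) z
        + mollifyDiv (fun z : ℝ × Sp N => η z.1 * ρ z.2)
          ((cylinder T Ω : Set (ℝ × Sp N)).indicator fun z => pflux p (Dv z.1 z.2)) z
        - mollifyDiv (fun z : ℝ × Sp N => η z.1 * ρ z.2)
          ((cylinder T Ω : Set (ℝ × Sp N)).indicator fun z => u z.1 z.2 • V z.2) z := by
  have hfinQ := isFiniteMeasure_restrict_cylinder (T := T) hΩ
  have hpq := holderConjugate_div hp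
  have hs1 := ofReal_one_le hpq.symm.lt.le
  have hQ := (cylinder T Ω).isOpen.measurableSet
  obtain ⟨hz1, hz2⟩ := closedBall_subset_of_cylinder hδ hz
  have hK : IsKernel volume (fun z : ℝ × Sp N => η z.1 * ρ z.2) δ := hη.prod hρ
  have hη1 : Differentiable ℝ η := hη.contDiff.differentiable (by simp)
  have hρ1 : Differentiable ℝ ρ := hρ.contDiff.differentiable (by simp)
  let ξ : 𝓓(Ω, ℝ) := hρ.testFunction z.2 hz2
  let ψ : 𝓓((⟨Iio T, isOpen_Iio⟩ : Opens ℝ), ℝ) :=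
    hη.testFunction z.1 (hz1.trans fun t ht => ht.2)
  -- The time kernel lives inside $(0,T)$, so the initial datum drops out.
  have hψ0 : ψ 0 = 0 := by
    refine hη.eq_zero _ ?_
    by_contra hle
    have : (0 : ℝ) ∈ Metric.closedBall z.1 δ := by
      rw [Metric.mem_closedBall, dist_comm, dist_eq_norm]
      exact not_lt.1 hle
    exact lt_irrefl _ (hz1 this).1
  have hξ := (isCompactLimit_of_contDiff (Ω := Ω) (r := p) (by linarith)
    (ξ.contDiff.of_le (by simp)) ξ.hasCompactSupport ξ.tsupport_subset).memW1D (by linarith) ΓD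
  obtain ⟨C, hC⟩ := ξ.hasCompactSupport.exists_bound_of_continuous ξ.continuous
  have hfξ : IntegrableOn (fun z : ℝ × Sp N => f z.1 z.2 * ξ z.2 * ψ z.1)
      (cylinder T Ω : Set (ℝ × Sp N)) :=
    integrableOn_mul_continuous (hf.mul_bdd (c := C)
      (ξ.continuous.comp continuous_snd).aestronglyMeasurable (ae_of_all _ fun z => hC _))
      ψ.continuous ψ.hasCompactSupport
  have hwf := h.weak_form ξ _ hξ ψ hfξ
  simp only [hψ0, mul_zero, integral_zero, add_zero] at hwf
  have hP : Integrable ((cylinder T Ω : Set (ℝ × Sp N)).indicator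
      fun z => pflux p (Dv z.1 z.2)) :=
    (integrable_indicator_iff hQ).2 ((h.memLp_pflux hp).integrable hs1)
  have huV : Integrable ((cylinder T Ω : Set (ℝ × Sp N)).indicator
      fun z => u z.1 z.2 • V z.2) :=
    (integrable_indicator_iff hQ).2 ((h.memLp_smul (memLp_snd hV.memLp)).integrable hs1)
  have hu : Integrable ((cylinder T Ω : Set (ℝ × Sp N)).indicator fun z => u z.1 z.2) :=
    (integrable_indicator_iff hQ).2 (h.u_bdd.integrable le_top)
  have e := mollifyDiv_sub (hK.contDiff.of_le (by simp)) hK.hasCompactSupport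
    hP.locallyIntegrable huV.locallyIntegrable z
  rw [show (fun z => (cylinder T Ω : Set (ℝ × Sp N)).indicator
      (fun z => pflux p (Dv z.1 z.2)) z - (cylinder T Ω : Set (ℝ × Sp N)).indicator
      (fun z => u z.1 z.2 • V z.2) z) = _ from (indicator_sub _ _ _).symm] at e
  rw [add_sub_assoc, ← e, fderiv_mollify_indicator hη hρ _ hu.locallyIntegrable,
    mollify_indicator, mollifyDiv_indicator hη1 hρ1, ← sub_eq_add_neg]
  exact eq_sub_of_add_eq hwf

/-- The inequality `-Δ_p v ≤ 1_{v > 0} (f - ∇ · V)`, mollified. -/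
theorem IsWeakSolution.mollifyDiv_pflux_nonneg (hp : 2 < p)
    (hΩ : Bornology.IsBounded (Ω : Set (Sp N)))
    (h : IsWeakSolution p T Ω ΓD V f u₀ u v Dv)
    (hV : MemW1Vec (ENNReal.ofReal (p / (p - 1))) Ω V)
    (hdivV : HasWeakDivergence Ω V divV)
    (hdivV_bdd : MemLp divV ⊤ (volume.restrict (Ω : Set (Sp N))))
    (hf : IntegrableOn (fun z : ℝ × Sp N => f z.1 z.2) (cylinder T Ω : Set (ℝ × Sp N)))
    {η : ℝ → ℝ} {ρ : Sp N → ℝ} {δ : ℝ} (hη : IsKernel volume η δ) (hρ : IsKernel volume ρ δ)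
    (hδ : 0 ≤ δ) {z : ℝ × Sp N}
    (hz : Metric.closedBall z δ ⊆ (cylinder T Ω : Set (ℝ × Sp N))) :
    0 ≤ mollifyDiv (fun z : ℝ × Sp N => η z.1 * ρ z.2)
          ((cylinder T Ω : Set (ℝ × Sp N)).indicator fun z => pflux p (Dv z.1 z.2)) z
        + mollify volume (fun z : ℝ × Sp N => η z.1 * ρ z.2)
          ((cylinder T Ω : Set (ℝ × Sp N)).indicator fun z =>
            (Ioi (0 : ℝ)).indicator (fun _ => 1) (v z.1 z.2) * (f z.1 z.2 - divV z.2)) z := by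
  obtain ⟨hz1, hz2⟩ := closedBall_subset_of_cylinder hδ hz
  have key := h.integral_pflux_le hp hΩ hV hdivV hdivV_bdd hf
    (hρ.testFunction z.2 hz2) (fun x => hρ.nonneg _) (hη.testFunction z.1 hz1) fun t => hη.nonneg _
  rw [mollify_indicator, mollifyDiv_indicator (hη.contDiff.differentiable (by simp))
    (hρ.contDiff.differentiable (by simp)), neg_add_eq_sub, sub_nonneg]
  refine key.trans_eq (integral_congr_ae (ae_of_all _ fun z' => ?_))
  show _ * (_ * ρ (z.2 - z'.2) * η (z.1 - z'.1)) = _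
  ring

end MollifiedEquation

/-! ### Limit of the transport term -/

section Transport

variable {N : ℕ} {T : ℝ} {Ω : Opens (Sp N)}

/-- An average against a probability density stays in the interval. This matters because `β` and its
derivative are only bounded on compact sets. -/
theorem IsKernel.mollify_mem_Icc {k u : ℝ × Sp N → ℝ} {δ : ℝ} (hk : IsKernel volume k δ)
    (hu : LocallyIntegrable u) (hu01 : ∀ᵐ z, u z ∈ Icc (0 : ℝ) 1) (z : ℝ × Sp N) :
    mollify volume k u z ∈ Icc (0 : ℝ) 1 := by
  have hi := integrable_kernel_smul hk.contDiff.continuous hk.hasCompactSupport hu z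
  refine ⟨integral_nonneg_of_ae ?_, ?_⟩
  · filter_upwards [hu01] with z' hz'
    exact mul_nonneg (hk.nonneg _) hz'.1
  · have h1 : ∫ z', k (z - z') = 1 := by
      rw [integral_sub_left_eq_self k volume z, hk.integral_eq_one]
    rw [← h1]
    refine integral_mono_ae hi (hk.integrable.comp_sub_left z) ?_
    filter_upwards [hu01] with z' hz'
    exact mul_le_of_le_one_right (hk.nonneg _) hz'.2

theorem exists_bound_Icc {β : ℝ → ℝ} (hβ : Continuous β) :
    ∃ M, ∀ r ∈ Icc (0 : ℝ) 1, ‖β r‖ ≤ M :=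
  isCompact_Icc.exists_bound_of_continuousOn hβ.continuousOn

theorem setIntegral_eq_integral_of_tsupport_subset {Q : Opens (ℝ × Sp N)} {φ : ℝ × Sp N → ℝ}
    (hφ : tsupport φ ⊆ Q) {F : ℝ × Sp N → ℝ} (hF : ∀ z ∉ tsupport φ, F z = 0) :
    ∫ z in (Q : Set (ℝ × Sp N)), F z = ∫ z, F z :=
  setIntegral_eq_integral_of_forall_compl_eq_zero fun z hz => hF z fun h => hz (hφ h)

theorem fderiv_eq_zero_of_notMem_tsupport {φ : ℝ × Sp N → ℝ} {z : ℝ × Sp N}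
    (hz : z ∉ tsupport φ) : fderiv ℝ φ z = 0 := by
  by_contra h
  exact hz (support_fderiv_subset ℝ h)

theorem MemW1Vec.exists_eLpNorm_translation_sub_le_of_isCompact {r : ℝ} (hr : 1 ≤ r)
    {V : Sp N → Sp N} (hV : MemW1Vec (ENNReal.ofReal r) Ω V) {K : Set (ℝ × Sp N)}
    (hK : IsCompact K) {δ : ℝ} (hδ : 0 < δ)
    (hKQ : ∀ z ∈ K, Metric.closedBall z (2 * δ) ⊆ (cylinder T Ω : Set (ℝ × Sp N))) :
    ∃ L : ℝ≥0∞, L ≠ ⊤ ∧ ∀ h : ℝ × Sp N, ‖h‖ ≤ δ →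
      eLpNorm (fun z : ℝ × Sp N => (Ω : Set (Sp N)).indicator V (z - h).2
        - (Ω : Set (Sp N)).indicator V z.2) (ENNReal.ofReal r) (volume.restrict K)
        ≤ ‖h.2‖ₑ * L := by
  obtain ⟨L, hL, h⟩ := hV.exists_eLpNorm_translation_sub_le hr
  have hVL := memLp_indicator hV.memLp
  have hsub : ∀ z ∈ K, Metric.closedBall z.1 (2 * δ) ⊆ Ioo 0 T ∧
      Metric.closedBall z.2 (2 * δ) ⊆ (Ω : Set (Sp N)) := fun z hz =>
    closedBall_subset_of_cylinder (by positivity) (hKQ z hz)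
  refine ⟨ENNReal.ofReal T ^ (1 / ENNReal.ofReal r).toReal * L,
    ENNReal.mul_ne_top (ENNReal.rpow_ne_top_of_nonneg ENNReal.toReal_nonneg ENNReal.ofReal_ne_top)
      hL, fun y hy => ?_⟩
  have hK' : IsCompact (Prod.snd '' K) := hK.image continuous_snd
  refine (eLpNorm_snd_le (T := T) ENNReal.ofReal_ne_top (K' := Prod.snd '' K)
    (g := fun x => (Ω : Set (Sp N)).indicator V (x - y.2) - (Ω : Set (Sp N)).indicator V x)
    (fun z hz => ⟨(hsub z hz).1 (Metric.mem_closedBall_self (by positivity)), z, hz, rfl⟩)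
    ((hVL.1.comp_measurePreserving (measurePreserving_sub_right volume y.2)).sub
      hVL.1).restrict).trans ?_
  rw [mul_left_comm]
  gcongr
  refine h hK'.isClosed.measurableSet hδ ?_ ((norm_snd_le y).trans hy)
  rintro _ ⟨z, hz, rfl⟩
  exact (hsub z hz).2

/-- The limit of the transport term in the equation satisfied by a nonlinear function of the
mollified solution. -/
theorem tendsto_integral_transport {r s : ℝ} (hrs : r.HolderConjugate s)
    (hΩ : Bornology.IsBounded (Ω : Set (Sp N))) {V : Sp N → Sp N} {d : Sp N → ℝ}
    (hV : MemW1Vec (ENNReal.ofReal s) Ω V) (hd : HasWeakDivergence Ω V d)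
    (hdL : MemLp d ⊤ (volume.restrict (Ω : Set (Sp N)))) {k : ℕ → ℝ × Sp N → ℝ} {δ : ℕ → ℝ}
    (hk : ∀ n, IsKernel volume (k n) (δ n)) (hδ : Tendsto δ atTop (𝓝 0)) {δ₀ : ℝ} (hδ₀ : 0 < δ₀)
    (hδδ₀ : ∀ n, δ n ≤ δ₀) {C : ℝ≥0∞} (hCt : C ≠ ⊤)
    (hC : ∀ n, ∫⁻ h, ‖(fderiv ℝ (k n) h).comp (ContinuousLinearMap.inr ℝ ℝ (Sp N))‖ₑ * ‖h.2‖ₑ ≤ C)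
    (φ : 𝓓(cylinder T Ω, ℝ)) (hφ : ∀ z ∈ tsupport φ,
      Metric.closedBall z (2 * δ₀) ⊆ (cylinder T Ω : Set (ℝ × Sp N)))
    {u : ℝ × Sp N → ℝ} (hu : MemLp u (ENNReal.ofReal r)) (hu01 : ∀ᵐ z, u z ∈ Icc (0 : ℝ) 1)
    (hu0 : ∀ z ∉ (cylinder T Ω : Set (ℝ × Sp N)), u z = 0)
    (hlim : ∀ᵐ z, Tendsto (fun n => mollify volume (k n) u z) atTop (𝓝 (u z)))
    {β : ℝ → ℝ} (hβ : ContDiff ℝ 1 β) :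
    Tendsto (fun n => ∫ z, φ z * deriv β (mollify volume (k n) u z)
        * mollifyDiv (k n) ((cylinder T Ω : Set (ℝ × Sp N)).indicator fun z => u z • V z.2) z) atTop
      (𝓝 (-(∫ z in (cylinder T Ω : Set (ℝ × Sp N)), d z.2 * (φ z * β (u z)))
        - (∫ z in (cylinder T Ω : Set (ℝ × Sp N)), β (u z) * fderiv ℝ φ z (0, V z.2))
        + ∫ z in (cylinder T Ω : Set (ℝ × Sp N)), φ z * deriv β (u z) * u z * d z.2)) := by
  have hfinQ := isFiniteMeasure_restrict_cylinder (T := T) hΩ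
  have hs1 := ofReal_one_le hrs.symm.lt.le
  have hQ := (cylinder T Ω).isOpen.measurableSet
  set Q : Set (ℝ × Sp N) := (cylinder T Ω : Set (ℝ × Sp N))
  -- `W` is cut off in space but constant in time, so its increments involve the spatial shift only;
  -- `Wq` is cut off in both, hence integrable. They agree on the cylinder.
  set W : ℝ × Sp N → Sp N := fun z => (Ω : Set (Sp N)).indicator V z.2
  set U : ℕ → ℝ × Sp N → ℝ := fun n => mollify volume (k n) u
  set D : ℝ × Sp N → ℝ := Q.indicator fun z => d z.2
  set Wq : ℝ × Sp N → Sp N := Q.indicator fun z => V z.2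
  have hfin := isFiniteMeasure_restrict hΩ
  have hul : LocallyIntegrable u := hu.locallyIntegrable (ofReal_one_le hrs.lt.le)
  have hVq : IntegrableOn (fun z : ℝ × Sp N => V z.2) Q := (memLp_snd hV.memLp).integrable hs1
  have hdq : IntegrableOn (fun z : ℝ × Sp N => d z.2) Q := (memLp_snd hdL).integrable le_top
  have hD : Integrable D := (integrable_indicator_iff hQ).2 hdq
  have hWq : Integrable Wq := (integrable_indicator_iff hQ).2 hVq
  have hWl : LocallyIntegrable W := locallyIntegrable_snd
    ((integrable_indicator_iff Ω.isOpen.measurableSet).2 (hV.memLp.integrable hs1))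
  have hWQ : ∀ z ∈ Q, W z = V z.2 := fun z hz => indicator_of_mem (s := (Ω : Set (Sp N))) hz.2 V
  have hWqQ : ∀ z ∈ Q, Wq z = V z.2 := fun z hz => indicator_of_mem hz _
  have hDQ : ∀ z ∈ Q, D z = d z.2 := fun z hz => indicator_of_mem hz _
  have huW : (Q.indicator fun z => u z • V z.2) = fun z => u z • W z := by
    funext z
    by_cases hz : z ∈ Q
    · rw [indicator_of_mem hz, hWQ z hz]
    · rw [indicator_of_notMem hz, hu0 z hz, zero_smul]
  have huWi : Integrable fun z => u z • W z := by
    rw [← huW, integrable_indicator_iff hQ]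
    refine hVq.norm.mono' (hul.aestronglyMeasurable.restrict.smul hVq.1) ?_
    filter_upwards [ae_restrict_of_ae hu01] with z hz
    rw [norm_smul, Real.norm_of_nonneg hz.1]
    exact mul_le_of_le_one_left (norm_nonneg _) hz.2
  obtain ⟨M₀, hM₀⟩ := exists_bound_Icc hβ.continuous
  have hβ' : Continuous (deriv β) := hβ.continuous_deriv le_rfl
  obtain ⟨M₁, hM₁⟩ := exists_bound_Icc hβ'
  obtain ⟨Cφ, hCφ⟩ := φ.hasCompactSupport.exists_bound_of_continuous φ.continuous
  have hCφ0 : 0 ≤ Cφ := (norm_nonneg _).trans (hCφ 0)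
  have hM₁0 : 0 ≤ M₁ := (norm_nonneg _).trans (hM₁ 0 (by simp))
  have hφ1 : ContDiff ℝ 1 φ := φ.contDiff.of_le (by simp)
  have hUs : ∀ n, ContDiff ℝ 1 (U n) := fun n =>
    (contDiff_mollify (hk n).contDiff (hk n).hasCompactSupport hul).of_le (by simp)
  have hU01 : ∀ n z, U n z ∈ Icc (0 : ℝ) 1 := fun n => (hk n).mollify_mem_Icc hul hu01
  have hφ0 : ∀ z ∉ tsupport φ, φ z = 0 := fun z hz => image_eq_zero_of_notMem_tsupport hz
  have hφQ : ∀ z ∈ tsupport φ, z ∈ Q := fun z hz => φ.tsupport_subset hz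
  set b : ℕ → ℝ × Sp N → ℝ := fun n z => φ z * deriv β (U n z)
  have hbc : ∀ n, Continuous (b n) := fun n =>
    φ.continuous.mul (hβ'.comp (hUs n).continuous)
  have hbs : ∀ n, HasCompactSupport (b n) := fun n => φ.hasCompactSupport.mul_right
  have hbM : ∀ n z, ‖b n z‖ ≤ Cφ * M₁ := fun n z => by
    rw [norm_mul]
    exact mul_le_mul (hCφ z) (hM₁ _ (hU01 n z)) (norm_nonneg _) hCφ0
  have hblim : ∀ᵐ z, Tendsto (fun n => b n z) atTop (𝓝 (φ z * deriv β (u z))) := by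
    filter_upwards [hlim] with z hz
    exact ((hβ'.tendsto _).comp hz).const_mul _
  have hb0 : ∀ n, ∀ z ∉ tsupport φ, b n z = 0 := fun n z hz => by simp [b, hφ0 z hz]
  -- the commutator
  obtain ⟨L, hLt, hL⟩ := hV.exists_eLpNorm_translation_sub_le_of_isCompact hrs.symm.lt.le
    φ.hasCompactSupport.isCompact hδ₀ hφ
  have hcomm := tendsto_lintegral_commutator hrs hk hδ hu hWl.aestronglyMeasurable
    (K := tsupport φ) hLt hCt (fun n h hh => hL h (hh.trans (hδδ₀ n))) hC
  -- decomposition of the integrand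
  have hdec : ∀ n z, b n z * mollifyDiv (k n) (fun z => u z • W z) z
      = (fderiv ℝ (fun z => φ z * β (U n z)) z (0, Wq z)
        - β (U n z) * fderiv ℝ φ z (0, Wq z))
        + b n z * u z * mollify volume (k n) D z + b n z * commutator (k n) u W z := fun n z => by
    -- This rewrites $\varphi\beta'(U_n)\,V\cdot\nabla U_n$ as $V\cdot\nabla(\varphi\beta(U_n)) -
    -- \beta(U_n)\,V\cdot\nabla\varphi$; the first term can then be handed to the weak divergence of
    -- `V`.
    have hfd : fderiv ℝ (fun z => φ z * β (U n z)) z (0, Wq z)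
        = b n z * fderiv ℝ (U n) z (0, Wq z) + β (U n z) * fderiv ℝ φ z (0, Wq z) := by
      have h1 := (hφ1.differentiable one_ne_zero z).hasFDerivAt
      have h2 : HasFDerivAt (fun z => β (U n z)) _ z :=
        ((hβ.differentiable one_ne_zero (U n z)).hasDerivAt).comp_hasFDerivAt z
          ((hUs n).differentiable one_ne_zero z).hasFDerivAt
      have h3 : HasFDerivAt (fun z => φ z * β (U n z)) _ z := h1.mul h2
      rw [h3.fderiv]
      simp only [add_apply, smul_apply, smul_eq_mul, b]
      ring
    rw [hfd]
    by_cases hz : z ∈ tsupport φ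
    · have e1 := commutator_eq (hk n).contDiff (hk n).hasCompactSupport hul hWl
        huWi.locallyIntegrable z
      have e2 : mollifyDiv (k n) W z = mollify volume (k n) D z :=
        hd.mollifyDiv_eq hrs hΩ hV.memLp hdL (hk n)
          ((Metric.closedBall_subset_closedBall (by linarith [hδδ₀ n])).trans (hφ z hz))
      rw [e1, e2, hWQ z (hφQ z hz), hWqQ z (hφQ z hz)]
      ring
    · rw [hb0 n z hz]
      ring
  have hζ1 : ∀ n, ContDiff ℝ 1 fun z => φ z * β (U n z) := fun n =>
    hφ1.mul (hβ.comp (hUs n))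
  have hζc : ∀ n, HasCompactSupport fun z => φ z * β (U n z) := fun n =>
    φ.hasCompactSupport.mul_right
  have i1 : ∀ n, Integrable fun z => fderiv ℝ (fun z => φ z * β (U n z)) z (0, Wq z) := fun n =>
    integrable_fderiv_apply (hζ1 n) (hζc n) hWq
  have i2' : Integrable fun z => fderiv ℝ φ z (0, Wq z) :=
    integrable_fderiv_apply hφ1 φ.hasCompactSupport hWq
  have hβU : ∀ n, AEStronglyMeasurable (fun z => β (U n z)) volume := fun n =>
    (hβ.continuous.comp (hUs n).continuous).aestronglyMeasurable
  have i2 : ∀ n, Integrable fun z => β (U n z) * fderiv ℝ φ z (0, Wq z) := fun n =>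
    i2'.bdd_mul (c := M₀) (hβU n) (ae_of_all _ fun z => hM₀ _ (hU01 n z))
  have hbu : ∀ n, ∀ᵐ z, ‖b n z * u z‖ ≤ Cφ * M₁ := fun n => by
    filter_upwards [hu01] with z hz
    rw [norm_mul, Real.norm_of_nonneg hz.1]
    exact (mul_le_of_le_one_right (norm_nonneg _) hz.2).trans (hbM n z)
  have hbum : ∀ n, AEStronglyMeasurable (fun z => b n z * u z) volume := fun n =>
    (hbc n).aestronglyMeasurable.mul hul.aestronglyMeasurable
  have hmD : ∀ n, Integrable (mollify volume (k n) D) := fun n => (hk n).integrable_mollify hD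
  have i3 : ∀ n, Integrable fun z => b n z * u z * mollify volume (k n) D z := fun n =>
    (hmD n).bdd_mul (c := Cφ * M₁) (hbum n) (hbu n)
  have i0 : ∀ n, Integrable fun z => b n z * mollifyDiv (k n) (fun z => u z • W z) z := fun n =>
    ((hbc n).mul (continuous_mollifyDiv (hk n).contDiff (hk n).hasCompactSupport
      huWi.locallyIntegrable)).integrable_of_hasCompactSupport (hbs n).mul_right
  have i4 : ∀ n, Integrable fun z => b n z * commutator (k n) u W z := fun n => by
    refine ((i0 n).sub (((i1 n).sub (i2 n)).add (i3 n))).congr (ae_of_all _ fun z => ?_)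
    simp only [Pi.sub_apply, Pi.add_apply, hdec n z]
    ring
  have hint : ∀ n, ∫ z, b n z * mollifyDiv (k n) (fun z => u z • W z) z
      = -(∫ z, β (U n z) * (φ z * D z)) - (∫ z, β (U n z) * fderiv ℝ φ z (0, Wq z))
        + (∫ z, b n z * u z * mollify volume (k n) D z)
        + ∫ z, b n z * commutator (k n) u W z := fun n => by
    have e1 := integral_sub (i1 n) (i2 n)
    have e2 := integral_add ((i1 n).sub (i2 n)) (i3 n)
    have e3 := integral_add (((i1 n).sub (i2 n)).add (i3 n)) (i4 n)
    simp only [Pi.sub_apply, Pi.add_apply] at e2 e3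
    have hts : tsupport (fun z => φ z * β (U n z)) ⊆ tsupport φ := tsupport_mul_subset_left
    have e4 := hd.integral_fderiv_eq_neg (T := T) hrs hΩ hV.memLp hdL (hζ1 n) (hζc n)
      (hts.trans φ.tsupport_subset)
    have e5 : ∫ z, fderiv ℝ (fun z => φ z * β (U n z)) z (0, Wq z)
        = ∫ z in Q, fderiv ℝ (fun z => φ z * β (U n z)) z (0, V z.2) := by
      rw [← setIntegral_eq_integral_of_tsupport_subset φ.tsupport_subset fun z hz => ?_]
      · exact setIntegral_congr_fun hQ fun z hz => by rw [hWqQ z hz]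
      · rw [fderiv_eq_zero_of_notMem_tsupport fun h => hz (hts h)]
        rfl
    have e6 : ∫ z, β (U n z) * (φ z * D z) = ∫ z in Q, d z.2 * (φ z * β (U n z)) := by
      rw [← setIntegral_eq_integral_of_tsupport_subset φ.tsupport_subset fun z hz => ?_]
      · exact setIntegral_congr_fun hQ fun z hz => by
          simp only [hDQ z hz]
          ring
      · rw [hφ0 z hz, zero_mul, mul_zero]
    rw [integral_congr_ae (ae_of_all _ (hdec n)), e3, e2, e1, e5, e4, e6]
  -- the limits
  have l1 : Tendsto (fun n => ∫ z, β (U n z) * (φ z * D z)) atTop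
      (𝓝 (∫ z, β (u z) * (φ z * D z))) := by
    have hg : Integrable fun z => φ z * D z :=
      hD.bdd_mul (c := Cφ) φ.continuous.aestronglyMeasurable (ae_of_all _ hCφ)
    refine tendsto_integral_mul_of_bounded hβU (fun n => ae_of_all _ fun z => hM₀ _ (hU01 n z))
      ?_ (fun _ => hg) hg (by simp)
    filter_upwards [hlim] with z hz using (hβ.continuous.tendsto _).comp hz
  have l2 : Tendsto (fun n => ∫ z, β (U n z) * fderiv ℝ φ z (0, Wq z)) atTop
      (𝓝 (∫ z, β (u z) * fderiv ℝ φ z (0, Wq z))) := by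
    refine tendsto_integral_mul_of_bounded hβU (fun n => ae_of_all _ fun z => hM₀ _ (hU01 n z))
      ?_ (fun _ => i2') i2' (by simp)
    filter_upwards [hlim] with z hz using (hβ.continuous.tendsto _).comp hz
  have l3 : Tendsto (fun n => ∫ z, b n z * u z * mollify volume (k n) D z) atTop
      (𝓝 (∫ z, φ z * deriv β (u z) * u z * D z)) := by
    refine tendsto_integral_mul_of_bounded hbum hbu ?_ hmD hD
      (tendsto_integral_mollify_sub hk hδ hD)
    filter_upwards [hblim] with z hz using hz.mul_const _
  -- The factor `b n` is uniformly bounded and supported in the support of `φ`, the set on which the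
  -- commutator tends to zero in $L^1$.
  have l4 : Tendsto (fun n => ∫ z, b n z * commutator (k n) u W z) atTop (𝓝 0) := by
    have h0 : Tendsto (fun n => ENNReal.ofReal (Cφ * M₁)
        * ∫⁻ z in tsupport φ, ‖commutator (k n) u W z‖ₑ) atTop (𝓝 0) := by
      simpa using ENNReal.Tendsto.const_mul hcomm (Or.inr ENNReal.ofReal_ne_top)
    have := tendsto_integral_of_L1 (μ := volume) (fun _ : ℝ × Sp N => (0 : ℝ))
      aestronglyMeasurable_const
      (F := fun n z => b n z * commutator (k n) u W z) (l := atTop)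
      (Eventually.of_forall i4) ?_
    · simpa using this
    refine tendsto_of_tendsto_of_tendsto_of_le_of_le tendsto_const_nhds h0 (fun _ => zero_le)
      fun n => ?_
    rw [← lintegral_const_mul' _ _ ENNReal.ofReal_ne_top,
      ← lintegral_indicator (isClosed_tsupport φ).measurableSet]
    refine lintegral_mono fun z => ?_
    by_cases hz : z ∈ tsupport φ
    · rw [indicator_of_mem hz, sub_zero, enorm_mul]
      gcongr
      rw [← ofReal_norm]
      exact ENNReal.ofReal_le_ofReal (hbM n z)
    · simp [hb0 n z hz]
  have hfinal := ((l1.neg.sub l2).add l3).add l4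
  rw [huW]
  simp only [← hint, add_zero] at hfinal
  have toQ : ∀ {F G : ℝ × Sp N → ℝ}, (∀ z ∉ tsupport φ, G z = 0) → (∀ z ∈ Q, F z = G z) →
      ∫ z in Q, F z = ∫ z, G z := fun hG hFG =>
    (setIntegral_congr_fun hQ hFG).trans
      (setIntegral_eq_integral_of_tsupport_subset φ.tsupport_subset hG)
  rw [toQ (G := fun z => β (u z) * (φ z * D z)) (fun z hz => by rw [hφ0 z hz]; ring)
      fun z hz => by simp only [hDQ z hz]; ring,
    toQ (G := fun z => β (u z) * fderiv ℝ φ z (0, Wq z))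
      (fun z hz => by rw [fderiv_eq_zero_of_notMem_tsupport hz]; exact mul_zero _)
      fun z hz => by simp only [hWqQ z hz],
    toQ (G := fun z => φ z * deriv β (u z) * u z * D z) (fun z hz => by rw [hφ0 z hz]; ring)
      fun z hz => by simp only [hDQ z hz]]
  exact hfinal

end Transport

/-! ### The renormalized inequality -/

section Renormalization

variable {N : ℕ} {p T : ℝ} {Ω : Opens (Sp N)} {ΓD : Set (Sp N)} {V : Sp N → Sp N} {divV : Sp N → ℝ}
  {f : ℝ → Sp N → ℝ} {u₀ : Sp N → ℝ} {u v : ℝ → Sp N → ℝ} {Dv : ℝ → Sp N → Sp N}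

/-- Almost everywhere convergence, rather than $L^1$ convergence, is what passes through the
nonlinear functions `β` and `deriv β`. -/
theorem exists_subseq_mollify_ae_tendsto {k : ℕ → ℝ × Sp N → ℝ} {δ : ℕ → ℝ}
    (hk : ∀ n, IsKernel volume (k n) (δ n)) (hδ : Tendsto δ atTop (𝓝 0)) {g : ℝ × Sp N → ℝ}
    (hg : Integrable g) : ∃ ns : ℕ → ℕ, StrictMono ns ∧
      ∀ᵐ z, Tendsto (fun n => mollify volume (k (ns n)) g z) atTop (𝓝 (g z)) := by
  have h1 : Tendsto (fun n => eLpNorm (mollify volume (k n) g - g) 1 volume) atTop (𝓝 0) := by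
    simp only [eLpNorm_one_eq_lintegral_enorm]
    exact tendsto_integral_mollify_sub hk hδ hg
  exact (tendstoInMeasure_of_tendsto_eLpNorm one_ne_zero
    (fun n => ((hk n).integrable_mollify hg).1) hg.1 h1).exists_seq_tendsto_ae

/-- The mollified equation is multiplied by $\varphi\beta'(U_n)$ and the Kato-type inequality
handles the $p$-Laplacian before the limit, when all terms are still continuous functions and can be
compared pointwise. -/
theorem IsWeakSolution.renormalized_le (hp : 2 < p)
    (hΩ : Bornology.IsBounded (Ω : Set (Sp N)))
    (h : IsWeakSolution p T Ω ΓD V f u₀ u v Dv)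
    (hV : MemW1Vec (ENNReal.ofReal (p / (p - 1))) Ω V)
    (hdivV : HasWeakDivergence Ω V divV)
    (hdivV_bdd : MemLp divV ⊤ (volume.restrict (Ω : Set (Sp N))))
    (hf : IntegrableOn (fun z : ℝ × Sp N => f z.1 z.2) (cylinder T Ω : Set (ℝ × Sp N)))
    {β : ℝ → ℝ} (hβ : ContDiff ℝ 1 β) (hβ_le : ∀ r, deriv β r ≤ 1) (hβ_one : deriv β 1 = 1)
    (φ : 𝓓(cylinder T Ω, ℝ)) (hφ : ∀ z, 0 ≤ φ z) :
    -(∫ z in (cylinder T Ω : Set (ℝ × Sp N)), β (u z.1 z.2) * fderiv ℝ φ z (1, 0))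
      ≤ -(∫ z in (cylinder T Ω : Set (ℝ × Sp N)), fderiv ℝ φ z (0, pflux p (Dv z.1 z.2)))
        + (∫ z in (cylinder T Ω : Set (ℝ × Sp N)), f z.1 z.2 * deriv β (u z.1 z.2) * φ z)
        + (∫ z in (cylinder T Ω : Set (ℝ × Sp N)), divV z.2 * (φ z * β (u z.1 z.2)))
        + (∫ z in (cylinder T Ω : Set (ℝ × Sp N)), β (u z.1 z.2) * fderiv ℝ φ z (0, V z.2))
        - ∫ z in (cylinder T Ω : Set (ℝ × Sp N)),
          φ z * deriv β (u z.1 z.2) * u z.1 z.2 * divV z.2 := by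
  have hfinQ := isFiniteMeasure_restrict_cylinder (T := T) hΩ
  have hpq := holderConjugate_div hp
  have hQ := (cylinder T Ω).isOpen.measurableSet
  have hs1 := ofReal_one_le hpq.symm.lt.le
  set Q : Set (ℝ × Sp N) := (cylinder T Ω : Set (ℝ × Sp N)) with hQdef
  set w : ℝ × Sp N → ℝ := Q.indicator fun z => u z.1 z.2
  set P : ℝ × Sp N → Sp N := Q.indicator fun z => pflux p (Dv z.1 z.2)
  set F : ℝ × Sp N → ℝ := Q.indicator fun z => f z.1 z.2
  set G : ℝ × Sp N → ℝ := Q.indicator fun z =>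
    (Ioi (0 : ℝ)).indicator (fun _ => 1) (v z.1 z.2) * (f z.1 z.2 - divV z.2)
  have hdq : IntegrableOn (fun z : ℝ × Sp N => divV z.2) Q := (memLp_snd hdivV_bdd).integrable le_top
  have hwQ : ∀ z ∈ Q, w z = u z.1 z.2 := fun z hz => indicator_of_mem hz _
  have hPQ : ∀ z ∈ Q, P z = pflux p (Dv z.1 z.2) := fun z hz => indicator_of_mem hz _
  have hFQ : ∀ z ∈ Q, F z = f z.1 z.2 := fun z hz => indicator_of_mem hz _
  have hw0 : ∀ z ∉ Q, w z = 0 := fun z hz => indicator_of_notMem hz _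
  have hF : Integrable F := (integrable_indicator_iff hQ).2 hf
  have hP : Integrable P := (integrable_indicator_iff hQ).2 ((h.memLp_pflux hp).integrable hs1)
  have hG : Integrable G := by
    have hm : Measurable ((Ioi (0 : ℝ)).indicator fun _ => (1 : ℝ)) :=
      measurable_const.indicator measurableSet_Ioi
    refine (integrable_indicator_iff hQ).2 ((hf.sub hdq).bdd_mul (c := 1)
      (hm.comp_aemeasurable h.v_memLp.1.aemeasurable).aestronglyMeasurable
      (ae_of_all _ fun z => ?_))
    simp only [indicator]
    split_ifs <;> simp
  have hw : Integrable w := (integrable_indicator_iff hQ).2 (h.u_bdd.integrable le_top)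
  -- Boundedness of `u` on a set of finite measure gives the exponent dual to that of `V` in the
  -- commutator estimate.
  have hwL : MemLp w (ENNReal.ofReal p) :=
    (memLp_indicator_iff_restrict hQ).2 (h.u_bdd.mono_exponent le_top)
  have hw01 : ∀ᵐ z, w z ∈ Icc (0 : ℝ) 1 := by
    filter_upwards [(ae_restrict_iff' hQ).1 h.ae_mem_Icc] with z hz
    by_cases hzQ : z ∈ Q
    · rw [hwQ z hzQ]
      exact hz hzQ
    · rw [hw0 z hzQ]
      simp
  obtain ⟨δ₁, hδ₁, hδ₁Q⟩ := φ.hasCompactSupport.exists_cthickening_subset_open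
    (cylinder T Ω).isOpen φ.tsupport_subset
  -- Half of the margin, since the translation estimate consumes twice the kernel radius.
  have hδ₀ : 0 < δ₁ / 2 := by positivity
  have hφδ : ∀ z ∈ tsupport φ, Metric.closedBall z (2 * (δ₁ / 2)) ⊆ Q := fun z hz => by
    rw [mul_div_cancel₀ _ two_ne_zero]
    exact (Metric.closedBall_subset_cthickening hz _).trans hδ₁Q
  obtain ⟨η', ρ', d', C, hη', hρ', hd', hd0', hdδ', hCt, hC'⟩ := exists_product_kernel_seq N hδ₀
  obtain ⟨ns, hns, hlim⟩ := exists_subseq_mollify_ae_tendsto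
    (k := fun n (z : ℝ × Sp N) => η' n z.1 * ρ' n z.2) (fun n => (hη' n).prod (hρ' n)) hd' hw
  set η : ℕ → ℝ → ℝ := fun n => η' (ns n)
  set ρ : ℕ → Sp N → ℝ := fun n => ρ' (ns n)
  set d : ℕ → ℝ := fun n => d' (ns n)
  have hη : ∀ n, IsKernel volume (η n) (d n) := fun n => hη' _
  have hρ : ∀ n, IsKernel volume (ρ n) (d n) := fun n => hρ' _
  have hd : Tendsto d atTop (𝓝 0) := hd'.comp hns.tendsto_atTop
  set k : ℕ → ℝ × Sp N → ℝ := fun n z => η n z.1 * ρ n z.2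
  have hk : ∀ n, IsKernel volume (k n) (d n) := fun n => (hη n).prod (hρ n)
  have htr := tendsto_integral_transport hpq hΩ hV hdivV hdivV_bdd hk hd hδ₀ (fun n => hdδ' _) hCt
    (fun n => hC' _) φ hφδ hwL hw01 hw0 hlim hβ
  have huV : (Q.indicator fun z => w z • V z.2) = Q.indicator fun z => u z.1 z.2 • V z.2 :=
    indicator_congr fun z hz => by rw [hwQ z hz]
  rw [← hQdef, huV] at htr
  have hQwu : ∀ {A : ℝ → ℝ × Sp N → ℝ}, ∫ z in Q, A (w z) z = ∫ z in Q, A (u z.1 z.2) z :=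
    setIntegral_congr_fun hQ fun z hz => by simp only [hwQ z hz]
  rw [hQwu (A := fun r z => divV z.2 * (φ z * β r)),
    hQwu (A := fun r z => β r * fderiv ℝ φ z (0, V z.2)),
    hQwu (A := fun r z => φ z * deriv β r * r * divV z.2)] at htr
  set B : ℝ × Sp N → Sp N := Q.indicator fun z => u z.1 z.2 • V z.2
  have hB : Integrable B :=
    (integrable_indicator_iff hQ).2 ((h.memLp_smul (memLp_snd hV.memLp)).integrable hs1)
  set U : ℕ → ℝ × Sp N → ℝ := fun n => mollify volume (k n) w
  obtain ⟨M₀, hM₀⟩ := exists_bound_Icc hβ.continuous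
  have hβ' : Continuous (deriv β) := hβ.continuous_deriv le_rfl
  obtain ⟨M₁, hM₁⟩ := exists_bound_Icc hβ'
  obtain ⟨Cφ, hCφ⟩ := φ.hasCompactSupport.exists_bound_of_continuous φ.continuous
  have hCφ0 : 0 ≤ Cφ := (norm_nonneg _).trans (hCφ 0)
  have hφ1 : ContDiff ℝ 1 φ := φ.contDiff.of_le (by simp)
  have hmc : ∀ {g : ℝ × Sp N → ℝ} (n), Integrable g → Continuous (mollify volume (k n) g) :=
    fun n hg => (contDiff_mollify (hk n).contDiff (hk n).hasCompactSupport
      hg.locallyIntegrable).continuous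
  have hUs : ∀ n, ContDiff ℝ 1 (U n) := fun n =>
    (contDiff_mollify (hk n).contDiff (hk n).hasCompactSupport hw.locallyIntegrable).of_le (by simp)
  have hU01 : ∀ n z, U n z ∈ Icc (0 : ℝ) 1 := fun n =>
    (hk n).mollify_mem_Icc hw.locallyIntegrable hw01
  have hφ0 : ∀ z ∉ tsupport φ, φ z = 0 := fun z hz => image_eq_zero_of_notMem_tsupport hz
  set b : ℕ → ℝ × Sp N → ℝ := fun n z => φ z * deriv β (U n z)
  have hbc : ∀ n, Continuous (b n) := fun n =>
    φ.continuous.mul (hβ'.comp (hUs n).continuous)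
  have hbs : ∀ n, HasCompactSupport (b n) := fun n => φ.hasCompactSupport.mul_right
  have hbM : ∀ n z, ‖b n z‖ ≤ Cφ * M₁ := fun n z => by
    rw [norm_mul]
    exact mul_le_mul (hCφ z) (hM₁ _ (hU01 n z)) (norm_nonneg _) hCφ0
  have hblim : ∀ᵐ z, Tendsto (fun n => b n z) atTop (𝓝 (φ z * deriv β (w z))) := by
    filter_upwards [hlim] with z hz
    exact ((hβ'.tendsto _).comp hz).const_mul _
  have hφi : ∀ {g : ℝ × Sp N → ℝ}, Continuous g → Integrable fun z => φ z * g z := fun hg =>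
    (φ.continuous.mul hg).integrable_of_hasCompactSupport φ.hasCompactSupport.mul_right
  have hbi : ∀ {g : ℝ × Sp N → ℝ} (n), Continuous g → Integrable fun z => b n z * g z :=
    fun n hg => ((hbc n).mul hg).integrable_of_hasCompactSupport (hbs n).mul_right
  have hdc : ∀ {g : ℝ × Sp N → Sp N} (n), Integrable g → Continuous (mollifyDiv (k n) g) :=
    fun n hg => continuous_mollifyDiv (hk n).contDiff (hk n).hasCompactSupport hg.locallyIntegrable
  -- the inequality for the mollified solution
  have hle : ∀ n, -(∫ z, β (U n z) * fderiv ℝ φ z (1, 0))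
      ≤ (∫ z, φ z * mollifyDiv (k n) P z) + (∫ z, φ z * mollify volume (k n) G z)
        + (∫ z, b n z * mollify volume (k n) F z) - (∫ z, b n z * mollify volume (k n) G z)
        - ∫ z, b n z * mollifyDiv (k n) B z := fun n => by
    have j1 := hφi (hdc n hP)
    have j2 := hφi (hmc n hG)
    have j3 := hbi n (hmc n hF)
    have j4 := hbi n (hmc n hG)
    have j5 := hbi n (hdc n hB)
    have e1 := integral_add j1 j2
    have e2 := integral_add (j1.add j2) j3
    have e3 := integral_sub ((j1.add j2).add j3) j4
    have e4 := integral_sub (((j1.add j2).add j3).sub j4) j5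
    simp only [Pi.add_apply, Pi.sub_apply] at e2 e3 e4
    rw [← e1, ← e2, ← e3, ← e4]
    have hβU : ContDiff ℝ 1 fun z => β (U n z) := hβ.comp (hUs n)
    have e5 := integral_mul_fderiv_eq_neg hφ1 hβU φ.hasCompactSupport (1, 0)
    have e6 : ∫ z, β (U n z) * fderiv ℝ φ z (1, 0) = ∫ z, fderiv ℝ φ z (1, 0) * β (U n z) := by
      simp only [mul_comm]
    rw [e6, ← e5]
    refine integral_mono (hφi ((hβU.continuous_fderiv one_ne_zero).clm_apply continuous_const))
      ((((j1.add j2).add j3).sub j4).sub j5) fun z => ?_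
    have e7 : fderiv ℝ (fun z => β (U n z)) z (1, 0)
        = deriv β (U n z) * fderiv ℝ (U n) z (1, 0) := by
      have h2 : HasFDerivAt (fun z => β (U n z)) _ z :=
        ((hβ.differentiable one_ne_zero (U n z)).hasDerivAt).comp_hasFDerivAt z
          ((hUs n).differentiable one_ne_zero z).hasFDerivAt
      rw [h2.fderiv]
      simp
    simp only [e7]
    by_cases hz : z ∈ tsupport φ
    · have hzb : Metric.closedBall z (d n) ⊆ Q :=
        (Metric.closedBall_subset_closedBall (by linarith [hdδ' (ns n)])).trans (hφδ z hz)
      have a1 : fderiv ℝ (U n) z (1, 0) = mollify volume (k n) F z + mollifyDiv (k n) P z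
          - mollifyDiv (k n) B z :=
        h.fderiv_mollify_eq hp hΩ hV hf (hη n) (hρ n) (hd0' _).le hzb
      have a2 : 0 ≤ mollifyDiv (k n) P z + mollify volume (k n) G z :=
        h.mollifyDiv_pflux_nonneg hp hΩ hV hdivV hdivV_bdd hf (hη n) (hρ n) (hd0' _).le hzb
      -- The central step: a nonnegative quantity is multiplied by $\beta'(U_n)\le 1$, so
      -- $\beta'(U_n)(\Delta_p v)_n \le (\Delta_p v)_n + G_n - \beta'(U_n)G_n$, the index denoting
      -- mollification. No lower bound on $\beta'$ is involved.
      have a3 := mul_le_mul_of_nonneg_right (hβ_le (U n z)) a2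
      have a4 := mul_le_mul_of_nonneg_left a3 (hφ z)
      rw [a1]
      simp only [b]
      linarith
    · simp [b, hφ0 z hz]
  -- passage to the limit
  have hφ' : Continuous fun z => fderiv ℝ φ z (1, 0) :=
    (hφ1.continuous_fderiv one_ne_zero).clm_apply continuous_const
  have hφ'i : Integrable fun z => fderiv ℝ φ z (1, 0) :=
    hφ'.integrable_of_hasCompactSupport (φ.hasCompactSupport.fderiv_apply ℝ _)
  have l0 : Tendsto (fun n => ∫ z, β (U n z) * fderiv ℝ φ z (1, 0)) atTop
      (𝓝 (∫ z, β (w z) * fderiv ℝ φ z (1, 0))) := by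
    refine tendsto_integral_mul_of_bounded
      (fun n => (hβ.continuous.comp (hUs n).continuous).aestronglyMeasurable)
      (fun n => ae_of_all _ fun z => hM₀ _ (hU01 n z)) ?_ (fun _ => hφ'i) hφ'i (by simp)
    filter_upwards [hlim] with z hz using (hβ.continuous.tendsto _).comp hz
  have l1 := tendsto_integral_mul_mollifyDiv hk hd hP hφ1 φ.hasCompactSupport
  have l2 : Tendsto (fun n => ∫ z, φ z * mollify volume (k n) G z) atTop (𝓝 (∫ z, φ z * G z)) :=
    tendsto_integral_mul_of_bounded (fun n => φ.continuous.aestronglyMeasurable)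
      (fun n => ae_of_all _ hCφ) (ae_of_all _ fun z => tendsto_const_nhds)
      (fun n => (hk n).integrable_mollify hG) hG (tendsto_integral_mollify_sub hk hd hG)
  have lb : ∀ {g : ℝ × Sp N → ℝ}, Integrable g →
      Tendsto (fun n => ∫ z, b n z * mollify volume (k n) g z) atTop
        (𝓝 (∫ z, φ z * deriv β (w z) * g z)) := fun hg =>
    tendsto_integral_mul_of_bounded (fun n => (hbc n).aestronglyMeasurable)
      (fun n => ae_of_all _ (hbM n)) hblim
      (fun n => (hk n).integrable_mollify hg) hg (tendsto_integral_mollify_sub hk hd hg)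
  have hlimit := le_of_tendsto_of_tendsto' l0.neg
    ((((l1.add l2).add (lb hF)).sub (lb hG)).sub htr) hle
  -- The two remainders with `G` cancel in the limit: where `G` is nonzero, $v>0$, hence $u=1$ and
  -- $\beta'(u)=\beta'(1)=1$.
  have hGG : ∫ z, φ z * deriv β (w z) * G z = ∫ z, φ z * G z := by
    refine integral_congr_ae ?_
    filter_upwards [(ae_restrict_iff' hQ).1 h.ae_eq_one] with z hz
    by_cases hzQ : z ∈ Q
    · by_cases hv : 0 < v z.1 z.2
      · rw [hwQ z hzQ, hz hzQ hv, hβ_one, mul_one]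
      · simp [G, indicator_of_mem hzQ, indicator_of_notMem (s := Ioi (0 : ℝ)) hv]
    · simp [G, indicator_of_notMem hzQ]
  have toQ : ∀ {A A' : ℝ × Sp N → ℝ}, (∀ z ∉ tsupport φ, A' z = 0) → (∀ z ∈ Q, A z = A' z) →
      ∫ z in Q, A z = ∫ z, A' z := fun hA' hAA' =>
    (setIntegral_congr_fun hQ hAA').trans
      (setIntegral_eq_integral_of_tsupport_subset φ.tsupport_subset hA')
  rw [toQ (A' := fun z => β (w z) * fderiv ℝ φ z (1, 0))
      (fun z hz => by rw [fderiv_eq_zero_of_notMem_tsupport hz]; exact mul_zero _)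
      fun z hz => by simp only [hwQ z hz],
    toQ (A' := fun z => fderiv ℝ φ z (0, P z))
      (fun z hz => by rw [fderiv_eq_zero_of_notMem_tsupport hz]; rfl)
      fun z hz => by simp only [hPQ z hz],
    toQ (A' := fun z => φ z * deriv β (w z) * F z)
      (fun z hz => by rw [hφ0 z hz]; ring)
      fun z hz => by simp only [hwQ z hz, hFQ z hz]; ring]
  rw [hGG] at hlimit
  linarith

end Renormalization

end CrowdMotion

/-! ### Local integrability and the inequality in the sense of distributions -/

theorem proposition3p1 {N : ℕ} (hN : 1 ≤ N) (p : ℝ) (hp : 2 < p) (T : ℝ) (hT : 0 < T)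
    (Ω : Opens (CrowdMotion.Sp N)) (hΩ : Bornology.IsBounded (Ω : Set (CrowdMotion.Sp N)))
    (hΩ_reg : CrowdMotion.HasLipschitzBoundary (Ω : Set (CrowdMotion.Sp N)))
    (ΓD ΓN : Set (CrowdMotion.Sp N))
    (hΓ_union : ΓD ∪ ΓN = frontier (Ω : Set (CrowdMotion.Sp N))) (hΓ_disj : Disjoint ΓD ΓN)
    (hΓ_meas : MeasurableSet ΓD)
    (hΓD : 0 < CrowdMotion.surface (Ω : Set (CrowdMotion.Sp N)) ΓD)
    (V : CrowdMotion.Sp N → CrowdMotion.Sp N) (divV : CrowdMotion.Sp N → ℝ)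
    (hV : CrowdMotion.MemW1Vec (ENNReal.ofReal (p / (p - 1))) Ω V)
    (hdivV : CrowdMotion.HasWeakDivergence Ω V divV)
    (hdivV_bdd : MemLp divV ⊤ (volume.restrict (Ω : Set (CrowdMotion.Sp N))))
    (f : ℝ → CrowdMotion.Sp N → ℝ)
    (hf : IntegrableOn (fun z : ℝ × CrowdMotion.Sp N => f z.1 z.2)
      (CrowdMotion.cylinder T Ω : Set (ℝ × CrowdMotion.Sp N)))
    (u₀ : CrowdMotion.Sp N → ℝ)
    (hu₀ : MemLp u₀ ⊤ (volume.restrict (Ω : Set (CrowdMotion.Sp N))))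
    (u v : ℝ → CrowdMotion.Sp N → ℝ) (Dv : ℝ → CrowdMotion.Sp N → CrowdMotion.Sp N)
    (huv : CrowdMotion.IsWeakSolution p T Ω ΓD V f u₀ u v Dv)
    (β : ℝ → ℝ) (hβ : ContDiff ℝ 1 β) (hβ_le : ∀ r, deriv β r ≤ 1) (hβ_one : deriv β 1 = 1) :
    -- all the functions that define the distributions below are locally integrable in `Q`
    (LocallyIntegrableOn (fun z : ℝ × CrowdMotion.Sp N => β (u z.1 z.2))
        (CrowdMotion.cylinder T Ω : Set (ℝ × CrowdMotion.Sp N)) ∧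
      LocallyIntegrableOn (fun z : ℝ × CrowdMotion.Sp N => CrowdMotion.pflux p (Dv z.1 z.2))
        (CrowdMotion.cylinder T Ω : Set (ℝ × CrowdMotion.Sp N)) ∧
      LocallyIntegrableOn (fun z : ℝ × CrowdMotion.Sp N => β (u z.1 z.2) • V z.2)
        (CrowdMotion.cylinder T Ω : Set (ℝ × CrowdMotion.Sp N)) ∧
      LocallyIntegrableOn (fun z : ℝ × CrowdMotion.Sp N => β (u z.1 z.2) * divV z.2)
        (CrowdMotion.cylinder T Ω : Set (ℝ × CrowdMotion.Sp N)) ∧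
      LocallyIntegrableOn (fun z : ℝ × CrowdMotion.Sp N => u z.1 z.2 * divV z.2 * deriv β (u z.1 z.2))
        (CrowdMotion.cylinder T Ω : Set (ℝ × CrowdMotion.Sp N)) ∧
      LocallyIntegrableOn (fun z : ℝ × CrowdMotion.Sp N => f z.1 z.2 * deriv β (u z.1 z.2))
        (CrowdMotion.cylinder T Ω : Set (ℝ × CrowdMotion.Sp N))) ∧
    -- the inequality in the sense of distributions in `Q`
    ∀ φ : 𝓓(CrowdMotion.cylinder T Ω, ℝ), (∀ z, 0 ≤ φ z) →
      CrowdMotion.distTime (fun z => β (u z.1 z.2)) φ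
        - CrowdMotion.distDiv (fun z => CrowdMotion.pflux p (Dv z.1 z.2)) φ
        + CrowdMotion.distTransport V divV (fun z => β (u z.1 z.2)) φ
        + CrowdMotion.distFun (fun z => u z.1 z.2 * divV z.2 * deriv β (u z.1 z.2)) φ
      ≤ CrowdMotion.distFun (fun z => f z.1 z.2 * deriv β (u z.1 z.2)) φ := by
  have hfinQ := CrowdMotion.isFiniteMeasure_restrict_cylinder (T := T) hΩ
  have hpq := CrowdMotion.holderConjugate_div hp
  have hs1 := CrowdMotion.ofReal_one_le hpq.symm.lt.le
  have hloc : ∀ {F : Type} [NormedAddCommGroup F] {g : ℝ × CrowdMotion.Sp N → F},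
      IntegrableOn g (CrowdMotion.cylinder T Ω : Set (ℝ × CrowdMotion.Sp N)) →
      LocallyIntegrableOn g (CrowdMotion.cylinder T Ω : Set (ℝ × CrowdMotion.Sp N)) :=
    fun hg => hg.locallyIntegrableOn
  have hu01 := huv.ae_mem_Icc
  have hβ' : Continuous (deriv β) := hβ.continuous_deriv le_rfl
  obtain ⟨M₀, hM₀⟩ := CrowdMotion.exists_bound_Icc hβ.continuous
  obtain ⟨M₁, hM₁⟩ := CrowdMotion.exists_bound_Icc hβ'
  have hum := huv.u_bdd.1
  have hβm := hβ.continuous.comp_aestronglyMeasurable hum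
  have hβm' := hβ'.comp_aestronglyMeasurable hum
  have hβM : ∀ᵐ z ∂(volume.restrict (CrowdMotion.cylinder T Ω : Set (ℝ × CrowdMotion.Sp N))),
      ‖β (u z.1 z.2)‖ ≤ M₀ := hu01.mono fun z hz => hM₀ _ hz
  have hβM' : ∀ᵐ z ∂(volume.restrict (CrowdMotion.cylinder T Ω : Set (ℝ × CrowdMotion.Sp N))),
      ‖deriv β (u z.1 z.2)‖ ≤ M₁ := hu01.mono fun z hz => hM₁ _ hz
  have hVi : IntegrableOn (fun z : ℝ × CrowdMotion.Sp N => V z.2)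
      (CrowdMotion.cylinder T Ω : Set (ℝ × CrowdMotion.Sp N)) :=
    (CrowdMotion.memLp_snd hV.memLp).integrable hs1
  have hdi : IntegrableOn (fun z : ℝ × CrowdMotion.Sp N => divV z.2)
      (CrowdMotion.cylinder T Ω : Set (ℝ × CrowdMotion.Sp N)) :=
    (CrowdMotion.memLp_snd hdivV_bdd).integrable le_top
  have i1 : IntegrableOn (fun z : ℝ × CrowdMotion.Sp N => β (u z.1 z.2))
      (CrowdMotion.cylinder T Ω : Set (ℝ × CrowdMotion.Sp N)) :=
    Integrable.of_bound hβm M₀ hβM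
  have i2 : IntegrableOn (fun z : ℝ × CrowdMotion.Sp N => CrowdMotion.pflux p (Dv z.1 z.2))
      (CrowdMotion.cylinder T Ω : Set (ℝ × CrowdMotion.Sp N)) :=
    (huv.memLp_pflux hp).integrable hs1
  have i3 : IntegrableOn (fun z : ℝ × CrowdMotion.Sp N => β (u z.1 z.2) • V z.2)
      (CrowdMotion.cylinder T Ω : Set (ℝ × CrowdMotion.Sp N)) :=
    hVi.bdd_smul M₀ hβm hβM
  have i4 : IntegrableOn (fun z : ℝ × CrowdMotion.Sp N => β (u z.1 z.2) * divV z.2)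
      (CrowdMotion.cylinder T Ω : Set (ℝ × CrowdMotion.Sp N)) :=
    hdi.bdd_mul (c := M₀) hβm hβM
  have i5 : IntegrableOn (fun z : ℝ × CrowdMotion.Sp N =>
      u z.1 z.2 * divV z.2 * deriv β (u z.1 z.2))
      (CrowdMotion.cylinder T Ω : Set (ℝ × CrowdMotion.Sp N)) := by
    refine (hdi.bdd_mul (c := 1) hum ?_).mul_bdd (c := M₁) hβm' hβM'
    filter_upwards [hu01] with z hz
    rw [Real.norm_of_nonneg hz.1]
    exact hz.2
  have i6 : IntegrableOn (fun z : ℝ × CrowdMotion.Sp N => f z.1 z.2 * deriv β (u z.1 z.2))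
      (CrowdMotion.cylinder T Ω : Set (ℝ × CrowdMotion.Sp N)) :=
    hf.mul_bdd (c := M₁) hβm' hβM'
  refine ⟨⟨hloc i1, hloc i2, hloc i3, hloc i4, hloc i5, hloc i6⟩, fun φ hφ => ?_⟩
  have key := huv.renormalized_le hp hΩ hV hdivV hdivV_bdd hf hβ hβ_le hβ_one φ hφ
  have hφd : ∀ z, DifferentiableAt ℝ φ z := fun z =>
    φ.contDiff.differentiable (by simp) z
  -- Time derivatives and spatial gradients of slices become values of the full derivative in the
  -- directions $(1,0)$ and $(0,a)$, the form in which the inequality was proved.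
  simp only [CrowdMotion.distTime, CrowdMotion.distDiv, CrowdMotion.distTransport,
    CrowdMotion.distFun, CrowdMotion.fderiv_apply_zero_right (hφd _),
    CrowdMotion.inner_gradient_slice (hφd _)]
  have e1 : ∀ z : ℝ × CrowdMotion.Sp N,
      β (u z.1 z.2) * divV z.2 * φ z = divV z.2 * (φ z * β (u z.1 z.2)) := fun z => by ring
  have e2 : ∀ z : ℝ × CrowdMotion.Sp N, u z.1 z.2 * divV z.2 * deriv β (u z.1 z.2) * φ z
      = φ z * deriv β (u z.1 z.2) * u z.1 z.2 * divV z.2 := fun z => by ring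
  have e3 : ∀ z : ℝ × CrowdMotion.Sp N, fderiv ℝ φ z (0, β (u z.1 z.2) • V z.2)
      = β (u z.1 z.2) * fderiv ℝ φ z (0, V z.2) := fun z => by
    rw [← smul_eq_mul, ← map_smul, Prod.smul_mk, smul_zero]
  simp only [e1, e2, e3]
  linarith
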